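/- Let $M$ be a complex manifold of dimension $d$ with a smooth Hermitian metric $g$, let $(L,h)$ be a holomorphic line bundle on $M$ with a smooth Hermitian metric, and let $R^L=R_{i\bar j}\,dz^i\wedge d\bar z^j$ be its Chern curvature. Let $R=R_i^j\,dz^i\otimes\partial_j$, $R_i^j=R_{i\bar s}g^{j\bar s}$, be the endomorphism of $T^{1,0}M$ obtained from $R^L$ by type change; it is self-adjoint, and $\lambda_1(z)\ge\cdots\ge\lambda_d(z)$ denote its eigenvalues at $z$, with multiplicity. Let $1\le p<d$ and assume $\lambda_p(z)>\lambda_{p+1}(z)$ for every $z\in M$. Let $\Lambda$ be the adjoint of the wedge product with $\sqrt{-1}g_{i\bar j}\,dz^i\wedge d\bar z^j$, let $F_p\subset\bigwedge^{p,0}$ be the line bundle whose fibre at each point is the eigenspace of $[\sqrt{-1}R^L,\Lambda]$ on $\bigwedge^{p,0}$ for its largest eigenvalue, and let $\Psi^{F_p}=|\psi|^{-2}\,\psi\otimes\psi^*$, where $\psi$ is any local nonvanishing section of $F_p$ and $\psi^*$ is its metric dual; this is a section of the holomorphic bundle $\bigwedge^{p,0}\otimes(\bigwedge^{p,0})^*$.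 For a section $A$ of a holomorphic bundle built from $T^{1,0}M$ (or a function), $|\bar\partial A|^2$ is the pointwise squared norm of $\bar\partial A$ induced by $g$, so that at a point where $(\partial_i)$ is unitary it is the sum of $|\partial_{\bar k}a|^2$ over all $k$ and all coefficients $a$ of $A$ in the coordinate frame; $|R|$ is the pointwise (Hilbert–Schmidt) norm of $R$. Then the coefficients of $\Psi^{F_p}$ in holomorphic frames are differentiable, and: 1. If $z_0\in M$ and $(z^1,\dots,z^d)$ are holomorphic coordinates near $z_0$ such that $\partial_1|_{z_0},\dots,\partial_d|_{z_0}$ is a unitary basis of $T^{1,0}_{z_0}M$ with $R\,\partial_i|_{z_0}=\lambda_i(z_0)\,\partial_i|_{z_0}$ for all $i$, then $$|\bar\partial\Psi^{F_p}|^2(z_0)=\sum_{i\le p}\ \sum_{j\ge p+1}(\lambda_i-\lambda_j)^{-2}\left(|\bar\partial R^i_j|^2+|\bar\partial R^j_i|^2\right)(z_0).$$ 2. At every point of $M$, $$|\bar\partial\Psi^{F_p}|^2\le(\lambda_p-\lambda_{p+1})^{-2}\,|\bar\partial R|^2 .$$ 3. (a) At every point of $M$, $$|\bar\partial\Psi^{F_p}|^2\le(\lambda_p-\lambda_{p+1})^{-2}\left(|\bar\partial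 R|^2-\tfrac1d\,|\bar\partial\operatorname{Tr}R|^2\right).$$ (b) At every point where $|R|\ne0$, $$|\bar\partial\Psi^{F_p}|^2\le(\lambda_p-\lambda_{p+1})^{-2}\left(|\bar\partial R|^2-\big|\bar\partial|R|\big|^2\right).$$ -/

import Mathlib

open scoped ContDiff Manifold Bundle ComplexConjugate

noncomputable section

/-! ### Pointwise linear algebra

`T` stands for a holomorphic tangent space `T^{1,0}`, a complex vector space. A sesquilinear form is
linear in the first and conjugate linear in the second variable, so that `g_{i j̄} = g(∂_i, ∂_j)`. -/

section PointwiseAlgebra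

variable {T : Type*} [AddCommGroup T] [Module ℂ T] {d : ℕ}

/-- A basis `b` is unitary for `g` if `g(b_i, b_j) = δ_{ij}`. -/
def IsUnitaryFrame (g : T →ₗ[ℂ] T →ₗ⋆[ℂ] ℂ) (b : Fin d → T) : Prop :=
  ∀ i j, g (b i) (b j) = if i = j then 1 else 0

/-- Gram-Schmidt: a Hermitian inner product has a unitary basis. -/
theorem exists_unitaryFrame [FiniteDimensional ℂ T] (hd : Module.finrank ℂ T = d)
    (g : T →ₗ[ℂ] T →ₗ⋆[ℂ] ℂ) (hsymm : ∀ v w, conj (g v w) = g w v)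
    (hpos : ∀ v, v ≠ 0 → 0 < (g v v).re) :
    ∃ b : Module.Basis (Fin d) ℂ T, IsUnitaryFrame g b := by
  let core : InnerProductSpace.Core ℂ T :=
    { inner := fun v w => g w v
      conj_inner_symm := fun v w => hsymm v w
      re_inner_nonneg := fun v => by
        by_cases hv : v = 0
        · simp [hv]
        · exact (hpos v hv).le
      add_left := fun u v w => by simp
      smul_left := fun u v r => by simp
      definite := fun v hv => by
        by_contra hne
        have := hpos v hne
        rw [hv] at this
        simp at this }
  let _ : NormedAddCommGroup T := core.toNormedAddCommGroup
  let _ : InnerProductSpace ℂ T := InnerProductSpace.ofCore core.toCore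
  let b := (stdOrthonormalBasis ℂ T).reindex (finCongr hd)
  refine ⟨b.toBasis, fun i j => ?_⟩
  have h := (orthonormal_iff_ite (𝕜 := ℂ)).1 b.orthonormal j i
  have h' : inner ℂ (b j) (b i) = g (b i) (b j) := rfl
  rw [OrthonormalBasis.coe_toBasis, ← h', h]
  simp only [eq_comm]

/-- The space `T^{0,1}*` of conjugate linear functionals on `T`. -/
abbrev ConjDual (T : Type*) [AddCommGroup T] [Module ℂ T] := T →ₗ⋆[ℂ] ℂ

/-- The conjugate `η̄` of a `(1,0)`-covector `η`. -/
def conjCovector (η : Module.Dual ℂ T) : ConjDual T where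
  toFun v := conj (η v)
  map_add' := by simp
  map_smul' := by simp

/-- The sesquilinear form `(v, w) ↦ η(v) conj(ζ(w))`, which is the coefficient form of the
`(1,1)`-covector `η ∧ ζ̄`. -/
def sesqOf (η ζ : Module.Dual ℂ T) : T →ₗ[ℂ] T →ₗ⋆[ℂ] ℂ :=
  LinearMap.smulRight η (conjCovector ζ)

/-- The type change of a sesquilinear form `Q = Q_{i j̄}` by the metric for which `b` is unitary: the
endomorphism with `g(A v, w) = Q(v, w)`. -/
def typeChange (b : Module.Basis (Fin d) ℂ T) (Q : T →ₗ[ℂ] T →ₗ⋆[ℂ] ℂ) : T →ₗ[ℂ] T :=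
  ∑ k, (Q.flip (b k)).smulRight (b k)

theorem typeChange_spec (g : T →ₗ[ℂ] T →ₗ⋆[ℂ] ℂ) (b : Module.Basis (Fin d) ℂ T)
    (hb : IsUnitaryFrame g b) (Q : T →ₗ[ℂ] T →ₗ⋆[ℂ] ℂ) (v w : T) :
    g (typeChange b Q v) w = Q v w := by
  have h : g (typeChange b Q v) = Q v := by
    refine b.ext fun j => ?_
    simp [typeChange, hb _ _]
  rw [h]

/-- The algebra `Λ^{•,•}` of all covectors, the exterior algebra of `T^{1,0}* ⊕ T^{0,1}*`. -/
abbrev Forms (T : Type*) [AddCommGroup T] [Module ℂ T] :=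
  ExteriorAlgebra ℂ (Module.Dual ℂ T × ConjDual T)

/-- Exterior multiplication by a (complex) covector of degree one. -/
def extMul (η : Module.Dual ℂ T × ConjDual T) : Module.End ℂ (Forms T) :=
  LinearMap.mulLeft ℂ (ExteriorAlgebra.ι ℂ η)

/-- Evaluation of covectors of degree one at the vector `v ∈ T^{1,0}`. -/
def evalHol (v : T) : Module.Dual ℂ (Module.Dual ℂ T × ConjDual T) where
  toFun η := η.1 v
  map_add' := by simp
  map_smul' := by simp

/-- Evaluation of covectors of degree one at the vector `v̄ ∈ T^{0,1}`. -/
def evalAntihol (v : T) : Module.Dual ℂ (Module.Dual ℂ T × ConjDual T) where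
  toFun η := η.2 v
  map_add' := by simp
  map_smul' := by simp

/-- Contraction: the antiderivation of `Λ^{•,•}` extending a functional on covectors of degree
one. -/
def contract (X : Module.Dual ℂ (Module.Dual ℂ T × ConjDual T)) : Module.End ℂ (Forms T) :=
  CliffordAlgebra.contractLeft X

/-- The operator `Q ∧ ·` for the `(1,1)`-covector `Q = Q_{i j̄} b^i ∧ b̄^j`. -/
def wedgeForm (b : Module.Basis (Fin d) ℂ T) (Q : T →ₗ[ℂ] T →ₗ⋆[ℂ] ℂ) :
    Module.End ℂ (Forms T) :=
  ∑ i, ∑ j, Q (b i) (b j) • (extMul (b.coord i, 0) * extMul (0, conjCovector (b.coord j)))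

/-- `Λ`, the adjoint of `L = √-1 ∑ b^i ∧ b̄^i ∧ ·` for the metric for which `b` is unitary. -/
def lefschetzAdjoint (b : Module.Basis (Fin d) ℂ T) : Module.End ℂ (Forms T) :=
  (-Complex.I) • ∑ k, contract (evalAntihol (b k)) * contract (evalHol (b k))

/-- The curvature operator `[√-1 Q, Λ]` on `Λ^{•,•}`. -/
def curvOperator (b : Module.Basis (Fin d) ℂ T) (Q : T →ₗ[ℂ] T →ₗ⋆[ℂ] ℂ) :
    Module.End ℂ (Forms T) :=
  (Complex.I • wedgeForm b Q) * lefschetzAdjoint b - lefschetzAdjoint b * (Complex.I • wedgeForm b Q)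

/-- `Λ^{p,0}`, the `p`-th exterior power of `T^{1,0}*`. -/
abbrev HolForms (p : ℕ) (T : Type*) [AddCommGroup T] [Module ℂ T] :=
  ⋀[ℂ]^p (Module.Dual ℂ T)

/-- The inclusion `Λ^{p,0} ⊂ Λ^{•,•}`. -/
def holIncl (p : ℕ) : HolForms p T →ₗ[ℂ] Forms T :=
  (ExteriorAlgebra.map (LinearMap.inl ℂ (Module.Dual ℂ T) (ConjDual T))).toLinearMap ∘ₗ
    (⋀[ℂ]^p (Module.Dual ℂ T)).subtype

/-- The largest eigenvalue of `[√-1 Q, Λ]` on `Λ^{p,0}`. -/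
def maxEigenvalue (p : ℕ) (b : Module.Basis (Fin d) ℂ T) (Q : T →ₗ[ℂ] T →ₗ⋆[ℂ] ℂ) : ℝ :=
  sSup {μ : ℝ | ∃ α : HolForms p T, α ≠ 0 ∧
    curvOperator b Q (holIncl p α) = (μ : ℂ) • holIncl p α}

/-- The eigenspace of `[√-1 Q, Λ]` on `Λ^{p,0}` for its largest eigenvalue. -/
def maxEigenspace (p : ℕ) (b : Module.Basis (Fin d) ℂ T) (Q : T →ₗ[ℂ] T →ₗ⋆[ℂ] ℂ) :
    Submodule ℂ (HolForms p T) :=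
  LinearMap.eqLocus (curvOperator b Q ∘ₗ holIncl p) ((maxEigenvalue p b Q : ℂ) • holIncl p)

/-- The basis `b^{i_1} ∧ ⋯ ∧ b^{i_p}`, `i_1 < ⋯ < i_p`, of `Λ^{p,0}`. -/
def holFormsBasis (p : ℕ) (b : Module.Basis (Fin d) ℂ T) :
    Module.Basis (Set.powersetCard (Fin d) p) ℂ (HolForms p T) :=
  b.dualBasis.exteriorPower p

/-- The metric induced on `Λ^{p,0}`: if `b` is unitary, the `b^{i_1} ∧ ⋯ ∧ b^{i_p}` are
orthonormal. -/
def holFormsInner (p : ℕ) (b : Module.Basis (Fin d) ℂ T) (α η : HolForms p T) : ℂ :=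
  ∑ I, (holFormsBasis p b).repr α I * conj ((holFormsBasis p b).repr η I)

/-- The endomorphism `|ψ|⁻² ψ ⊗ ψ*` of `Λ^{p,0}`, where `ψ*` is the metric dual of `ψ`. -/
def rankOne (p : ℕ) (b : Module.Basis (Fin d) ℂ T) (ψ : HolForms p T) :
    Module.End ℂ (HolForms p T) where
  toFun α := (holFormsInner p b ψ ψ)⁻¹ • holFormsInner p b α ψ • ψ
  map_add' α η := by
    simp only [holFormsInner, map_add, Finsupp.add_apply, add_mul, Finset.sum_add_distrib,
      add_smul, smul_add]
  map_smul' r α := by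
    simp only [holFormsInner, map_smul, Finsupp.smul_apply, smul_eq_mul, mul_assoc,
      ← Finset.mul_sum, RingHom.id_apply, smul_smul]
    ring_nf

/-- The real eigenvalues of an endomorphism, with algebraic multiplicity and in decreasing order:
`eigenvalueDesc A k` is the `k`-th largest one, `k = 1, 2, …`. -/
def eigenvalueDesc [FiniteDimensional ℂ T] (A : Module.End ℂ T) (k : ℕ) : ℝ :=
  ((A.charpoly.roots.map Complex.re).sort (· ≥ ·)).getD (k - 1) 0

end PointwiseAlgebra

/-! ### Hermitian manifolds and Hermitian holomorphic bundles -/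

/-- The model space `ℂ^d`. -/
abbrev Cn (d : ℕ) := EuclideanSpace ℂ (Fin d)

variable {d : ℕ} {M : Type*} [TopologicalSpace M] [ChartedSpace (Cn d) M]

/-- The holomorphic tangent space `T^{1,0}_x M`. -/
abbrev HolTangent (d : ℕ) {M : Type*} [TopologicalSpace M] [ChartedSpace (Cn d) M] (x : M) :=
  TangentSpace 𝓘(ℂ, Cn d) x

instance (x : M) : FiniteDimensional ℂ (HolTangent d x) :=
  inferInstanceAs (FiniteDimensional ℂ (Cn d))

theorem finrank_holTangent (x : M) : Module.finrank ℂ (HolTangent d x) = d :=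
  (finrank_euclideanSpace_fin : Module.finrank ℂ (Cn d) = d)

/-- A (real-)smooth Hermitian metric on a complex vector bundle `V` with fibre `F` over `M`. For
`V = T^{1,0} M` this is a Hermitian metric on the complex manifold `M`. -/
structure HermitianMetric (d : ℕ) {M : Type*} [TopologicalSpace M] [ChartedSpace (Cn d) M]
    (F : Type*) [NormedAddCommGroup F] [NormedSpace ℂ F]
    (V : M → Type*) [∀ x, AddCommGroup (V x)] [∀ x, Module ℂ (V x)]
    [TopologicalSpace (Bundle.TotalSpace F V)] [∀ x, TopologicalSpace (V x)]
    [FiberBundle F V] where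
  form : ∀ x, V x →ₗ[ℂ] V x →ₗ⋆[ℂ] ℂ
  conj_symm : ∀ x v w, conj (form x v w) = form x w v
  pos : ∀ x v, v ≠ 0 → 0 < (form x v v).re
  smooth : ∀ (e : Bundle.Trivialization F (Bundle.TotalSpace.proj : Bundle.TotalSpace F V → M))
    [MemTrivializationAtlas e] (u w : F),
    ContMDiffOn 𝓘(ℝ, Cn d) 𝓘(ℝ, ℂ) ∞ (fun x => form x (e.symm x u) (e.symm x w)) e.baseSet

/-- `∂f(v)` for a complex function `f` on `M`, at the point `x`. -/
def del (f : M → ℂ) (x : M) (v : HolTangent d x) : ℂ :=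
  let D : Cn d → ℂ := fun u => mfderiv 𝓘(ℝ, Cn d) 𝓘(ℝ, ℂ) f x u
  (D v - Complex.I * D (Complex.I • v)) / 2

/-- `∂̄f(v̄)` for a complex function `f` on `M`, at the point `x`. -/
def dbar (f : M → ℂ) (x : M) (v : HolTangent d x) : ℂ :=
  let D : Cn d → ℂ := fun u => mfderiv 𝓘(ℝ, Cn d) 𝓘(ℝ, ℂ) f x u
  (D v + Complex.I * D (Complex.I • v)) / 2

/-- The coordinate vector field `∂_i` of the chart `c`. -/
def coordVec (c : OpenPartialHomeomorph M (Cn d)) (x : M) (i : Fin d) : HolTangent d x :=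
  mfderiv 𝓘(ℂ, Cn d) 𝓘(ℂ, Cn d) c.symm (c x) (EuclideanSpace.single i (1 : ℂ) : Cn d)

/-- The coordinate form `dz^i` of the chart `c`. -/
def coordForm (c : OpenPartialHomeomorph M (Cn d)) (x : M) (i : Fin d) :
    Module.Dual ℂ (HolTangent d x) :=
  (EuclideanSpace.proj i : Cn d →L[ℂ] ℂ).toLinearMap ∘ₗ
    (mfderiv 𝓘(ℂ, Cn d) 𝓘(ℂ, Cn d) c x).toLinearMap

/-- The isomorphism `T^{1,0}_x M → T^{1,0}_y M` that identifies the coordinate vectors of the chart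
`c`; for fixed `x` it is a holomorphic trivialization of `T^{1,0} M` near `x`, the identity at `x`. -/
def chartTransport (c : OpenPartialHomeomorph M (Cn d)) (x y : M) :
    HolTangent d x →ₗ[ℂ] HolTangent d y :=
  (mfderiv 𝓘(ℂ, Cn d) 𝓘(ℂ, Cn d) c.symm (c y)).toLinearMap ∘ₗ
    (mfderiv 𝓘(ℂ, Cn d) 𝓘(ℂ, Cn d) c x).toLinearMap

section Metric

variable [IsManifold 𝓘(ℂ, Cn d) ω M] (g : HermitianMetric d (Cn d) (HolTangent d : M → Type))

/-- A unitary basis of `T^{1,0}_x M`. -/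
def unitaryFrame (x : M) : Module.Basis (Fin d) ℂ (HolTangent d x) :=
  (exists_unitaryFrame (finrank_holTangent x) (g.form x) (g.conj_symm x) (g.pos x)).choose

theorem unitaryFrame_isUnitary (x : M) : IsUnitaryFrame (g.form x) (unitaryFrame g x) :=
  (exists_unitaryFrame (finrank_holTangent x) (g.form x) (g.conj_symm x) (g.pos x)).choose_spec

/-- `|∂̄f|²` at `x` for a complex function `f` on `M`. -/
def normSqDbar (f : M → ℂ) (x : M) : ℝ :=
  ∑ k, ‖dbar f x (unitaryFrame g x k)‖ ^ 2

/-- `|∂̄A|²` at `x` for a section `A` of the holomorphic bundle `End(T^{1,0} M)`: `∂̄` is applied to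
the coefficients of `A` in a holomorphic frame that is unitary at `x`. -/
def normSqDbarEnd (A : ∀ y : M, Module.End ℂ (HolTangent d y)) (x : M) : ℝ :=
  let c := chartAt (Cn d) x
  let b := unitaryFrame g x
  ∑ i, ∑ j, normSqDbar g
    (fun y => b.coord j (chartTransport c y x (A y (chartTransport c x y (b i))))) x

/-- The coefficients of a section `Ψ` of the holomorphic bundle `End(Λ^{p,0}) = Λ^{p,0} ⊗ Λ_{p,0}` in
the holomorphic frame that extends the basis of `Λ^{p,0}_x` given by the basis `b` of `T^{1,0}_x M`
constantly in the chart `c`. -/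
def endFormsCoeff {p : ℕ} (Ψ : ∀ y : M, Module.End ℂ (HolForms p (HolTangent d y)))
    (c : OpenPartialHomeomorph M (Cn d)) (x : M) (b : Module.Basis (Fin d) ℂ (HolTangent d x))
    (I J : Set.powersetCard (Fin d) p) (y : M) : ℂ :=
  (holFormsBasis p b).coord J
    (exteriorPower.map p (chartTransport c x y).dualMap
      (Ψ y (exteriorPower.map p (chartTransport c y x).dualMap (holFormsBasis p b I))))

/-- `|∂̄Ψ|²` at `x` for a section `Ψ` of the holomorphic bundle `Λ^{p,0} ⊗ Λ_{p,0}`. -/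
def normSqDbarEndForms {p : ℕ} (Ψ : ∀ y : M, Module.End ℂ (HolForms p (HolTangent d y)))
    (x : M) : ℝ :=
  ∑ I, ∑ J, normSqDbar g (endFormsCoeff Ψ (chartAt (Cn d) x) x (unitaryFrame g x) I J) x

end Metric

/-! ### The curvature of a Hermitian line bundle and the twisting section -/

section LineBundle

variable {L : M → Type*} [∀ x, AddCommGroup (L x)] [∀ x, Module ℂ (L x)]
  [TopologicalSpace (Bundle.TotalSpace ℂ L)] [∀ x, TopologicalSpace (L x)] [FiberBundle ℂ L]
  [IsManifold 𝓘(ℂ, Cn d) ω M]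
  (g : HermitianMetric d (Cn d) (HolTangent d : M → Type)) (h : HermitianMetric d ℂ L)

/-- `|s|²_h` for the frame `s` of `L` given by the local trivialization `e`. -/
def frameNormSq (e : Bundle.Trivialization ℂ (Bundle.TotalSpace.proj : Bundle.TotalSpace ℂ L → M))
    (y : M) : ℂ :=
  h.form y (e.symm y 1) (e.symm y 1)

/-- The coefficient `θ_i` of the connection form `θ = |s|⁻² ∂|s|²` of the Chern connection of `(L, h)`
in the chart `c` and the holomorphic frame `s` given by `e`. -/
def chernConnectionCoeff (c : OpenPartialHomeomorph M (Cn d))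
    (e : Bundle.Trivialization ℂ (Bundle.TotalSpace.proj : Bundle.TotalSpace ℂ L → M))
    (i : Fin d) (y : M) : ℂ :=
  (frameNormSq h e y)⁻¹ * del (frameNormSq h e) y (coordVec c y i)

/-- The Chern curvature `R^L = dθ = ∂̄θ = R_{i j̄} dz^i ∧ dz̄^j` of `(L, h)` at `x`, as the sesquilinear
form with coefficients `R_{i j̄} = -∂_{j̄} θ_i`. -/
def chernCurvature (x : M) : HolTangent d x →ₗ[ℂ] HolTangent d x →ₗ⋆[ℂ] ℂ :=
  let c := chartAt (Cn d) x
  let e := trivializationAt ℂ L x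
  ∑ i, ∑ j, (-dbar (chernConnectionCoeff h c e i) x (coordVec c x j)) •
    sesqOf (coordForm c x i) (coordForm c x j)

/-- The endomorphism `R` of `T^{1,0} M`, the type change of `R^L`. -/
def curvEnd (x : M) : Module.End ℂ (HolTangent d x) :=
  typeChange (unitaryFrame g x) (chernCurvature h x)

/-- The `k`-th largest eigenvalue `λ_k(x)` of `R`, `k = 1, …, d`. -/
def eigval (k : ℕ) (x : M) : ℝ :=
  eigenvalueDesc (curvEnd g h x) k

/-- The pointwise norm `|R|`. -/
def curvNorm (x : M) : ℝ :=
  √(∑ i, ∑ j, ‖(unitaryFrame g x).coord j (curvEnd g h x (unitaryFrame g x i))‖ ^ 2)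

/-- The trace `Tr R`. -/
def curvTrace (x : M) : ℂ :=
  LinearMap.trace ℂ (HolTangent d x) (curvEnd g h x)

/-- The fibre at `x` of `F_p`, the maximal eigenspace of `[√-1 R^L, Λ]` on `Λ^{p,0}`. -/
def eigenline (p : ℕ) (x : M) : Submodule ℂ (HolForms p (HolTangent d x)) :=
  maxEigenspace p (unitaryFrame g x) (chernCurvature h x)

open Classical in
/-- `Ψ^{F_p} = |ψ|⁻² ψ ⊗ ψ*` for any `ψ ≠ 0` in the fibre of `F_p`; it does not depend on `ψ` where
`F_p` is a line. -/
def twistingSection (p : ℕ) (x : M) : Module.End ℂ (HolForms p (HolTangent d x)) :=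
  if hψ : ∃ ψ ∈ eigenline g h p x, ψ ≠ 0 then rankOne p (unitaryFrame g x) hψ.choose else 0

/-- The coefficient function `R_i^j` of `R` in the chart `c`, where `R = R_i^j dz^i ⊗ ∂_j`. -/
def curvCoeff (c : OpenPartialHomeomorph M (Cn d)) (i j : Fin d) (y : M) : ℂ :=
  coordForm c y j (curvEnd g h y (coordVec c y i))

end LineBundle

end

/-!
Write `P` for the orthogonal projection of `T^{1,0} M` onto the sum of the eigenspaces of `R` for
`λ_1, …, λ_p`. On `Λ^{p,0}` the operator `[√-1 R^L, Λ]` is the derivation induced by `R` minus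
`Tr R`, so its eigenvectors are the wedge products of the dual of an eigenframe of `R`, with
eigenvalues `λ_{i_1} + ⋯ + λ_{i_p} - Tr R`. The gap after `λ_p` makes the largest one simple, and
`Ψ` is the map `Λ^p P` (`twistingSection_eq`). In a holomorphic frame the coefficients of `Ψ` are
thus the `p × p` minors of the matrix `A` of `P` (`endFormsCoeff_twistingSection`), and everything
is reduced to the first-order behaviour of `A` and of the matrix `S` of `R`.

*Regularity.* `S` is differentiable because the Chern curvature and the metric are smooth in a
holomorphic frame; for the curvature, which is defined with a chart and a frame of `L` that vary
with the point, this uses that it does not depend on them (`chernCurvature_chartVec`). That `A` is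
differentiable is obtained without a resolvent integral (`differentiableAt_spectralProj`). The
eigenframes at nearby points, chosen arbitrarily, are bounded, so their vectors are eigenvectors of
`S(z)` up to first order in the distance to `z`. By the gap, their off-diagonal blocks and hence
`A - A(z)` are of first order, and then the equations `A² = A` and `[A, S] = 0` determine
`A - A(z)` up to second order as a linear function of `S - S(z)`.

*The formula.* Take a holomorphic frame that at `z` is unitary and consists of eigenvectors of
`R`. By `A² = A`, `∂̄A` vanishes on the diagonal blocks, and differentiating `[A, S] = 0` gives
`∂̄A_{ij} = ∂̄S_{ij} / (λ_i - λ_j)` and `∂̄A_{ji} = ∂̄S_{ji} / (λ_i - λ_j)` for `i ≤ p < j`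
(`dbarMat_spectralProj_apply`). The `p`-th compound of `A` is again a projection, of rank one, so
its derivative at `z` has only the row and the column of the multi-index `{1, …, p}`. By
Cauchy–Binet the norm of that row is the norm of the off-diagonal block of `∂̄A`
(`sum_sq_rowDeriv_compound`), and similarly for the column. Other holomorphic coordinates with the
same frame at `z` conjugate `S` by a holomorphic matrix that is the identity at `z`, which does not
change `∂̄S` (`dbarE_curvCoeff`).

*The estimates.* Since `λ_i - λ_j ≥ λ_p - λ_{p+1}`, the formula gives the bound
`(λ_p - λ_{p+1})⁻² (|∂̄S|² - ∑_i |∂̄S_{ii}|²)` (`hsNormSq_dbarMat_compound_le`). The diagonal sum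
is nonnegative; it is at least `|∂̄ Tr R|² / d`, and at least `|∂̄|R||²`, because
`|R| ∂̄|R| = ∑_i λ_i ∂̄S_{ii}` by `|R|² = Tr R²`.
-/

noncomputable section

/-! ### Compound matrices -/

section Compound

open Set.powersetCard

variable {d p : ℕ}

/-- The **Cauchy–Binet formula**: it expands an exterior product of `p` vectors in the basis of
`p`-fold exterior products. -/
theorem det_mul_eq_sum_minors (X : Matrix (Fin p) (Fin d) ℂ) (Y : Matrix (Fin d) (Fin p) ℂ) :
    (X * Y).det = ∑ I : Set.powersetCard (Fin d) p,
      (X.submatrix id (ofFinEmbEquiv.symm I)).det * (Y.submatrix (ofFinEmbEquiv.symm I) id).det := by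
  let b := Pi.basisFun ℂ (Fin d)
  let φ : Fin p → Module.Dual ℂ (Fin d → ℂ) := fun j => ∑ k, Y k j • LinearMap.proj k
  let x := exteriorPower.ιMulti ℂ p fun a => X a
  have h1 : exteriorPower.pairingDual ℂ (Fin d → ℂ) p (exteriorPower.ιMulti ℂ p φ) x
      = (X * Y).det := by
    rw [exteriorPower.pairingDual_ιMulti_ιMulti]
    congr 1
    ext i j
    simp [φ, Matrix.mul_apply, mul_comm]
  rw [← h1, ← (b.exteriorPower p).sum_repr x, map_sum]
  refine Finset.sum_congr rfl fun I _ => ?_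
  rw [map_smul, exteriorPower.basis_repr_apply, exteriorPower.basis_apply,
    exteriorPower.ιMultiDual_apply_ιMulti, exteriorPower.ιMulti_family,
    exteriorPower.pairingDual_ιMulti_ιMulti, smul_eq_mul]
  congr 2
  ext i j
  simp [φ, b, Pi.single_apply]

/-- The `p`-th compound matrix, whose entries are the `p × p` minors of `A`. -/
def compound (p : ℕ) (A : Matrix (Fin d) (Fin d) ℂ) :
    Matrix (Set.powersetCard (Fin d) p) (Set.powersetCard (Fin d) p) ℂ :=
  Matrix.of fun I J => (A.submatrix (ofFinEmbEquiv.symm I) (ofFinEmbEquiv.symm J)).det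

theorem compound_apply (A : Matrix (Fin d) (Fin d) ℂ) (I J : Set.powersetCard (Fin d) p) :
    compound p A I J = (A.submatrix (ofFinEmbEquiv.symm I) (ofFinEmbEquiv.symm J)).det := rfl

theorem compound_mul (A B : Matrix (Fin d) (Fin d) ℂ) :
    compound p (A * B) = compound p A * compound p B := by
  ext I J
  rw [compound_apply, Matrix.mul_apply, Matrix.submatrix_mul _ _ _ id _ Function.bijective_id,
    det_mul_eq_sum_minors]
  rfl

theorem compound_transpose (A : Matrix (Fin d) (Fin d) ℂ) :
    compound p A.transpose = (compound p A).transpose := by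
  ext I J
  rw [compound_apply, Matrix.transpose_apply, compound_apply, ← Matrix.det_transpose]
  rfl

theorem compound_conjTranspose (A : Matrix (Fin d) (Fin d) ℂ) :
    compound p A.conjTranspose = (compound p A).conjTranspose := by
  ext I J
  rw [compound_apply, Matrix.conjTranspose_apply, compound_apply, ← Matrix.det_conjTranspose]
  rfl

/-- The orthogonal projection of `ℂ^d` onto its first `p` coordinates. -/
def stdProj (d p : ℕ) : Matrix (Fin d) (Fin d) ℂ :=
  Matrix.diagonal fun i => if (i : ℕ) < p then 1 else 0

/-- The multi-index `{1, …, p}`. -/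
def firstIndices (hpd : p ≤ d) : Set.powersetCard (Fin d) p :=
  ofFinEmbEquiv (Fin.castLEOrderEmb hpd)

theorem enum_firstIndices (hpd : p ≤ d) :
    ofFinEmbEquiv.symm (firstIndices hpd) = Fin.castLEOrderEmb hpd := by
  simp [firstIndices]

theorem mem_firstIndices (hpd : p ≤ d) (i : Fin d) : i ∈ firstIndices hpd ↔ (i : ℕ) < p := by
  rw [firstIndices, mem_ofFinEmbEquiv_iff_mem_range]
  constructor
  · rintro ⟨a, rfl⟩
    simp
  · intro h
    exact ⟨⟨i, h⟩, by ext; simp⟩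

theorem exists_ge_of_ne_firstIndices (hpd : p ≤ d) {I : Set.powersetCard (Fin d) p}
    (hI : I ≠ firstIndices hpd) : ∃ a : Fin p, p ≤ (ofFinEmbEquiv.symm I a : ℕ) := by
  obtain ⟨i, hi, hi'⟩ := (exists_mem_notMem_iff_ne I (firstIndices hpd)).mp hI
  obtain ⟨a, rfl⟩ := (mem_range_ofFinEmbEquiv_symm_iff_mem I i).mpr hi
  exact ⟨a, by simpa [mem_firstIndices] using hi'⟩

theorem compound_one : compound p (1 : Matrix (Fin d) (Fin d) ℂ) = 1 := by
  ext I J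
  rw [compound_apply]
  by_cases h : I = J
  · subst h
    rw [Matrix.submatrix_one _ (ofFinEmbEquiv.symm I).injective]
    simp
  · obtain ⟨i, hi, hi'⟩ := (exists_mem_notMem_iff_ne I J).mp h
    obtain ⟨a, rfl⟩ := (mem_range_ofFinEmbEquiv_symm_iff_mem I i).mpr hi
    rw [Matrix.one_apply_ne h]
    refine Matrix.det_eq_zero_of_row_eq_zero a fun c => ?_
    refine Matrix.one_apply_ne fun hc => hi' ?_
    rw [hc]
    exact (mem_range_ofFinEmbEquiv_symm_iff_mem J _).mp ⟨c, rfl⟩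

theorem compound_stdProj (hpd : p ≤ d) :
    compound p (stdProj d p) = Matrix.single (firstIndices hpd) (firstIndices hpd) 1 := by
  ext I J
  by_cases hI : I = firstIndices hpd
  · by_cases hJ : J = firstIndices hpd
    · subst hI hJ
      rw [compound_apply, enum_firstIndices, Matrix.single_apply_same, ← Matrix.det_one (n := Fin p)]
      congr 1
      ext a c
      simp [stdProj, Matrix.diagonal_apply, Matrix.one_apply, Fin.ext_iff]
    · obtain ⟨a, ha⟩ := exists_ge_of_ne_firstIndices hpd hJ
      rw [Matrix.single_apply_of_ne _ _ _ _ _ (by tauto), compound_apply]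
      refine Matrix.det_eq_zero_of_column_eq_zero a fun c => ?_
      simp only [stdProj, Matrix.submatrix_apply, Matrix.diagonal_apply]
      split_ifs with h1 h2 <;> first | rfl | (rw [h1] at h2; omega)
  · obtain ⟨a, ha⟩ := exists_ge_of_ne_firstIndices hpd hI
    rw [Matrix.single_apply_of_ne _ _ _ _ _ (by tauto), compound_apply]
    refine Matrix.det_eq_zero_of_row_eq_zero a fun c => ?_
    simp only [stdProj, Matrix.submatrix_apply, Matrix.diagonal_apply]
    split_ifs with h1 h2 <;> first | rfl | omega

/-- The rows `e_1, …, e_p` with the `r`-th one replaced by `e_j`. -/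
def replacedRows (d : ℕ) (p : ℕ) (hpd : p ≤ d) (r : Fin p) (j : Fin d) :
    Matrix (Fin p) (Fin d) ℂ :=
  Matrix.of fun a k => if k = (if a = r then j else Fin.castLE hpd a) then 1 else 0

/-- The `p`-vectors `e_1 ∧ ⋯ ∧ e_j ∧ ⋯ ∧ e_p`, with `e_j`, `j > p`, in place of `e_r`, are
orthonormal: their Gram determinants are those of Cauchy–Binet. -/
theorem sum_minors_replacedRows (hpd : p ≤ d) (r r' : Fin p) (j j' : Fin d) (hj : p ≤ (j : ℕ))
    (hj' : p ≤ (j' : ℕ)) :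
    ∑ J : Set.powersetCard (Fin d) p,
      ((replacedRows d p hpd r j).submatrix id (ofFinEmbEquiv.symm J)).det *
        conj ((replacedRows d p hpd r' j').submatrix id (ofFinEmbEquiv.symm J)).det =
      if r = r' ∧ j = j' then 1 else 0 := by
  have h1 := det_mul_eq_sum_minors (replacedRows d p hpd r j)
    (replacedRows d p hpd r' j').conjTranspose
  have h2 : ∀ J : Set.powersetCard (Fin d) p,
      ((replacedRows d p hpd r' j').conjTranspose.submatrix (ofFinEmbEquiv.symm J) id).det =
        conj ((replacedRows d p hpd r' j').submatrix id (ofFinEmbEquiv.symm J)).det := by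
    intro J
    rw [← Matrix.conjTranspose_submatrix, Matrix.det_conjTranspose]
    rfl
  simp only [h2] at h1
  rw [← h1]
  have h3 : ∀ a c, (replacedRows d p hpd r j * (replacedRows d p hpd r' j').conjTranspose) a c =
      if (if c = r' then j' else Fin.castLE hpd c) = (if a = r then j else Fin.castLE hpd a)
        then 1 else 0 := by
    intro a c
    simp only [replacedRows, Matrix.mul_apply, Matrix.conjTranspose_apply, Matrix.of_apply,
      apply_ite star, star_one, star_zero, ite_mul, one_mul, zero_mul, Finset.sum_ite_eq',
      Finset.mem_univ, if_true, eq_comm]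
  have hne : ∀ a : Fin p, Fin.castLE hpd a ≠ j := fun a h => by
    have := congrArg Fin.val h; simp at this; omega
  have hne' : ∀ a : Fin p, Fin.castLE hpd a ≠ j' := fun a h => by
    have := congrArg Fin.val h; simp at this; omega
  split_ifs with h
  · obtain ⟨rfl, rfl⟩ := h
    rw [← Matrix.det_one (n := Fin p)]
    congr 1
    ext a c
    rw [h3, Matrix.one_apply]
    by_cases ha : a = r <;> by_cases hc : c = r
    · simp [ha, hc]
    · simp [ha, hc, hne, Ne.symm hc]
    · simp [ha, hc, (hne _).symm]
    · simp [ha, hc, eq_comm]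
  · by_cases hjj : j = j'
    · have hr : r ≠ r' := fun h' => h ⟨h', hjj⟩
      subst hjj
      refine Matrix.det_eq_zero_of_row_eq_zero r' fun c => ?_
      rw [h3, if_neg hr.symm]
      split_ifs with h4 h5 h5
      · exact absurd h5.symm (hne _)
      · rfl
      · exact absurd (by simpa using h5) h4
      · rfl
    · refine Matrix.det_eq_zero_of_row_eq_zero r fun c => ?_
      rw [h3, if_pos rfl]
      split_ifs with h4 h5 h5
      · exact absurd h5.symm hjj
      · rfl
      · exact absurd h5 (hne _)
      · rfl

/-- The derivative at `stdProj` of the row of index `{1, …, p}` of the compound matrix is an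
isometry in the off-diagonal block of the direction `X`. -/
theorem sum_sq_rowDeriv_compound (hpd : p ≤ d) (X : Matrix (Fin d) (Fin d) ℂ)
    (hX : ∀ i j : Fin d, (i : ℕ) < p → (j : ℕ) < p → X i j = 0) :
    ∑ J : Set.powersetCard (Fin d) p, ‖∑ r, (((stdProj d p).submatrix
        (ofFinEmbEquiv.symm (firstIndices hpd)) (ofFinEmbEquiv.symm J)).updateRow r
        (X.submatrix (ofFinEmbEquiv.symm (firstIndices hpd)) (ofFinEmbEquiv.symm J) r)).det‖ ^ 2 =
      ∑ i : Fin d, ∑ j : Fin d, if (i : ℕ) < p ∧ p ≤ (j : ℕ) then ‖X i j‖ ^ 2 else 0 := by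
  rw [enum_firstIndices]
  set w : Fin p → Fin d → Set.powersetCard (Fin d) p → ℂ := fun r j J =>
    ((replacedRows d p hpd r j).submatrix id (ofFinEmbEquiv.symm J)).det with hw
  set x : Fin p → Fin d → ℂ := fun r j => X (Fin.castLE hpd r) j with hx
  have hterm : ∀ (J : Set.powersetCard (Fin d) p) (r : Fin p),
      (((stdProj d p).submatrix (Fin.castLEOrderEmb hpd) (ofFinEmbEquiv.symm J)).updateRow r
        (X.submatrix (Fin.castLEOrderEmb hpd) (ofFinEmbEquiv.symm J) r)).det =
      ∑ j, x r j * w r j J := by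
    intro J r
    have hrow : X.submatrix (Fin.castLEOrderEmb hpd) (ofFinEmbEquiv.symm J) r =
        ∑ j, x r j • (fun c => if ofFinEmbEquiv.symm J c = j then (1 : ℂ) else 0) := by
      ext c
      simp [x]
    have hsum := (Matrix.detRowAlternating (R := ℂ) (n := Fin p)).toMultilinearMap.map_update_sum
      Finset.univ r (fun j => x r j • (fun c => if ofFinEmbEquiv.symm J c = j then (1 : ℂ) else 0))
      ((stdProj d p).submatrix (Fin.castLEOrderEmb hpd) (ofFinEmbEquiv.symm J))
    rw [hrow]
    refine hsum.trans (Finset.sum_congr rfl fun j _ => ?_)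
    refine (Matrix.det_updateRow_smul _ _ _ _).trans ?_
    rw [hw]
    congr 2
    ext a c
    by_cases ha : a = r
    · subst ha
      simp [replacedRows]
    · simp only [Matrix.updateRow_ne ha, replacedRows, stdProj, Matrix.submatrix_apply,
        Matrix.of_apply, id_eq, if_neg ha, Matrix.diagonal_apply]
      simp [Fin.ext_iff, eq_comm]
  simp only [hterm]
  have hx0 : ∀ (r : Fin p) (j : Fin d), (j : ℕ) < p → x r j = 0 := fun r j hj => hX _ _ (by simp) hj
  have key : ((∑ J : Set.powersetCard (Fin d) p, ‖∑ r, ∑ j, x r j * w r j J‖ ^ 2 : ℝ) : ℂ) =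
      ((∑ r, ∑ j, ‖x r j‖ ^ 2 : ℝ) : ℂ) := by
    push_cast
    simp only [← Complex.mul_conj', map_sum, map_mul, Finset.sum_mul, Finset.mul_sum]
    rw [Finset.sum_comm]
    refine Finset.sum_congr rfl fun r _ => ?_
    rw [Finset.sum_comm]
    refine Finset.sum_congr rfl fun j _ => ?_
    by_cases hj : (j : ℕ) < p
    · simp [hx0 r j hj]
    rw [Finset.sum_comm, Finset.sum_eq_single r, Finset.sum_comm, Finset.sum_eq_single j]
    · have := sum_minors_replacedRows hpd r r j j (by omega) (by omega)
      rw [if_pos ⟨rfl, rfl⟩] at this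
      calc _ = ∑ J, (x r j * conj (x r j)) * (w r j J * conj (w r j J)) :=
            Finset.sum_congr rfl fun J _ => by ring
        _ = _ := by rw [← Finset.mul_sum, this, mul_one]
    · intro j' _ hjj
      by_cases hj' : (j' : ℕ) < p
      · simp [hx0 r j' hj']
      have := sum_minors_replacedRows hpd r r j' j (by omega) (by omega)
      rw [if_neg (by tauto)] at this
      calc _ = ∑ J, (x r j' * conj (x r j)) * (w r j' J * conj (w r j J)) :=
            Finset.sum_congr rfl fun J _ => by ring
        _ = _ := by rw [← Finset.mul_sum, this, mul_zero]
    · simp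
    · intro r' _ hr
      rw [Finset.sum_comm]
      refine Finset.sum_eq_zero fun j' _ => ?_
      by_cases hj' : (j' : ℕ) < p
      · simp [hx0 r' j' hj']
      have := sum_minors_replacedRows hpd r' r j' j (by omega) (by omega)
      rw [if_neg (by tauto)] at this
      calc _ = ∑ J, (x r' j' * conj (x r j)) * (w r' j' J * conj (w r j J)) :=
            Finset.sum_congr rfl fun J _ => by ring
        _ = _ := by rw [← Finset.mul_sum, this, mul_zero]
    · simp
  rw [Complex.ofReal_inj.mp key]
  obtain ⟨m, rfl⟩ := Nat.exists_eq_add_of_le hpd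
  rw [Fin.sum_univ_add]
  have : ∀ i : Fin m, (∑ j : Fin (p + m), if ((Fin.natAdd p i : Fin (p + m)) : ℕ) < p ∧ p ≤ (j : ℕ)
      then ‖X (Fin.natAdd p i) j‖ ^ 2 else 0) = 0 := fun i => by simp
  rw [Finset.sum_congr rfl fun i _ => this i, Finset.sum_const_zero, add_zero]
  refine Finset.sum_congr rfl fun r _ => Finset.sum_congr rfl fun j _ => ?_
  by_cases hj : (j : ℕ) < p
  · simp [hx0 r j hj, not_le.mpr hj]
  · simp only [x, Fin.val_castAdd, Fin.is_lt, true_and, if_pos (not_lt.mp hj)]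
    rfl

end Compound

/-! ### Hilbert–Schmidt norms -/

section HilbertSchmidt

variable {n : Type*} [Fintype n]

/-- The squared Hilbert–Schmidt norm of a matrix. -/
def hsNormSq (X : Matrix n n ℂ) : ℝ := ∑ i, ∑ j, ‖X i j‖ ^ 2

theorem hsNormSq_eq_trace (X : Matrix n n ℂ) : (hsNormSq X : ℂ) = (X * X.conjTranspose).trace := by
  simp [hsNormSq, Matrix.trace, Matrix.mul_apply, Matrix.conjTranspose_apply, Complex.mul_conj']

theorem hsNormSq_unitary_conj [DecidableEq n] {W : Matrix n n ℂ} (hW : W.conjTranspose * W = 1)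
    (X : Matrix n n ℂ) : hsNormSq (W * X * W.conjTranspose) = hsNormSq X := by
  apply Complex.ofReal_injective
  rw [hsNormSq_eq_trace, hsNormSq_eq_trace, Matrix.conjTranspose_mul, Matrix.conjTranspose_mul,
    Matrix.conjTranspose_conjTranspose]
  calc (W * X * W.conjTranspose * (W * (X.conjTranspose * W.conjTranspose))).trace
      = (W * (X * (W.conjTranspose * W) * (X.conjTranspose * W.conjTranspose))).trace := by
        simp only [Matrix.mul_assoc]
    _ = (X * X.conjTranspose * (W.conjTranspose * W)).trace := by
        rw [hW, Matrix.trace_mul_comm]; simp only [Matrix.mul_assoc, Matrix.mul_one, hW]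
    _ = _ := by rw [hW, Matrix.mul_one]

end HilbertSchmidt

/-! ### Unitary frames and eigenframes -/

section UnitaryFrames

variable {T : Type*} [AddCommGroup T] [Module ℂ T] {d : ℕ}

theorem IsUnitaryFrame.linearIndependent {g : T →ₗ[ℂ] T →ₗ⋆[ℂ] ℂ} {b : Fin d → T}
    (hb : IsUnitaryFrame g b) : LinearIndependent ℂ b := by
  rw [Fintype.linearIndependent_iff]
  intro c hc i
  have h := congrArg (fun v => g v (b i)) hc
  simpa [hb _ _] using h

theorem IsUnitaryFrame.exists_basis [FiniteDimensional ℂ T] (hd : Module.finrank ℂ T = d)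
    {g : T →ₗ[ℂ] T →ₗ⋆[ℂ] ℂ} {b : Fin d → T} (hb : IsUnitaryFrame g b) :
    ∃ e : Module.Basis (Fin d) ℂ T, ⇑e = b := by
  let e := basisOfLinearIndependentOfCardEqFinrank' b hb.linearIndependent (by simp [hd])
  exact ⟨e, by simp [e]⟩

theorem IsUnitaryFrame.coord_eq {g : T →ₗ[ℂ] T →ₗ⋆[ℂ] ℂ} {b : Module.Basis (Fin d) ℂ T}
    (hb : IsUnitaryFrame g b) (i : Fin d) (v : T) : b.coord i v = g v (b i) := by
  conv_rhs => rw [← b.sum_repr v]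
  simp only [map_sum, map_smul, LinearMap.sum_apply, LinearMap.smul_apply, hb _ _, smul_eq_mul,
    mul_ite, mul_one, mul_zero, Finset.sum_ite_eq', Finset.mem_univ, if_true]
  rfl

/-- The change of basis between unitary frames is a unitary matrix. -/
theorem IsUnitaryFrame.conjTranspose_toMatrix_mul {g : T →ₗ[ℂ] T →ₗ⋆[ℂ] ℂ}
    {e : Module.Basis (Fin d) ℂ T} (he : IsUnitaryFrame g e) {b : Fin d → T}
    (hb : IsUnitaryFrame g b) : (e.toMatrix b).conjTranspose * e.toMatrix b = 1 := by
  ext k l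
  have h := hb l k
  rw [← e.sum_repr (b l), ← e.sum_repr (b k)] at h
  simp only [map_sum, map_smul, LinearMap.sum_apply, LinearMap.smul_apply, map_smulₛₗ, he _ _,
    smul_eq_mul, mul_ite, mul_one, mul_zero, Finset.sum_ite_eq',
    Finset.mem_univ, if_true] at h
  rw [Matrix.mul_apply, Matrix.one_apply]
  simp only [eq_comm (a := k)]
  rw [← h]
  exact Finset.sum_congr rfl fun i _ => by
    simp [Module.Basis.toMatrix_apply, Matrix.conjTranspose_apply]

/-- The spectral theorem, with the eigenvalues numbered by `eigenvalueDesc`. -/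
theorem exists_unitary_eigenframe [FiniteDimensional ℂ T] (hd : Module.finrank ℂ T = d)
    (g : T →ₗ[ℂ] T →ₗ⋆[ℂ] ℂ) (hsymm : ∀ v w, conj (g v w) = g w v)
    (hpos : ∀ v, v ≠ 0 → 0 < (g v v).re) (A : Module.End ℂ T)
    (hA : ∀ v w, g (A v) w = g v (A w)) :
    ∃ e : Module.Basis (Fin d) ℂ T, IsUnitaryFrame g e ∧
      (∀ i, A (e i) = (eigenvalueDesc A (i + 1) : ℂ) • e i) ∧
      Antitone fun i : Fin d => eigenvalueDesc A (i + 1) := by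
  let core : InnerProductSpace.Core ℂ T :=
    { inner := fun v w => g w v
      conj_inner_symm := fun v w => hsymm v w
      re_inner_nonneg := fun v => by
        by_cases hv : v = 0
        · simp [hv]
        · exact (hpos v hv).le
      add_left := fun u v w => by simp
      smul_left := fun u v r => by simp
      definite := fun v hv => by
        by_contra hne
        have := hpos v hne
        rw [hv] at this
        simp at this }
  let _ : NormedAddCommGroup T := core.toNormedAddCommGroup
  let _ : InnerProductSpace ℂ T := InnerProductSpace.ofCore core.toCore
  have hsym : LinearMap.IsSymmetric A := fun v w => (hA w v).symm
  have hlam : ∀ i : Fin d, eigenvalueDesc A (i + 1) = hsym.eigenvalues hd i := by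
    intro i
    have := hsym.sort_roots_charpoly_eq_eigenvalues hd
    rw [eigenvalueDesc]
    erw [this]
    simp
  refine ⟨(hsym.eigenvectorBasis hd).toBasis, fun i j => ?_, fun i => ?_, fun i j hij => ?_⟩
  · have h := (orthonormal_iff_ite (𝕜 := ℂ)).1 (hsym.eigenvectorBasis hd).orthonormal j i
    have h' : inner ℂ (hsym.eigenvectorBasis hd j) (hsym.eigenvectorBasis hd i) =
      g (hsym.eigenvectorBasis hd i) (hsym.eigenvectorBasis hd j) := rfl
    rw [OrthonormalBasis.coe_toBasis, ← h', h]
    simp only [eq_comm]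
  · rw [hlam, OrthonormalBasis.coe_toBasis]
    exact hsym.apply_eigenvectorBasis hd i
  · simp only [hlam]
    exact hsym.eigenvalues_antitone hd hij

theorem typeChange_isSelfAdjoint {g : T →ₗ[ℂ] T →ₗ⋆[ℂ] ℂ} (hsymm : ∀ v w, conj (g v w) = g w v)
    {b : Module.Basis (Fin d) ℂ T} (hb : IsUnitaryFrame g b) {Q : T →ₗ[ℂ] T →ₗ⋆[ℂ] ℂ}
    (hQ : ∀ v w, conj (Q v w) = Q w v) (v w : T) :
    g (typeChange b Q v) w = g v (typeChange b Q w) := by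
  rw [typeChange_spec g b hb, ← hsymm, typeChange_spec g b hb, hQ]

end UnitaryFrames

/-! ### The curvature operator on `(p,0)`-forms -/

section CurvatureOperator

variable {T : Type*} [AddCommGroup T] [Module ℂ T] {d : ℕ}

/-- The derivation of `Λ^{•,•}` that extends `η ↦ Q_{i j̄} η(b_j) b^i`. -/
def curvDerivation (b : Module.Basis (Fin d) ℂ T) (Q : T →ₗ[ℂ] T →ₗ⋆[ℂ] ℂ) :
    Module.End ℂ (Forms T) :=
  ∑ i, ∑ j, Q (b i) (b j) • (extMul (b.coord i, 0) * contract (evalHol (b j)))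

theorem contract_extMul (X : Module.Dual ℂ (Module.Dual ℂ T × ConjDual T))
    (η : Module.Dual ℂ T × ConjDual T) (x : Forms T) :
    contract X (extMul η x) = X η • x - extMul η (contract X x) :=
  CliffordAlgebra.contractLeft_ι_mul X η x

theorem contract_evalAntihol_holIncl (p : ℕ) (v : T) (α : HolForms p T) :
    contract (evalAntihol v) (holIncl p α) = 0 := by
  change CliffordAlgebra.contractLeft (evalAntihol v)
    (ExteriorAlgebra.map (LinearMap.inl ℂ (Module.Dual ℂ T) (ConjDual T)) (α : ExteriorAlgebra ℂ _))
      = 0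
  induction (α : ExteriorAlgebra ℂ (Module.Dual ℂ T)) using CliffordAlgebra.left_induction with
  | algebraMap r => rw [AlgHom.commutes]; exact CliffordAlgebra.contractLeft_algebraMap _ _ _
  | add x y hx hy => rw [map_add, map_add, hx, hy, add_zero]
  | ι_mul x m hx =>
    rw [map_mul]
    erw [ExteriorAlgebra.map_apply_ι]
    refine (CliffordAlgebra.contractLeft_ι_mul (evalAntihol v) _ _).trans ?_
    rw [hx]
    simp [evalAntihol]

/-- On `(p,0)`-forms `[√-1 Q, Λ]` is a derivation up to a multiple of the identity, since `Λ` and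
the contractions with `(0,1)`-vectors vanish there. -/
theorem curvOperator_holIncl (p : ℕ) (b : Module.Basis (Fin d) ℂ T)
    (Q : T →ₗ[ℂ] T →ₗ⋆[ℂ] ℂ) (α : HolForms p T) :
    curvOperator b Q (holIncl p α) =
      curvDerivation b Q (holIncl p α) - (∑ i, Q (b i) (b i)) • holIncl p α := by
  set x := holIncl p α with hx
  have h0 : ∀ v, contract (evalAntihol v) x = 0 := fun v => contract_evalAntihol_holIncl p v α
  have h1 : ∀ v w, contract (evalAntihol v) (contract (evalHol w) x) = 0 := fun v w => by
    refine (CliffordAlgebra.contractLeft_comm _ _ x).trans ?_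
    have : CliffordAlgebra.contractLeft (evalAntihol v) x = 0 := h0 v
    rw [this, map_zero, neg_zero]
  have hL : lefschetzAdjoint b x = 0 := by
    simp [lefschetzAdjoint, h1]
  have hk : ∀ k i j, contract (evalAntihol (b k)) (contract (evalHol (b k))
      (extMul (b.coord i, 0) (extMul (0, conjCovector (b.coord j)) x))) =
      (if k = i ∧ k = j then x else 0) -
        if k = j then extMul (b.coord i, 0) (contract (evalHol (b k)) x) else 0 := by
    intro k i j
    have e1 : evalHol (b k) ((b.coord i, 0) : Module.Dual ℂ T × ConjDual T) =
        if k = i then 1 else 0 := by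
      simp [evalHol, Finsupp.single_apply]
    have e2 : evalHol (b k) ((0, conjCovector (b.coord j)) : Module.Dual ℂ T × ConjDual T) = 0 := by
      simp [evalHol]
    have e3 : evalAntihol (b k) ((b.coord i, 0) : Module.Dual ℂ T × ConjDual T) = 0 := by
      simp [evalAntihol]
    have e4 : evalAntihol (b k) ((0, conjCovector (b.coord j)) : Module.Dual ℂ T × ConjDual T) =
        if k = j then 1 else 0 := by
      simp [evalAntihol, conjCovector, Finsupp.single_apply, apply_ite]
    rw [contract_extMul, contract_extMul, e1, e2]
    simp only [map_sub, map_smul, contract_extMul, e3, e4, h0, h1, map_zero, zero_smul, zero_sub,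
      sub_zero, map_neg]
    by_cases hi : k = i <;> by_cases hj : k = j <;> simp [hi, hj]
  rw [curvOperator, LinearMap.sub_apply, Module.End.mul_apply, Module.End.mul_apply, hL, map_zero,
    zero_sub]
  have hI : ∀ q : ℂ, Complex.I * q * -Complex.I = q := fun q => by
    linear_combination -q * Complex.I_mul_I
  have hdiag : ∀ (i j : Fin d) (y : Forms T),
      (∑ k, if k = i ∧ k = j then y else 0) = if i = j then y else 0 := by
    intro i j y
    rw [Finset.sum_eq_single i (fun k _ hk => by simp [hk]) (by simp)]
    simp
  simp only [lefschetzAdjoint, wedgeForm, LinearMap.smul_apply, LinearMap.sum_apply,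
    Module.End.mul_apply, map_smul, map_sum, hk, curvDerivation, Finset.smul_sum, smul_smul,
    smul_sub, Finset.sum_sub_distrib, neg_sub, smul_ite, smul_zero, hI, hdiag, Finset.sum_ite_eq',
    Finset.sum_ite_eq, Finset.mem_univ, if_true, Finset.sum_smul]

/-- A product of `(1,0)`-covectors that are eigenvectors of the transpose of `R` is an eigenvector of
the derivation; the eigenvalues add up. -/
theorem curvDerivation_prod (b : Module.Basis (Fin d) ℂ T) (Q : T →ₗ[ℂ] T →ₗ⋆[ℂ] ℂ)
    (l : List (Module.Dual ℂ T × ℂ))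
    (hl : ∀ η ∈ l, ∀ v, η.1 (typeChange b Q v) = η.2 * η.1 v) :
    curvDerivation b Q (l.map fun η => ExteriorAlgebra.ι ℂ
        ((η.1, 0) : Module.Dual ℂ T × ConjDual T)).prod =
      (l.map Prod.snd).sum • (l.map fun η => ExteriorAlgebra.ι ℂ
        ((η.1, 0) : Module.Dual ℂ T × ConjDual T)).prod := by
  induction l with
  | nil =>
    have : ∀ j, contract (evalHol (b j)) (1 : Forms T) = 0 := fun j =>
      CliffordAlgebra.contractLeft_one _ _
    simp [curvDerivation, this]
  | cons η l ih =>
    have ih := ih fun ζ hζ => hl ζ (List.mem_cons_of_mem _ hζ)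
    set x := (l.map fun η => ExteriorAlgebra.ι ℂ
        ((η.1, 0) : Module.Dual ℂ T × ConjDual T)).prod
    have hη := hl η List.mem_cons_self
    rw [List.map_cons, List.prod_cons, List.map_cons, List.sum_cons]
    change curvDerivation b Q (extMul (η.1, 0) x) = (_ + _) • extMul (η.1, 0) x
    have hanti : ∀ ζ : Module.Dual ℂ T × ConjDual T, ∀ y : Forms T,
        extMul ζ (extMul (η.1, 0) y) = - extMul (η.1, 0) (extMul ζ y) := by
      intro ζ y
      have := ExteriorAlgebra.ι_add_mul_swap (R := ℂ) ζ ((η.1, 0) : Module.Dual ℂ T × ConjDual T)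
      simp only [extMul, LinearMap.mulLeft_apply, ← mul_assoc]
      rw [eq_neg_of_add_eq_zero_left this, neg_mul]
    have hder : curvDerivation b Q (extMul (η.1, 0) x) =
        (∑ i, ∑ j, Q (b i) (b j) • η.1 (b j) • extMul (b.coord i, 0) x) +
          extMul (η.1, 0) (curvDerivation b Q x) := by
      simp only [curvDerivation, LinearMap.sum_apply, LinearMap.smul_apply, Module.End.mul_apply,
        map_sum, map_smul, contract_extMul, map_sub, hanti, sub_neg_eq_add, smul_add,
        Finset.sum_add_distrib]
      rfl
    have hcov : (∑ i, ∑ j, (Q (b i) (b j) * η.1 (b j)) • b.coord i) = η.2 • η.1 := by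
      refine b.ext fun m => ?_
      have := hη (b m)
      simp only [typeChange, LinearMap.sum_apply, LinearMap.smulRight_apply, LinearMap.flip_apply,
        map_sum, map_smul, smul_eq_mul] at this
      simp [← this, Finsupp.single_apply]
    have hext : (∑ i, ∑ j, Q (b i) (b j) • η.1 (b j) • extMul (b.coord i, 0) x) =
        extMul (η.2 • η.1, 0) x := by
      rw [← hcov]
      have hlin : ∀ ζ : Module.Dual ℂ T, extMul ((ζ, 0) : Module.Dual ℂ T × ConjDual T) x =
          ((LinearMap.mul ℂ (Forms T)).flip x ∘ₗ ExteriorAlgebra.ι ℂ ∘ₗ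
            LinearMap.inl ℂ (Module.Dual ℂ T) (ConjDual T)) ζ := fun ζ => rfl
      simp only [hlin, map_sum, map_smul, smul_smul]
    rw [hder, hext, ih, map_smul, add_smul]
    congr 1
    have : ((η.2 • η.1, 0) : Module.Dual ℂ T × ConjDual T) = η.2 • (η.1, 0) := by simp
    change ExteriorAlgebra.ι ℂ _ * x = η.2 • (ExteriorAlgebra.ι ℂ _ * x)
    rw [this, map_smul, smul_mul_assoc]

theorem holIncl_ιMulti (p : ℕ) (η : Fin p → Module.Dual ℂ T) :
    holIncl p (exteriorPower.ιMulti ℂ p η) = (List.ofFn fun a => ExteriorAlgebra.ι ℂ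
        ((η a, 0) : Module.Dual ℂ T × ConjDual T)).prod := by
  change ExteriorAlgebra.map _ (ExteriorAlgebra.ιMulti ℂ p η) = _
  rw [ExteriorAlgebra.map_apply_ιMulti, ExteriorAlgebra.ιMulti_apply]
  rfl

theorem holIncl_injective (p : ℕ) :
    Function.Injective (holIncl p : HolForms p T →ₗ[ℂ] Forms T) := by
  refine Function.Injective.comp (g := ExteriorAlgebra.map
    (LinearMap.inl ℂ (Module.Dual ℂ T) (ConjDual T))) ?_ Subtype.val_injective
  refine Function.LeftInverse.injective (g := ExteriorAlgebra.map
    (LinearMap.fst ℂ (Module.Dual ℂ T) (ConjDual T))) fun x => ?_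
  have h := AlgHom.congr_fun (ExteriorAlgebra.map_comp_map
    (LinearMap.inl ℂ (Module.Dual ℂ T) (ConjDual T))
    (LinearMap.fst ℂ (Module.Dual ℂ T) (ConjDual T))) x
  rw [LinearMap.fst_comp_inl, ExteriorAlgebra.map_id] at h
  exact h

theorem holFormsBasis_apply (p : ℕ) (b : Module.Basis (Fin d) ℂ T)
    (I : Set.powersetCard (Fin d) p) :
    holFormsBasis p b I = exteriorPower.ιMulti ℂ p fun a =>
      b.coord (Set.powersetCard.ofFinEmbEquiv.symm I a) := by
  rw [holFormsBasis, exteriorPower.basis_apply, exteriorPower.ιMulti_family,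
    Module.Basis.coe_dualBasis]
  rfl

/-- The forms `e^{i_1} ∧ ⋯ ∧ e^{i_p}` of an eigenframe `e` are eigenvectors of `[√-1 Q, Λ]`. -/
theorem curvOperator_holFormsBasis (p : ℕ) {b e : Module.Basis (Fin d) ℂ T}
    {Q : T →ₗ[ℂ] T →ₗ⋆[ℂ] ℂ} {lam : Fin d → ℝ}
    (he : ∀ i, typeChange b Q (e i) = (lam i : ℂ) • e i) (I : Set.powersetCard (Fin d) p) :
    curvOperator b Q (holIncl p (holFormsBasis p e I)) =
      ((∑ a, lam (Set.powersetCard.ofFinEmbEquiv.symm I a) : ℝ) - ∑ i, Q (b i) (b i) : ℂ) •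
        holIncl p (holFormsBasis p e I) := by
  rw [curvOperator_holIncl, sub_smul, holFormsBasis_apply, holIncl_ιMulti]
  congr 1
  have h := curvDerivation_prod b Q (List.ofFn fun a : Fin p =>
    (e.coord (Set.powersetCard.ofFinEmbEquiv.symm I a),
      (lam (Set.powersetCard.ofFinEmbEquiv.symm I a) : ℂ))) (by
    intro η hη v
    obtain ⟨a, rfl⟩ := (List.mem_ofFn' _ _).mp hη
    have : e.coord (Set.powersetCard.ofFinEmbEquiv.symm I a) ∘ₗ typeChange b Q =
        (lam (Set.powersetCard.ofFinEmbEquiv.symm I a) : ℂ) •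
          e.coord (Set.powersetCard.ofFinEmbEquiv.symm I a) := by
      refine e.ext fun m => ?_
      simp only [LinearMap.comp_apply, he, map_smul, LinearMap.smul_apply, smul_eq_mul,
        Module.Basis.coord_apply, Module.Basis.repr_self, Finsupp.single_apply]
      split_ifs with hm <;> simp [hm]
    exact LinearMap.congr_fun this v)
  simp only [List.map_ofFn, List.sum_ofFn, Function.comp_def] at h
  rw [h]
  push_cast
  rfl

/-- If the eigenvalue `μ I₀` is larger than all the others, the maximal eigenspace is the line
spanned by the form of index `I₀`. -/
theorem mem_maxEigenspace_iff (p : ℕ) {b e : Module.Basis (Fin d) ℂ T}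
    {Q : T →ₗ[ℂ] T →ₗ⋆[ℂ] ℂ} {μ : Set.powersetCard (Fin d) p → ℝ}
    (hμ : ∀ I, curvOperator b Q (holIncl p (holFormsBasis p e I)) =
      (μ I : ℂ) • holIncl p (holFormsBasis p e I))
    (I₀ : Set.powersetCard (Fin d) p) (hI₀ : ∀ I, I ≠ I₀ → μ I < μ I₀) (α : HolForms p T) :
    α ∈ maxEigenspace p b Q ↔ ∀ I, I ≠ I₀ → (holFormsBasis p e).repr α I = 0 := by
  have key : ∀ (α : HolForms p T) (t : ℝ),
      curvOperator b Q (holIncl p α) = (t : ℂ) • holIncl p α ↔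
        ∀ I, (holFormsBasis p e).repr α I ≠ 0 → μ I = t := by
    intro α t
    have h1 : curvOperator b Q (holIncl p α) = holIncl p (∑ I,
        ((holFormsBasis p e).repr α I * μ I) • holFormsBasis p e I) := by
      conv_lhs => rw [← (holFormsBasis p e).sum_repr α]
      simp only [map_sum, map_smul, hμ, smul_smul]
    have h2 : (t : ℂ) • α = ∑ I, ((holFormsBasis p e).repr α I * t) • holFormsBasis p e I := by
      conv_lhs => rw [← (holFormsBasis p e).sum_repr α]
      simp only [Finset.smul_sum, smul_smul, mul_comm]
    rw [h1, ← map_smul, (holIncl_injective p).eq_iff, h2]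
    constructor
    · intro h I hI
      have := DFunLike.congr_fun (congrArg (holFormsBasis p e).repr h) I
      rw [Module.Basis.repr_sum_self, Module.Basis.repr_sum_self] at this
      exact Complex.ofReal_injective (mul_left_cancel₀ hI this)
    · intro h
      refine Finset.sum_congr rfl fun I _ => ?_
      by_cases hI : (holFormsBasis p e).repr α I = 0
      · simp [hI]
      · rw [h I hI]
  have hmax : maxEigenvalue p b Q = μ I₀ := by
    refine IsGreatest.csSup_eq ⟨⟨holFormsBasis p e I₀, (holFormsBasis p e).ne_zero I₀, hμ I₀⟩, ?_⟩
    rintro t ⟨α, hα, ht⟩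
    rw [key] at ht
    have : ∃ I, (holFormsBasis p e).repr α I ≠ 0 := by
      by_contra! hall
      exact hα ((holFormsBasis p e).ext_elem fun I => by simpa using hall I)
    obtain ⟨I, hI⟩ := this
    rw [← ht I hI]
    by_cases h : I = I₀
    · rw [h]
    · exact (hI₀ I h).le
  have : α ∈ maxEigenspace p b Q ↔
      curvOperator b Q (holIncl p α) = ((μ I₀ : ℝ) : ℂ) • holIncl p α := by
    rw [← hmax]
    exact Iff.rfl
  rw [this, key]
  constructor
  · intro h I hI
    by_contra h'
    exact (hI₀ I hI).ne (h I h')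
  · intro h I hI
    by_contra h'
    exact hI (h I fun h'' => h' (by rw [h'']))

end CurvatureOperator

/-! ### The maximal eigenline and its projection -/

section EigenlineProjection

open Set.powersetCard

variable {T : Type*} [AddCommGroup T] [Module ℂ T] {d p : ℕ}

/-- A sum of `p` among `d` decreasing numbers is largest for the first `p` ones, and only for them
if there is a gap after the `p`-th number. -/
theorem sum_lt_sum_firstIndices (hpd : p ≤ d) {lam : Fin d → ℝ}
    (hgap : ∀ i j : Fin d, (i : ℕ) < p → p ≤ (j : ℕ) → lam j < lam i)
    {I : Set.powersetCard (Fin d) p} (hI : I ≠ firstIndices hpd) :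
    ∑ a, lam (ofFinEmbEquiv.symm I a) < ∑ a, lam (ofFinEmbEquiv.symm (firstIndices hpd) a) := by
  have hsum : ∀ J : Set.powersetCard (Fin d) p,
      ∑ a, lam (ofFinEmbEquiv.symm J a) = ∑ i ∈ J.val, lam i := by
    intro J
    have h1 : J.val = Finset.univ.map (ofFinEmbEquiv.symm J).toEmbedding := by
      ext i
      rw [Finset.mem_map]
      have := mem_range_ofFinEmbEquiv_symm_iff_mem J i
      simp only [Set.mem_range] at this
      simp only [Finset.mem_univ, true_and, RelEmbedding.coe_toEmbedding]
      exact this.symm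
    conv_rhs => rw [h1, Finset.sum_map]
    rfl
  rw [hsum, hsum]
  set J := firstIndices hpd with hJ
  have hcard : (I.val \ J.val).card = (J.val \ I.val).card := by
    rw [Finset.card_sdiff_comm]
    rw [show I.val.card = p from I.prop, show J.val.card = p from J.prop]
  have hne : (J.val \ I.val).Nonempty := by
    rw [Finset.sdiff_nonempty]
    intro hsub
    exact hI (Subtype.ext (Finset.eq_of_subset_of_card_le hsub (by
      rw [show I.val.card = p from I.prop, show J.val.card = p from J.prop])).symm)
  rw [← Finset.sum_sdiff_lt_sum_sdiff]
  let φ := Finset.equivOfCardEq hcard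
  have hmem : ∀ i : Fin d, i ∈ J.val ↔ (i : ℕ) < p := fun i => mem_firstIndices hpd i
  have hc : ∀ i ∈ I.val \ J.val, ∀ j ∈ J.val \ I.val, lam i < lam j := by
    intro i hi j hj
    rw [Finset.mem_sdiff, hmem] at hi hj
    exact hgap j i hj.1 (not_lt.mp hi.2)
  rw [← Finset.sum_coe_sort (I.val \ J.val), ← Finset.sum_coe_sort (J.val \ I.val),
    ← φ.sum_comp]
  refine Finset.sum_lt_sum (fun i _ => (hc i i.2 _ (φ i).2).le) ?_
  obtain ⟨j, hj⟩ := hne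
  exact ⟨φ.symm ⟨j, hj⟩, Finset.mem_univ _, hc _ (φ.symm ⟨j, hj⟩).2 _ (φ _).2⟩

/-- In the basis of `Λ^{p,0}` given by `b`, the map that an endomorphism of `T^{1,0}` induces on
forms is a compound matrix. -/
theorem coord_exteriorPower_map (b : Module.Basis (Fin d) ℂ T) (A : Module.End ℂ T)
    (I J : Set.powersetCard (Fin d) p) :
    (holFormsBasis p b).coord J (exteriorPower.map p A.dualMap (holFormsBasis p b I)) =
      compound p (LinearMap.toMatrix b b A) I J := by
  rw [holFormsBasis_apply, exteriorPower.map_apply_ιMulti, holFormsBasis,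
    exteriorPower.basis_coord, exteriorPower.ιMultiDual_apply_ιMulti, compound_apply]
  congr 1
  ext i j
  simp [LinearMap.toMatrix_apply]

theorem repr_holFormsBasis (b e : Module.Basis (Fin d) ℂ T) (I J : Set.powersetCard (Fin d) p) :
    (holFormsBasis p b).repr (holFormsBasis p e I) J = compound p (e.toMatrix b) I J := by
  rw [holFormsBasis_apply, holFormsBasis, exteriorPower.basis_repr_apply,
    exteriorPower.ιMultiDual_apply_ιMulti, compound_apply]
  congr 1
  ext i j
  simp [Module.Basis.toMatrix_apply]

/-- The metric on `Λ^{p,0}` does not depend on the unitary frame. -/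
theorem holFormsInner_eq {g : T →ₗ[ℂ] T →ₗ⋆[ℂ] ℂ} {b e : Module.Basis (Fin d) ℂ T}
    (hb : IsUnitaryFrame g b) (he : IsUnitaryFrame g e) (α η : HolForms p T) :
    holFormsInner p b α η = holFormsInner p e α η := by
  set C := compound p (e.toMatrix b) with hC
  have hrepr : ∀ (α : HolForms p T) J, (holFormsBasis p b).repr α J =
      ∑ I, (holFormsBasis p e).repr α I * C I J := by
    intro α J
    conv_lhs => rw [← (holFormsBasis p e).sum_repr α]
    simp only [map_sum, map_smul, Finsupp.coe_finsetSum, Finset.sum_apply, Finsupp.smul_apply,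
      smul_eq_mul, repr_holFormsBasis, hC]
  have hCC : C * C.conjTranspose = 1 := by
    rw [hC, ← compound_conjTranspose, ← compound_mul,
      mul_eq_one_comm.mp (he.conjTranspose_toMatrix_mul hb), compound_one]
  have hCC' : ∀ I I', ∑ J, C I J * conj (C I' J) = if I = I' then 1 else 0 := by
    intro I I'
    rw [← Matrix.one_apply, ← hCC, Matrix.mul_apply]
    rfl
  simp only [holFormsInner, hrepr, map_sum, map_mul, Finset.sum_mul, Finset.mul_sum]
  rw [Finset.sum_comm]
  have : ∀ x y : Set.powersetCard (Fin d) p,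
      ∑ J, (holFormsBasis p e).repr α y * C y J *
        (conj ((holFormsBasis p e).repr η x) * conj (C x J)) =
      if y = x then (holFormsBasis p e).repr α y * conj ((holFormsBasis p e).repr η x) else 0 := by
    intro x y
    rw [← mul_boole, ← hCC', Finset.mul_sum]
    exact Finset.sum_congr rfl fun J _ => by ring
  calc _ = ∑ x, ∑ y, ∑ J, (holFormsBasis p e).repr α y * C y J *
        (conj ((holFormsBasis p e).repr η x) * conj (C x J)) := by
        exact Finset.sum_congr rfl fun x _ => Finset.sum_comm
    _ = _ := by simp only [this]; simp

/-- The projection onto the span of the first `p` vectors of a basis along the other ones. -/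
def frameProj (e : Module.Basis (Fin d) ℂ T) (p : ℕ) : Module.End ℂ T :=
  e.constr ℂ fun i => if (i : ℕ) < p then e i else 0

theorem frameProj_apply (e : Module.Basis (Fin d) ℂ T) (p : ℕ) (i : Fin d) :
    frameProj e p (e i) = if (i : ℕ) < p then e i else 0 := by
  rw [frameProj, Module.Basis.constr_basis]

theorem toMatrix_frameProj (e : Module.Basis (Fin d) ℂ T) (p : ℕ) :
    LinearMap.toMatrix e e (frameProj e p) = stdProj d p := by
  ext i j
  rw [LinearMap.toMatrix_apply, frameProj_apply, stdProj, Matrix.diagonal_apply]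
  by_cases hij : i = j
  · subst hij
    rw [if_pos rfl]
    split_ifs <;> simp
  · split_ifs <;> simp [Ne.symm hij]

/-- `|ψ|⁻² ψ ⊗ ψ*`, for `ψ` in the maximal eigenline, is the map that the spectral projection of
`R` induces on `(p,0)`-forms. -/
theorem rankOne_eq_map_frameProj (hpd : p ≤ d) {g : T →ₗ[ℂ] T →ₗ⋆[ℂ] ℂ}
    {b e : Module.Basis (Fin d) ℂ T} (hb : IsUnitaryFrame g b) (he : IsUnitaryFrame g e)
    {ψ : HolForms p T} (hψ : ψ ≠ 0)
    (hψ' : ∀ I, I ≠ firstIndices hpd → (holFormsBasis p e).repr ψ I = 0) :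
    rankOne p b ψ = exteriorPower.map p (frameProj e p).dualMap := by
  set I₀ := firstIndices hpd
  set a := (holFormsBasis p e).repr ψ I₀ with ha
  have ha0 : a ≠ 0 := by
    intro h0
    refine hψ ((holFormsBasis p e).ext_elem fun I => ?_)
    by_cases h : I = I₀
    · rw [h, ← ha, h0]; simp
    · rw [hψ' I h]; simp
  have hinner : ∀ α, holFormsInner p b α ψ = (holFormsBasis p e).repr α I₀ * conj a := by
    intro α
    rw [holFormsInner_eq hb he, holFormsInner, Finset.sum_eq_single I₀]
    · intro I _ hI
      rw [hψ' I hI, map_zero, mul_zero]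
    · simp
  refine (holFormsBasis p e).ext fun I => (holFormsBasis p e).ext_elem fun J => ?_
  rw [← Module.Basis.coord_apply (holFormsBasis p e) J (exteriorPower.map _ _ _),
    coord_exteriorPower_map, toMatrix_frameProj, compound_stdProj hpd]
  change (holFormsBasis p e).repr ((holFormsInner p b ψ ψ)⁻¹ • holFormsInner p b _ ψ • ψ) J = _
  rw [hinner, hinner, map_smul, map_smul, Finsupp.smul_apply, Finsupp.smul_apply, ← ha,
    Module.Basis.repr_self, Matrix.single_apply]
  have hca : conj a ≠ 0 := (map_ne_zero _).mpr ha0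
  by_cases hI : I = I₀
  · by_cases hJ : J = I₀
    · subst hI hJ
      simp only [Finsupp.single_eq_same, smul_eq_mul, ← ha]
      rw [if_pos (by trivial)]
      field_simp
    · rw [hψ' J hJ, if_neg (fun h => hJ h.2.symm)]
      simp
  · rw [Finsupp.single_eq_of_ne (Ne.symm hI), if_neg (fun h => hI h.1.symm)]
    simp

end EigenlineProjection

section Twisting

variable {d : ℕ} {M : Type*} [TopologicalSpace M] [ChartedSpace (Cn d) M]
  {L : M → Type*} [∀ x, AddCommGroup (L x)] [∀ x, Module ℂ (L x)]
  [TopologicalSpace (Bundle.TotalSpace ℂ L)] [∀ x, TopologicalSpace (L x)] [FiberBundle ℂ L]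
  [IsManifold 𝓘(ℂ, Cn d) ω M]
  {g : HermitianMetric d (Cn d) (HolTangent d : M → Type)} {h : HermitianMetric d ℂ L}

theorem exists_curvEnd_eigenframe {x : M}
    (hQ : ∀ v w, conj (chernCurvature h x v w) = chernCurvature h x w v) :
    ∃ e : Module.Basis (Fin d) ℂ (HolTangent d x), IsUnitaryFrame (g.form x) e ∧
      (∀ i, curvEnd g h x (e i) = (eigval g h (i + 1) x : ℂ) • e i) ∧
      Antitone fun i : Fin d => eigval g h (i + 1) x :=
  exists_unitary_eigenframe (finrank_holTangent x) (g.form x) (g.conj_symm x) (g.pos x) _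
    (typeChange_isSelfAdjoint (g.conj_symm x) (unitaryFrame_isUnitary g x) hQ)

/-- The eigenvalues of `[√-1 R^L, Λ]` on `Λ^{p,0}` are the sums of `p` eigenvalues of `R`, shifted by
a common constant. With a gap after `λ_p` the largest one is simple, and `Ψ` is the map that the
orthogonal projection onto the first `p` eigenvectors of `R` induces on forms. -/
theorem twistingSection_eq {p : ℕ} (hpd : p ≤ d) {x : M}
    (hQ : ∀ v w, conj (chernCurvature h x v w) = chernCurvature h x w v)
    {e : Module.Basis (Fin d) ℂ (HolTangent d x)} (he : IsUnitaryFrame (g.form x) e)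
    {lam : Fin d → ℝ} (hlam : ∀ i, curvEnd g h x (e i) = (lam i : ℂ) • e i)
    (hgap : ∀ i j : Fin d, (i : ℕ) < p → p ≤ (j : ℕ) → lam j < lam i) :
    twistingSection g h p x = exteriorPower.map p (frameProj e p).dualMap := by
  set b := unitaryFrame g x
  set Q := chernCurvature h x
  have hc : ((∑ i, Q (b i) (b i)).re : ℂ) = ∑ i, Q (b i) (b i) := by
    rw [← Complex.conj_eq_iff_re, map_sum]
    exact Finset.sum_congr rfl fun i _ => hQ _ _
  have hmem := mem_maxEigenspace_iff p (b := b) (e := e) (Q := Q)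
    (μ := fun I => ∑ a, lam (Set.powersetCard.ofFinEmbEquiv.symm I a) -
      (∑ i, Q (b i) (b i)).re) (fun I => by
        rw [Complex.ofReal_sub, hc]
        exact curvOperator_holFormsBasis p hlam I)
    (firstIndices hpd) (fun I hI => sub_lt_sub_right (sum_lt_sum_firstIndices hpd hgap hI) _)
  have hex : ∃ ψ ∈ eigenline g h p x, ψ ≠ 0 := by
    refine ⟨holFormsBasis p e (firstIndices hpd), (hmem _).mpr fun I hI => ?_,
      (holFormsBasis p e).ne_zero _⟩
    rw [Module.Basis.repr_self, Finsupp.single_eq_of_ne hI]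
  rw [twistingSection, dif_pos hex]
  exact rankOne_eq_map_frameProj hpd (unitaryFrame_isUnitary g x) he hex.choose_spec.2
    ((hmem _).mp hex.choose_spec.1)

end Twisting

/-! ### Perturbation of spectral projections -/

section Perturbation

open Filter Topology Asymptotics

variable {d : ℕ}

/-- A matrix that has, together with its inverse, bounded entries has a diagonal (in the sense of
permutations) of entries that are bounded from below. -/
theorem exists_perm_le_norm (d : ℕ) {K : ℝ} (hK : 1 ≤ K) :
    ∃ δ > 0, ∀ C C' : Matrix (Fin d) (Fin d) ℂ, C * C' = 1 → (∀ i j, ‖C i j‖ ≤ K) →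
      (∀ i j, ‖C' i j‖ ≤ K) → ∃ σ : Equiv.Perm (Fin d), ∀ i, δ ≤ ‖C (σ i) i‖ := by
  set N : ℝ := d.factorial * K ^ d with hN
  have hN0 : 0 < N := by positivity
  refine ⟨1 / (2 * N * N), by positivity, fun C C' h hC hC' => ?_⟩
  have hdet : ‖C.det‖ * ‖C'.det‖ = 1 := by
    rw [← norm_mul, ← Matrix.det_mul, h, Matrix.det_one, norm_one]
  have hdet' : ‖C'.det‖ ≤ N := by
    have := Matrix.det_le (abv := (IsAbsoluteValue.toAbsoluteValue (norm : ℂ → ℝ))) (A := C')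
      (x := K) hC'
    simpa [hN] using this
  have hlow : 1 ≤ ‖C.det‖ * N := by
    rw [← hdet]
    exact mul_le_mul_of_nonneg_left hdet' (norm_nonneg _)
  by_contra! hno
  have hterm : ∀ σ : Equiv.Perm (Fin d), ‖((Equiv.Perm.sign σ : ℤ) : ℂ) * ∏ i, C (σ i) i‖ ≤
      1 / (2 * N * N) * K ^ d := by
    intro σ
    obtain ⟨i, hi⟩ := hno σ
    have hs : ‖((Equiv.Perm.sign σ : ℤ) : ℂ)‖ = 1 := by
      rcases Int.units_eq_one_or (Equiv.Perm.sign σ) with h | h <;> simp [h]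
    rw [norm_mul, hs, one_mul, norm_prod, ← Finset.mul_prod_erase _ _ (Finset.mem_univ i)]
    refine mul_le_mul hi.le ?_ (Finset.prod_nonneg fun _ _ => norm_nonneg _) (by positivity)
    calc ∏ j ∈ Finset.univ.erase i, ‖C (σ j) j‖ ≤ ∏ _j ∈ Finset.univ.erase i, K :=
          Finset.prod_le_prod (fun _ _ => norm_nonneg _) fun _ _ => hC _ _
      _ = K ^ (d - 1) := by simp
      _ ≤ K ^ d := pow_le_pow_right₀ hK (Nat.sub_le _ _)
  have hup : ‖C.det‖ ≤ 1 / (2 * N) := by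
    rw [Matrix.det_apply']
    calc _ ≤ ∑ _σ : Equiv.Perm (Fin d), 1 / (2 * N * N) * K ^ d :=
          norm_sum_le_of_le _ fun σ _ => hterm σ
      _ = 1 / (2 * N * N) * N := by
          simp only [Finset.sum_const, Finset.card_univ, Fintype.card_perm, Fintype.card_fin,
            nsmul_eq_mul, hN]
          ring
      _ = 1 / (2 * N) := by field_simp
  have : ‖C.det‖ * N ≤ 1 / (2 * N) * N := mul_le_mul_of_nonneg_right hup hN0.le
  have h2 : 1 / (2 * N) * N = 1 / 2 := by field_simp
  linarith

/-- Two decreasing sequences that agree up to `η` after a permutation agree up to `η` on both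
sides of any position, by the pigeonhole principle. -/
theorem le_add_of_perm_close {p : ℕ} (hp : 1 ≤ p) (hpd : p < d) {a b : Fin d → ℝ} (ha : Antitone a)
    (hb : Antitone b) {η : ℝ} (σ : Equiv.Perm (Fin d)) (h : ∀ i, |a (σ i) - b i| ≤ η) :
    b ⟨p, hpd⟩ ≤ a ⟨p, hpd⟩ + η ∧ a ⟨p - 1, by omega⟩ - η ≤ b ⟨p - 1, by omega⟩ := by
  constructor
  · have : ∃ i : Fin d, (i : ℕ) ≤ p ∧ p ≤ (σ i : ℕ) := by
      by_contra! hno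
      have := Finset.card_le_card_of_injOn (s := Finset.univ.filter fun i : Fin d => (i : ℕ) < p + 1)
        (t := Finset.univ.filter fun i : Fin d => (i : ℕ) < p) σ
        (fun i hi => by simpa using hno i (by simpa [Nat.lt_succ_iff] using hi)) σ.injective.injOn
      rw [Fin.card_filter_val_lt, Fin.card_filter_val_lt] at this
      omega
    obtain ⟨i, hi, hi'⟩ := this
    have h1 : b ⟨p, hpd⟩ ≤ b i := hb (Fin.mk_le_mk.mpr hi)
    have h2 : a (σ i) ≤ a ⟨p, hpd⟩ := ha (Fin.mk_le_mk.mpr hi')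
    have := abs_le.mp (h i)
    linarith
  · have : ∃ i : Fin d, p ≤ (i : ℕ) + 1 ∧ (σ i : ℕ) < p := by
      by_contra! hno
      have := Finset.card_le_card_of_injOn (s := Finset.univ.filter fun i : Fin d => (i : ℕ) < p)
        (t := Finset.univ.filter fun i : Fin d => (i : ℕ) < p - 1) σ.symm
        (fun i hi => by
          simp only [Finset.coe_filter, Finset.mem_univ, true_and, Set.mem_ofPred_eq] at hi ⊢
          by_contra hcon
          have := hno (σ.symm i) (by omega)
          rw [Equiv.apply_symm_apply] at this
          omega) σ.symm.injective.injOn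
      rw [Fin.card_filter_val_lt, Fin.card_filter_val_lt] at this
      omega
    obtain ⟨i, hi, hi'⟩ := this
    have h1 : b i ≤ b ⟨p - 1, by omega⟩ := hb (Fin.mk_le_mk.mpr (by omega))
    have h2 : a ⟨p - 1, by omega⟩ ≤ a (σ i) :=
      ha (by rw [Fin.le_def]; change (σ i : ℕ) ≤ p - 1; omega)
    have := abs_le.mp (h i)
    linarith

theorem isBigO_matrix_mul {X : Type*} {l : Filter X} {F G : X → Matrix (Fin d) (Fin d) ℂ}
    {u v : X → ℝ} (hF : ∀ i j, (fun x => F x i j) =O[l] u) (hG : ∀ i j, (fun x => G x i j) =O[l] v)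
    (i j : Fin d) : (fun x => (F x * G x) i j) =O[l] fun x => u x * v x := by
  simp only [Matrix.mul_apply]
  exact IsBigO.fun_sum fun k _ => (hF i k).mul (hG k j)

variable {X : Type*} [NormedAddCommGroup X] [NormedSpace ℝ X]

/-- The case of `differentiableAt_spectralProj` in which the eigenframe at `x₀` is the standard
one. -/
theorem differentiableAt_spectralProj_of_one {p : ℕ} (hp : 1 ≤ p) (hpd : p < d) {x₀ : X}
    {S C C' : X → Matrix (Fin d) (Fin d) ℂ} {lam : X → Fin d → ℝ}
    (hC0 : C x₀ = 1) (hCC : ∀ᶠ x in 𝓝 x₀, C x * C' x = 1)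
    (hSC : ∀ᶠ x in 𝓝 x₀, S x * C x = C x * Matrix.diagonal fun i => (lam x i : ℂ))
    (hlam : ∀ᶠ x in 𝓝 x₀, Antitone (lam x))
    (hgap : lam x₀ ⟨p, hpd⟩ < lam x₀ ⟨p - 1, by omega⟩)
    (hS : ∀ i j, DifferentiableAt ℝ (fun x => S x i j) x₀)
    (hC : ∀ i j, (fun x => C x i j) =O[𝓝 x₀] fun _ => (1 : ℝ))
    (hC' : ∀ i j, (fun x => C' x i j) =O[𝓝 x₀] fun _ => (1 : ℝ)) (i j : Fin d) :
    DifferentiableAt ℝ (fun x => (C x * stdProj d p * C' x) i j) x₀ := by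
  set D₀ : Matrix (Fin d) (Fin d) ℂ := Matrix.diagonal fun i => (lam x₀ i : ℂ) with hD₀
  set P : Matrix (Fin d) (Fin d) ℂ := stdProj d p with hP
  set Δ : X → Matrix (Fin d) (Fin d) ℂ := fun x => S x - D₀ with hΔ
  have hS0 : S x₀ = D₀ := by
    have := hSC.self_of_nhds
    rwa [hC0, Matrix.mul_one, Matrix.one_mul] at this
  have hΔO : ∀ i j, (fun x => Δ x i j) =O[𝓝 x₀] fun x => ‖x - x₀‖ := fun i j => by
    have := (hS i j).isBigO_sub.norm_right
    simpa only [hΔ, Matrix.sub_apply, hS0] using this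
  -- the columns of `C` are approximate eigenvectors of the diagonal matrix `D₀`
  have hcomm : ∀ i j, (fun x => ((lam x₀ i : ℂ) - lam x j) * C x i j) =O[𝓝 x₀]
      fun x => ‖x - x₀‖ := by
    intro i j
    have h1 := (isBigO_matrix_mul hΔO hC i j).neg_left
    simp only [mul_one] at h1
    refine h1.congr' ?_ EventuallyEq.rfl
    filter_upwards [hSC] with x hx
    have := congrFun (congrFun hx i) j
    rw [Matrix.mul_diagonal] at this
    rw [hΔ, Matrix.sub_mul, Matrix.sub_apply, this, hD₀, Matrix.diagonal_mul]
    ring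
  set γ : ℝ := lam x₀ ⟨p - 1, by omega⟩ - lam x₀ ⟨p, hpd⟩ with hγ
  have hγ0 : 0 < γ := by rw [hγ]; linarith
  have hlam0 := hlam.self_of_nhds
  -- the eigenvalues number `p` and `p + 1` are semicontinuous
  have hclose : ∀ᶠ x in 𝓝 x₀, lam x ⟨p, hpd⟩ ≤ lam x₀ ⟨p, hpd⟩ + γ / 2 ∧
      lam x₀ ⟨p - 1, by omega⟩ - γ / 2 ≤ lam x ⟨p - 1, by omega⟩ := by
    have hbdd : ∃ K, 1 ≤ K ∧ ∀ᶠ x in 𝓝 x₀, (∀ i j, ‖C x i j‖ ≤ K) ∧ ∀ i j, ‖C' x i j‖ ≤ K := by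
      choose K hK using fun i j => (hC i j).bound
      choose K' hK' using fun i j => (hC' i j).bound
      refine ⟨1 + ∑ i, ∑ j, (|K i j| + |K' i j|), ?_, ?_⟩
      · have : 0 ≤ ∑ i, ∑ j, (|K i j| + |K' i j|) := by positivity
        linarith
      · have hle : ∀ i j, |K i j| + |K' i j| ≤ ∑ i, ∑ j, (|K i j| + |K' i j|) := fun i j =>
          (Finset.single_le_sum (f := fun j => |K i j| + |K' i j|) (fun _ _ => by positivity)
            (Finset.mem_univ j)).trans
          (Finset.single_le_sum (f := fun i => ∑ j, (|K i j| + |K' i j|))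
            (fun _ _ => by positivity) (Finset.mem_univ i))
        filter_upwards [eventually_all.mpr fun i => eventually_all.mpr fun j => hK i j,
          eventually_all.mpr fun i => eventually_all.mpr fun j => hK' i j] with x h1 h2
        refine ⟨fun i j => ?_, fun i j => ?_⟩
        · have := h1 i j
          rw [norm_one, mul_one] at this
          linarith [le_abs_self (K i j), abs_nonneg (K' i j), hle i j]
        · have := h2 i j
          rw [norm_one, mul_one] at this
          linarith [le_abs_self (K' i j), abs_nonneg (K i j), hle i j]
    obtain ⟨K, hK1, hK⟩ := hbdd
    obtain ⟨δ, hδ, hperm⟩ := exists_perm_le_norm d hK1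
    have hsmall : ∀ i j, ∀ᶠ x in 𝓝 x₀, ‖((lam x₀ i : ℂ) - lam x j) * C x i j‖ < δ * (γ / 2) := by
      intro i j
      have h0 : Tendsto (fun x => ‖x - x₀‖) (𝓝 x₀) (𝓝 0) := tendsto_norm_sub_self x₀
      have := ((hcomm i j).trans_tendsto h0).norm
      rw [norm_zero] at this
      exact this.eventually_lt_const (by positivity)
    filter_upwards [hK, hCC, hlam, eventually_all.mpr fun i => eventually_all.mpr fun j =>
      hsmall i j] with x hKx hx hanti hsm
    obtain ⟨σ, hσ⟩ := hperm _ _ hx hKx.1 hKx.2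
    refine le_add_of_perm_close hp hpd hlam0 hanti σ fun i => ?_
    have h1 := hsm (σ i) i
    rw [norm_mul, ← Complex.ofReal_sub, Complex.norm_real, Real.norm_eq_abs] at h1
    have h2 : |lam x₀ (σ i) - lam x i| * δ < γ / 2 * δ := by
      calc _ ≤ _ := mul_le_mul_of_nonneg_left (hσ i) (abs_nonneg _)
        _ < _ := by rw [mul_comm (γ / 2)]; exact h1
    exact (lt_of_mul_lt_mul_right h2 hδ.le).le
  -- hence the off-diagonal blocks of `C` are small
  have hCoff : ∀ i j : Fin d, ¬((i : ℕ) < p ↔ (j : ℕ) < p) →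
      (fun x => C x i j) =O[𝓝 x₀] fun x => ‖x - x₀‖ := by
    intro i j hij
    refine IsBigO.trans (IsBigO.of_bound (2 / γ) ?_) (hcomm i j)
    filter_upwards [hclose, hlam] with x hx hanti
    have habs : γ / 2 ≤ |lam x₀ i - lam x j| := by
      by_cases hi : (i : ℕ) < p
      · have hj : p ≤ (j : ℕ) := by omega
        have h1 : lam x j ≤ lam x ⟨p, hpd⟩ := hanti (Fin.mk_le_mk.mpr hj)
        have h2 : lam x₀ ⟨p - 1, by omega⟩ ≤ lam x₀ i := hlam0 (Fin.mk_le_mk.mpr (by omega))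
        refine le_trans ?_ (le_abs_self _)
        linarith [hx.1]
      · have hj : (j : ℕ) < p := by omega
        have h1 : lam x ⟨p - 1, by omega⟩ ≤ lam x j := hanti (Fin.mk_le_mk.mpr (by omega))
        have h2 : lam x₀ i ≤ lam x₀ ⟨p, hpd⟩ := hlam0 (Fin.mk_le_mk.mpr (by omega))
        rw [abs_sub_comm]
        refine le_trans ?_ (le_abs_self _)
        linarith [hx.2]
    rw [norm_mul, ← Complex.ofReal_sub, Complex.norm_real, Real.norm_eq_abs]
    calc ‖C x i j‖ = 2 / γ * (γ / 2 * ‖C x i j‖) := by field_simp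
      _ ≤ _ := by gcongr
  set A : X → Matrix (Fin d) (Fin d) ℂ := fun x => C x * P * C' x with hA
  set E : X → Matrix (Fin d) (Fin d) ℂ := fun x => A x - P with hE
  set χ : Fin d → ℂ := fun i => if (i : ℕ) < p then 1 else 0 with hχ
  have hPP : P * P = P := by
    rw [hP, stdProj, Matrix.diagonal_mul_diagonal]
    congr 1
    ext i
    split_ifs <;> simp
  have hEO : ∀ i j, (fun x => E x i j) =O[𝓝 x₀] fun x => ‖x - x₀‖ := by
    have h1 : ∀ i j, (fun x => (C x * P - P * C x) i j) =O[𝓝 x₀] fun x => ‖x - x₀‖ := by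
      intro i j
      have h2 : ∀ x, (C x * P - P * C x) i j = (χ j - χ i) * C x i j := fun x => by
        rw [hP, stdProj, Matrix.sub_apply, Matrix.mul_diagonal, Matrix.diagonal_mul]
        simp only [χ]
        ring
      simp only [h2]
      by_cases hij : (i : ℕ) < p ↔ (j : ℕ) < p
      · have : χ j - χ i = 0 := by simp [χ, hij]
        simp [this, isBigO_zero]
      · exact (hCoff i j hij).const_mul_left _
    intro i j
    have h3 := isBigO_matrix_mul h1 hC' i j
    simp only [mul_one] at h3
    refine h3.congr' ?_ EventuallyEq.rfl
    filter_upwards [hCC] with x hx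
    rw [hE, hA, Matrix.sub_mul, Matrix.mul_assoc P, hx, Matrix.mul_one]
  have hsq : ∀ {F G : X → Matrix (Fin d) (Fin d) ℂ},
      (∀ i j, (fun x => F x i j) =O[𝓝 x₀] fun x => ‖x - x₀‖) →
      (∀ i j, (fun x => G x i j) =O[𝓝 x₀] fun x => ‖x - x₀‖) → ∀ i j,
      (fun x => (F x * G x) i j) =O[𝓝 x₀] fun x => ‖x - x₀‖ ^ 2 := fun hF hG i j => by
    simpa only [sq] using isBigO_matrix_mul hF hG i j
  -- `E` agrees to second order with a linear function of `S`
  have hlin : ∀ i j, ∃ c : ℂ, (fun x => E x i j - c * Δ x i j) =O[𝓝 x₀] fun x => ‖x - x₀‖ ^ 2 := by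
    intro i j
    by_cases hij : (i : ℕ) < p ↔ (j : ℕ) < p
    · refine ⟨0, ?_⟩
      simp only [zero_mul, sub_zero]
      refine IsBigO.congr' ((hsq hEO hEO i j).const_mul_left (1 - χ j - χ i)) ?_ EventuallyEq.rfl
      filter_upwards [hCC] with x hx
      have hAA : A x * A x = A x := by
        calc C x * P * C' x * (C x * P * C' x)
            = C x * P * (C' x * C x) * (P * C' x) := by simp only [Matrix.mul_assoc]
          _ = C x * (P * P) * C' x := by
            rw [mul_eq_one_comm.mp hx, Matrix.mul_one]; simp only [Matrix.mul_assoc]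
          _ = _ := by rw [hPP]
      have h1 : E x * E x = E x - E x * P - P * E x := by
        simp only [hE, Matrix.sub_mul, Matrix.mul_sub, hAA, hPP]
        abel
      have h2 : (E x * E x) i j = (1 - χ j - χ i) * E x i j := by
        rw [h1, hP, stdProj, Matrix.sub_apply, Matrix.sub_apply, Matrix.mul_diagonal,
          Matrix.diagonal_mul]
        simp only [χ]
        ring
      have h3 : (1 - χ j - χ i) * (1 - χ j - χ i) = 1 := by
        simp only [χ, hij]
        split_ifs <;> ring
      rw [h2, ← mul_assoc, h3, one_mul]
    · have hne : (lam x₀ i : ℂ) - lam x₀ j ≠ 0 := by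
        rw [← Complex.ofReal_sub]
        refine Complex.ofReal_ne_zero.mpr (sub_ne_zero.mpr ?_)
        by_cases hi : (i : ℕ) < p
        · have hj : p ≤ (j : ℕ) := by omega
          have h1 : lam x₀ j ≤ lam x₀ ⟨p, hpd⟩ := hlam0 (Fin.mk_le_mk.mpr hj)
          have h2 : lam x₀ ⟨p - 1, by omega⟩ ≤ lam x₀ i := hlam0 (Fin.mk_le_mk.mpr (by omega))
          linarith
        · have hj : (j : ℕ) < p := by omega
          have h1 : lam x₀ i ≤ lam x₀ ⟨p, hpd⟩ := hlam0 (Fin.mk_le_mk.mpr (by omega))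
          have h2 : lam x₀ ⟨p - 1, by omega⟩ ≤ lam x₀ j := hlam0 (Fin.mk_le_mk.mpr (by omega))
          linarith
      refine ⟨((lam x₀ i : ℂ) - lam x₀ j)⁻¹ * (χ i - χ j), ?_⟩
      refine IsBigO.congr' (((hsq hEO hΔO i j).sub (hsq hΔO hEO i j)).const_mul_left
        ((lam x₀ i : ℂ) - lam x₀ j)⁻¹) ?_ EventuallyEq.rfl
      filter_upwards [hCC, hSC] with x hx hx'
      have hC'C := mul_eq_one_comm.mp hx
      have hSA : S x * A x = A x * S x := by
        have hC'S : C' x * S x = (Matrix.diagonal fun i => (lam x i : ℂ)) * C' x := by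
          calc C' x * S x = C' x * (S x * C x) * C' x := by
                rw [Matrix.mul_assoc, Matrix.mul_assoc, hx, Matrix.mul_one]
            _ = _ := by rw [hx', ← Matrix.mul_assoc, hC'C, Matrix.one_mul]
        calc S x * (C x * P * C' x) = (S x * C x) * P * C' x := by simp only [Matrix.mul_assoc]
          _ = C x * ((Matrix.diagonal fun i => (lam x i : ℂ)) * P) * C' x := by
            rw [hx']; simp only [Matrix.mul_assoc]
          _ = C x * (P * (Matrix.diagonal fun i => (lam x i : ℂ))) * C' x := by
            rw [hP, stdProj, Matrix.diagonal_mul_diagonal, Matrix.diagonal_mul_diagonal]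
            simp only [mul_comm]
          _ = C x * P * (C' x * S x) := by rw [hC'S]; simp only [Matrix.mul_assoc]
          _ = _ := by simp only [hA, Matrix.mul_assoc]
      have hDP : D₀ * P = P * D₀ := by
        rw [hP, stdProj, hD₀, Matrix.diagonal_mul_diagonal, Matrix.diagonal_mul_diagonal]
        simp only [mul_comm]
      have h1 : D₀ * E x - E x * D₀ = (P * Δ x - Δ x * P) + (E x * Δ x - Δ x * E x) := by
        simp only [hE, hΔ, Matrix.sub_mul, Matrix.mul_sub, hDP, hSA]
        abel
      have h2 := congrFun (congrFun h1 i) j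
      simp only [Matrix.sub_apply, Matrix.add_apply] at h2
      rw [hD₀, Matrix.mul_diagonal, Matrix.diagonal_mul, hP, stdProj, Matrix.mul_diagonal,
        Matrix.diagonal_mul] at h2
      have h3 : (E x * Δ x) i j - (Δ x * E x) i j =
          ((lam x₀ i : ℂ) - lam x₀ j) * E x i j - (χ i - χ j) * Δ x i j := by
        simp only [χ]
        linear_combination -h2
      rw [h3, mul_sub, ← mul_assoc, inv_mul_cancel₀ hne, one_mul, mul_assoc]
  obtain ⟨c, hc⟩ := hlin i j
  have hE0 : E x₀ i j - c * Δ x₀ i j = 0 := by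
    have hC'0 : C' x₀ = 1 := by
      have := hCC.self_of_nhds
      rwa [hC0, Matrix.one_mul] at this
    simp [hE, hA, hΔ, hS0, hC0, hC'0]
  have hdiff : DifferentiableAt ℝ (fun x => E x i j - c * Δ x i j) x₀ := by
    refine HasFDerivAt.differentiableAt (f' := 0) (HasFDerivAt.of_isLittleO ?_)
    simp only [hE0, sub_zero, _root_.zero_apply]
    refine hc.trans_isLittleO ?_
    have h1 : (fun x => ‖x - x₀‖) =o[𝓝 x₀] fun _ => (1 : ℝ) := by
      rw [isLittleO_one_iff]
      exact tendsto_norm_sub_self x₀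
    have h2 := h1.mul_isBigO (isBigO_refl (fun x => ‖x - x₀‖) (𝓝 x₀))
    simpa only [sq, one_mul, isLittleO_norm_right] using h2
  have hfin : (fun x => (C x * P * C' x) i j) =
      fun x => (E x i j - c * Δ x i j) + (c * (S x i j - D₀ i j) + P i j) := by
    ext x
    simp only [hE, hA, hΔ, Matrix.sub_apply]
    ring
  rw [hfin]
  exact hdiff.add ((((hS i j).sub_const _).const_mul c).add_const _)

/-- The spectral projection onto the first `p` eigenspaces is differentiable where `S` is and where
there is a gap after the `p`-th eigenvalue. The eigenframes (columns of `B`) need not be continuous,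
only bounded together with their inverses. -/
theorem differentiableAt_spectralProj {p : ℕ} (hp : 1 ≤ p) (hpd : p < d) {x₀ : X}
    {S B B' : X → Matrix (Fin d) (Fin d) ℂ} {lam : X → Fin d → ℝ}
    (hBB : ∀ᶠ x in 𝓝 x₀, B x * B' x = 1)
    (hSB : ∀ᶠ x in 𝓝 x₀, S x * B x = B x * Matrix.diagonal fun i => (lam x i : ℂ))
    (hlam : ∀ᶠ x in 𝓝 x₀, Antitone (lam x))
    (hgap : lam x₀ ⟨p, hpd⟩ < lam x₀ ⟨p - 1, by omega⟩)
    (hS : ∀ i j, DifferentiableAt ℝ (fun x => S x i j) x₀)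
    (hB : ∀ i j, (fun x => B x i j) =O[𝓝 x₀] fun _ => (1 : ℝ))
    (hB' : ∀ i j, (fun x => B' x i j) =O[𝓝 x₀] fun _ => (1 : ℝ)) (i j : Fin d) :
    DifferentiableAt ℝ (fun x => (B x * stdProj d p * B' x) i j) x₀ := by
  have h0 := hBB.self_of_nhds
  have h0' := mul_eq_one_comm.mp h0
  have hconst : ∀ (N : Matrix (Fin d) (Fin d) ℂ) (i j : Fin d),
      (fun _ : X => N i j) =O[𝓝 x₀] fun _ => (1 : ℝ) := fun N i j => isBigO_const_one ℝ _ _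
  have hmul : ∀ {F G : X → Matrix (Fin d) (Fin d) ℂ},
      (∀ i j, DifferentiableAt ℝ (fun x => F x i j) x₀) →
      (∀ i j, DifferentiableAt ℝ (fun x => G x i j) x₀) → ∀ i j,
      DifferentiableAt ℝ (fun x => (F x * G x) i j) x₀ := fun hF hG i j => by
    simp only [Matrix.mul_apply]
    exact DifferentiableAt.fun_sum fun k _ => (hF i k).mul (hG k j)
  have key := differentiableAt_spectralProj_of_one hp hpd (x₀ := x₀)
    (S := fun x => B' x₀ * S x * B x₀) (C := fun x => B' x₀ * B x) (C' := fun x => B' x * B x₀)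
    (lam := lam) h0' (by
      filter_upwards [hBB] with x hx
      rw [Matrix.mul_assoc, ← Matrix.mul_assoc (B x), hx, Matrix.one_mul, h0']) (by
      filter_upwards [hSB] with x hx
      calc B' x₀ * S x * B x₀ * (B' x₀ * B x) = B' x₀ * S x * (B x₀ * B' x₀) * B x := by
            simp only [Matrix.mul_assoc]
        _ = B' x₀ * (S x * B x) := by rw [h0, Matrix.mul_one, Matrix.mul_assoc]
        _ = _ := by rw [hx, Matrix.mul_assoc]) hlam hgap
    (hmul (hmul (fun _ _ => differentiableAt_const _) hS) fun _ _ => differentiableAt_const _)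
    (by simpa only [mul_one] using isBigO_matrix_mul (hconst (B' x₀)) hB)
    (by simpa only [mul_one] using isBigO_matrix_mul hB' (hconst (B x₀)))
  have h2 := hmul (hmul (F := fun _ => B x₀) (fun _ _ => differentiableAt_const _) key)
    (G := fun _ => B' x₀) (fun _ _ => differentiableAt_const _) i j
  refine h2.congr_of_eventuallyEq (Eventually.of_forall fun x => ?_)
  have : B x₀ * (B' x₀ * B x * stdProj d p * (B' x * B x₀)) * B' x₀ =
      (B x₀ * B' x₀) * (B x * stdProj d p * B' x) * (B x₀ * B' x₀) := by
    simp only [Matrix.mul_assoc]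
  simp only [this, h0, Matrix.one_mul, Matrix.mul_one]

end Perturbation

/-! ### The operators `∂` and `∂̄` on `ℂ^d` -/

section ModelCalculus

open Filter Topology

variable {d : ℕ}

/-- `∂̄F(v̄)` at `u` for a function on `ℂ^d`. -/
def dbarE (F : Cn d → ℂ) (u v : Cn d) : ℂ :=
  (fderiv ℝ F u v + Complex.I * fderiv ℝ F u (Complex.I • v)) / 2

/-- `∂F(v)` at `u` for a function on `ℂ^d`. -/
def delE (F : Cn d → ℂ) (u v : Cn d) : ℂ :=
  (fderiv ℝ F u v - Complex.I * fderiv ℝ F u (Complex.I • v)) / 2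

/-- The standard basis vector `∂_i` of `ℂ^d`. -/
abbrev stdVec (i : Fin d) : Cn d := EuclideanSpace.single i (1 : ℂ)

theorem sum_smul_stdVec (v : Cn d) : ∑ i, v i • stdVec i = v := by
  ext j
  simp [Finset.sum_apply, Pi.single_apply]

variable {F G : Cn d → ℂ} {u v w : Cn d}

theorem dbarE_congr (h : F =ᶠ[𝓝 u] G) : dbarE F u = dbarE G u := by
  ext v
  rw [dbarE, dbarE, h.fderiv_eq]

theorem delE_congr (h : F =ᶠ[𝓝 u] G) : delE F u = delE G u := by
  ext v
  rw [delE, delE, h.fderiv_eq]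

theorem fderiv_real_of_holomorphic (h : DifferentiableAt ℂ F u) (v : Cn d) :
    fderiv ℝ F u v = fderiv ℂ F u v := by
  rw [(h.hasFDerivAt.restrictScalars ℝ).fderiv]
  rfl

theorem dbarE_of_holomorphic (h : DifferentiableAt ℂ F u) : dbarE F u v = 0 := by
  rw [dbarE, fderiv_real_of_holomorphic h, fderiv_real_of_holomorphic h, map_smul, smul_eq_mul,
    ← mul_assoc, Complex.I_mul_I]
  ring

theorem delE_of_holomorphic (h : DifferentiableAt ℂ F u) : delE F u v = fderiv ℂ F u v := by
  rw [delE, fderiv_real_of_holomorphic h, fderiv_real_of_holomorphic h, map_smul, smul_eq_mul,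
    ← mul_assoc, Complex.I_mul_I]
  ring

theorem fderiv_conj (h : DifferentiableAt ℝ F u) (v : Cn d) :
    fderiv ℝ (fun x => conj (F x)) u v = conj (fderiv ℝ F u v) := by
  have := (Complex.conjCLE.toContinuousLinearMap.hasFDerivAt.comp u h.hasFDerivAt).fderiv
  change fderiv ℝ (Complex.conjCLE ∘ F) u v = _
  exact DFunLike.congr_fun this v

theorem DifferentiableAt.conj' (h : DifferentiableAt ℝ F u) :
    DifferentiableAt ℝ (fun x => conj (F x)) u :=
  (Complex.conjCLE.toContinuousLinearMap.hasFDerivAt.comp u h.hasFDerivAt).differentiableAt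

theorem conj_dbarE (h : DifferentiableAt ℝ F u) :
    conj (dbarE F u v) = delE (fun x => conj (F x)) u v := by
  simp only [dbarE, delE, fderiv_conj h, map_div₀, map_add, map_mul, Complex.conj_I, map_ofNat]
  ring

theorem conj_delE (h : DifferentiableAt ℝ F u) :
    conj (delE F u v) = dbarE (fun x => conj (F x)) u v := by
  simp only [dbarE, delE, fderiv_conj h, map_div₀, map_sub, map_mul, Complex.conj_I, map_ofNat]
  ring

theorem dbarE_mul (hF : DifferentiableAt ℝ F u) (hG : DifferentiableAt ℝ G u) :
    dbarE (fun x => F x * G x) u v = dbarE F u v * G u + F u * dbarE G u v := by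
  simp only [dbarE, fderiv_fun_mul hF hG, _root_.add_apply,
    _root_.smul_apply, smul_eq_mul]
  ring

theorem delE_mul (hF : DifferentiableAt ℝ F u) (hG : DifferentiableAt ℝ G u) :
    delE (fun x => F x * G x) u v = delE F u v * G u + F u * delE G u v := by
  simp only [delE, fderiv_fun_mul hF hG, _root_.add_apply,
    _root_.smul_apply, smul_eq_mul]
  ring

theorem dbarE_add (hF : DifferentiableAt ℝ F u) (hG : DifferentiableAt ℝ G u) :
    dbarE (fun x => F x + G x) u v = dbarE F u v + dbarE G u v := by
  simp only [dbarE, fderiv_fun_add hF hG, _root_.add_apply]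
  ring

theorem dbarE_sum {ι : Type*} (s : Finset ι) {F : ι → Cn d → ℂ}
    (hF : ∀ i ∈ s, DifferentiableAt ℝ (F i) u) :
    dbarE (fun x => ∑ i ∈ s, F i x) u v = ∑ i ∈ s, dbarE (F i) u v := by
  simp only [dbarE, fderiv_fun_sum hF, _root_.sum_apply, Finset.mul_sum,
    ← Finset.sum_add_distrib, Finset.sum_div]

theorem dbarE_const (a : ℂ) : dbarE (fun _ => a) u v = 0 :=
  dbarE_of_holomorphic (differentiableAt_const a)

theorem dbarE_inv (hF : DifferentiableAt ℝ F u) (h0 : F u ≠ 0) :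
    dbarE (fun x => (F x)⁻¹) u v = -dbarE F u v / F u ^ 2 := by
  have h1 : DifferentiableAt ℝ (fun x => (F x)⁻¹) u := hF.inv h0
  have h2 : (fun x => F x * (F x)⁻¹) =ᶠ[𝓝 u] fun _ => 1 := by
    filter_upwards [hF.continuousAt.eventually_ne h0] with x hx
    exact mul_inv_cancel₀ hx
  have h3 : dbarE (fun x => F x * (F x)⁻¹) u v = 0 := by
    rw [dbarE_congr h2, dbarE_const]
  rw [dbarE_mul hF h1] at h3
  field_simp at h3 ⊢
  linear_combination h3

theorem dbarE_vec_add : dbarE F u (v + w) = dbarE F u v + dbarE F u w := by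
  simp only [dbarE, smul_add, map_add]
  ring

theorem dbarE_vec_smul (a : ℂ) : dbarE F u (a • v) = conj a * dbarE F u v := by
  have h1 : ∀ v : Cn d, fderiv ℝ F u (a • v) =
      a.re * fderiv ℝ F u v + a.im * fderiv ℝ F u (Complex.I • v) := by
    intro v
    have : a • v = a.re • v + a.im • (Complex.I • v) := by
      conv_lhs => rw [← Complex.re_add_im a, add_smul, mul_smul]
      rfl
    rw [this, map_add, map_smul, map_smul, Complex.real_smul, Complex.real_smul]
  have h2 : Complex.I • a • v = a • Complex.I • v := smul_comm _ _ _
  have h3 : Complex.I • Complex.I • v = -v := by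
    rw [smul_smul, Complex.I_mul_I, neg_one_smul]
  have h4 : conj a = a.re - a.im * Complex.I := by
    apply Complex.ext <;> simp
  rw [dbarE, h2, h1, h1, h3, map_neg, dbarE, h4]
  linear_combination (a.im * fderiv ℝ F u (Complex.I • v) / 2) * Complex.I_mul_I

theorem dbarE_eq_sum : dbarE F u w = ∑ l, conj (w l) * dbarE F u (stdVec l) := by
  let φ : Cn d →+ ℂ := ⟨⟨dbarE F u, by simp [dbarE]⟩, fun _ _ => dbarE_vec_add⟩
  conv_lhs => rw [← sum_smul_stdVec w]
  change φ _ = _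
  rw [map_sum]
  exact Finset.sum_congr rfl fun l _ => dbarE_vec_smul _

theorem delE_vec_sum : delE F u w = ∑ l, w l * delE F u (stdVec l) := by
  have key : ∀ x : Cn d, delE F u x = conj (dbarE (fun y => conj (F y)) u x) := by
    intro x
    have hconj : ∀ y : Cn d, fderiv ℝ (fun x => conj (F x)) u y = conj (fderiv ℝ F u y) := by
      intro y
      by_cases hd : DifferentiableAt ℝ F u
      · exact fderiv_conj hd y
      · have hd' : ¬ DifferentiableAt ℝ (fun x => conj (F x)) u := fun h' => by
          have := h'.conj'
          simp only [Complex.conj_conj] at this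
          exact hd this
        rw [fderiv_zero_of_not_differentiableAt hd, fderiv_zero_of_not_differentiableAt hd']
        simp
    simp only [dbarE, delE, hconj, map_div₀, map_add, map_mul, Complex.conj_I, map_ofNat,
      Complex.conj_conj]
    ring
  simp only [key]
  rw [dbarE_eq_sum]
  simp

/-- The determinant as a continuous multilinear function of the rows. -/
def detMultilinear (n : ℕ) : ContinuousMultilinearMap ℂ (fun _ : Fin n => Fin n → ℂ) ℂ :=
  { (Matrix.detRowAlternating (R := ℂ) (n := Fin n)).toMultilinearMap with
    cont := continuous_id.matrix_det }

theorem hasFDerivAt_det {n : ℕ} {N : Cn d → Matrix (Fin n) (Fin n) ℂ}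
    (hN : ∀ a c, DifferentiableAt ℝ (fun x => N x a c) u) :
    HasFDerivAt (fun x => (N x).det)
      (((detMultilinear n).linearDeriv (fun a c => N u a c)).restrictScalars ℝ ∘L
        fderiv ℝ (fun x a c => N x a c) u) u := by
  have hN' : DifferentiableAt ℝ (fun x a c => N x a c) u :=
    differentiableAt_pi.mpr fun a => differentiableAt_pi.mpr fun c => hN a c
  exact (((detMultilinear n).hasFDerivAt (fun a c => N u a c)).restrictScalars ℝ).comp u
    hN'.hasFDerivAt

theorem differentiableAt_det {n : ℕ} {N : Cn d → Matrix (Fin n) (Fin n) ℂ}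
    (hN : ∀ a c, DifferentiableAt ℝ (fun x => N x a c) u) :
    DifferentiableAt ℝ (fun x => (N x).det) u :=
  (hasFDerivAt_det hN).differentiableAt

/-- The derivative of a determinant, row by row. -/
theorem dbarE_det {n : ℕ} {N : Cn d → Matrix (Fin n) (Fin n) ℂ}
    (hN : ∀ a c, DifferentiableAt ℝ (fun x => N x a c) u) :
    dbarE (fun x => (N x).det) u v =
      ∑ r, ((N u).updateRow r fun c => dbarE (fun x => N x r c) u v).det := by
  have hN' : DifferentiableAt ℝ (fun x a c => N x a c) u :=
    differentiableAt_pi.mpr fun a => differentiableAt_pi.mpr fun c => hN a c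
  have hfd : ∀ v : Cn d, fderiv ℝ (fun x => (N x).det) u v =
      ∑ r, ((N u).updateRow r fun c => fderiv ℝ (fun x => N x r c) u v).det := by
    intro v
    rw [(hasFDerivAt_det hN).fderiv]
    change (detMultilinear n).linearDeriv (fun a c => N u a c)
      (fderiv ℝ (fun x a c => N x a c) u v) = _
    rw [ContinuousMultilinearMap.linearDeriv_apply]
    refine Finset.sum_congr rfl fun r _ => ?_
    have h2 : fderiv ℝ (fun x a c => N x a c) u v r =
        fun c => fderiv ℝ (fun x => N x r c) u v := by
      ext c
      have h3 := hasFDerivAt_pi'.mp hN'.hasFDerivAt r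
      have h4 := hasFDerivAt_pi'.mp h3 c
      exact (DFunLike.congr_fun h4.fderiv v).symm
    rw [h2]
    rfl
  rw [dbarE, hfd, hfd, Finset.mul_sum, ← Finset.sum_add_distrib, Finset.sum_div]
  refine Finset.sum_congr rfl fun r _ => ?_
  have h5 : (fun c => dbarE (fun x => N x r c) u v) = (1 / 2 : ℂ) •
      ((fun c => fderiv ℝ (fun x => N x r c) u v) +
        Complex.I • fun c => fderiv ℝ (fun x => N x r c) u (Complex.I • v)) := by
    ext c
    simp [dbarE]
    ring
  rw [h5, Matrix.det_updateRow_smul, Matrix.det_updateRow_add, Matrix.det_updateRow_smul]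
  ring

/-- The entrywise `∂̄` of a matrix-valued function. -/
def dbarMat {m n : Type*} (N : Cn d → Matrix m n ℂ) (u v : Cn d) : Matrix m n ℂ :=
  Matrix.of fun i j => dbarE (fun x => N x i j) u v

theorem dbarMat_mul {l m n : Type*} [Fintype m] {N : Cn d → Matrix l m ℂ}
    {N' : Cn d → Matrix m n ℂ} (hN : ∀ i j, DifferentiableAt ℝ (fun x => N x i j) u)
    (hN' : ∀ i j, DifferentiableAt ℝ (fun x => N' x i j) u) :
    dbarMat (fun x => N x * N' x) u v = dbarMat N u v * N' u + N u * dbarMat N' u v := by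
  ext i j
  simp only [dbarMat, Matrix.of_apply, Matrix.add_apply, Matrix.mul_apply]
  rw [dbarE_sum (F := fun k x => N x i k * N' x k j) _ fun k _ => (hN i k).mul (hN' k j),
    ← Finset.sum_add_distrib]
  exact Finset.sum_congr rfl fun k _ => dbarE_mul (hN i k) (hN' k j)

theorem differentiableAt_matrix_mul {l m n : Type*} [Fintype m] {N : Cn d → Matrix l m ℂ}
    {N' : Cn d → Matrix m n ℂ} (hN : ∀ i j, DifferentiableAt ℝ (fun x => N x i j) u)
    (hN' : ∀ i j, DifferentiableAt ℝ (fun x => N' x i j) u) (i : l) (j : n) :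
    DifferentiableAt ℝ (fun x => (N x * N' x) i j) u := by
  simp only [Matrix.mul_apply]
  exact DifferentiableAt.fun_sum fun k _ => (hN i k).mul (hN' k j)

theorem dbarMat_congr {m n : Type*} {N N' : Cn d → Matrix m n ℂ} (h : N =ᶠ[𝓝 u] N') :
    dbarMat N u v = dbarMat N' u v := by
  ext i j
  exact congrFun (dbarE_congr (h.mono fun x hx => congrFun (congrFun hx i) j)) v

theorem dbarMat_const {m n : Type*} (N : Matrix m n ℂ) : dbarMat (fun _ => N) u v = 0 := by
  ext i j
  exact dbarE_const _

/-! ### The Chern connection and curvature coefficients on `ℂ^d` -/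

/-- The coefficient `θ_i = H⁻¹ ∂_i H` of the Chern connection for the squared norm `H` of a
holomorphic frame. -/
def connE (H : Cn d → ℂ) (i : Fin d) (u : Cn d) : ℂ := (H u)⁻¹ * delE H u (stdVec i)

theorem contDiffAt_delE {H : Cn d → ℂ} {n : ℕ} (hH : ContDiffAt ℝ (n + 1) H u) (v : Cn d) :
    ContDiffAt ℝ n (fun x => delE H x v) u := by
  have h1 : ∀ w : Cn d, ContDiffAt ℝ n (fun x => fderiv ℝ H x w) u := fun w =>
    (hH.fderiv_right (by norm_cast)).clm_apply contDiffAt_const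
  exact ((h1 v).sub (contDiffAt_const.mul (h1 _))).div_const 2

theorem contDiffAt_dbarE {H : Cn d → ℂ} {n : ℕ} (hH : ContDiffAt ℝ (n + 1) H u) (v : Cn d) :
    ContDiffAt ℝ n (fun x => dbarE H x v) u := by
  have h1 : ∀ w : Cn d, ContDiffAt ℝ n (fun x => fderiv ℝ H x w) u := fun w =>
    (hH.fderiv_right (by norm_cast)).clm_apply contDiffAt_const
  exact ((h1 v).add (contDiffAt_const.mul (h1 _))).div_const 2

theorem contDiffAt_connE {H : Cn d → ℂ} {n : ℕ} (hH : ContDiffAt ℝ (n + 1) H u) (h0 : H u ≠ 0)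
    (i : Fin d) : ContDiffAt ℝ n (connE H i) u :=
  ((hH.of_le (by norm_cast; omega)).inv h0).mul (contDiffAt_delE hH _)

/-- `∂` and `∂̄` commute, by the symmetry of second derivatives. -/
theorem dbarE_delE_comm {H : Cn d → ℂ} (hH : ContDiffAt ℝ 2 H u) (v w : Cn d) :
    dbarE (fun x => delE H x v) u w = delE (fun x => dbarE H x w) u v := by
  have hd : DifferentiableAt ℝ (fderiv ℝ H) u :=
    (hH.fderiv_right (m := 1) (by norm_num)).differentiableAt one_ne_zero
  have hsymm : IsSymmSndFDerivAt ℝ H u := hH.isSymmSndFDerivAt (by simp)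
  have happ : ∀ a : Cn d, DifferentiableAt ℝ (fun x => fderiv ℝ H x a) u := fun a =>
    hd.clm_apply (differentiableAt_const a)
  have hsnd : ∀ a b : Cn d, fderiv ℝ (fun x => fderiv ℝ H x a) u b =
      fderiv ℝ (fderiv ℝ H) u b a := fun a b => by
    rw [fderiv_clm_apply hd (differentiableAt_const a)]
    simp
  have h1 : ∀ b, fderiv ℝ (fun x => delE H x v) u b = (fderiv ℝ (fderiv ℝ H) u b v -
      Complex.I * fderiv ℝ (fderiv ℝ H) u b (Complex.I • v)) / 2 := by
    intro b
    have := (((happ v).hasFDerivAt.sub ((happ (Complex.I • v)).hasFDerivAt.const_mul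
      Complex.I)).mul_const ((2 : ℂ)⁻¹)).fderiv
    simp only [delE, div_eq_mul_inv]
    refine (DFunLike.congr_fun this b).trans ?_
    simp only [_root_.smul_apply, _root_.sub_apply, smul_eq_mul, hsnd]
    ring
  have h2 : ∀ b, fderiv ℝ (fun x => dbarE H x w) u b = (fderiv ℝ (fderiv ℝ H) u b w +
      Complex.I * fderiv ℝ (fderiv ℝ H) u b (Complex.I • w)) / 2 := by
    intro b
    have := (((happ w).hasFDerivAt.add ((happ (Complex.I • w)).hasFDerivAt.const_mul
      Complex.I)).mul_const ((2 : ℂ)⁻¹)).fderiv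
    simp only [dbarE, div_eq_mul_inv]
    refine (DFunLike.congr_fun this b).trans ?_
    simp only [_root_.smul_apply, _root_.add_apply, smul_eq_mul, hsnd]
    ring
  rw [dbarE, h1, h1, delE, h2, h2, hsymm.eq w v, hsymm.eq w (Complex.I • v),
    hsymm.eq (Complex.I • w) v, hsymm.eq (Complex.I • w) (Complex.I • v)]
  ring

/-- The curvature coefficients `R_{i j̄} = -∂_{j̄} θ_i` form a Hermitian matrix. -/
theorem conj_dbarE_connE {H : Cn d → ℂ} (hH : ContDiffAt ℝ 2 H u) (h0 : H u ≠ 0)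
    (hreal : ∀ᶠ x in 𝓝 u, conj (H x) = H x) (i j : Fin d) :
    conj (dbarE (connE H i) u (stdVec j)) = dbarE (connE H j) u (stdVec i) := by
  have hd1 : DifferentiableAt ℝ H u := hH.differentiableAt two_ne_zero
  have hdel : ∀ v, DifferentiableAt ℝ (fun x => delE H x v) u := fun v =>
    (contDiffAt_delE (n := 1) (by simpa [one_add_one_eq_two] using hH) v).differentiableAt (by simp)
  have hdbar : ∀ v, DifferentiableAt ℝ (fun x => dbarE H x v) u := fun v =>
    (contDiffAt_dbarE (n := 1) (by simpa [one_add_one_eq_two] using hH) v).differentiableAt (by simp)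
  have hu := hreal.self_of_nhds
  have hconj : ∀ v, (fun x => conj (delE H x v)) =ᶠ[𝓝 u] fun x => dbarE H x v := by
    intro v
    have hev : ∀ᶠ x in 𝓝 u, ContDiffAt ℝ 2 H x := hH.eventually (by simp)
    filter_upwards [hreal.eventually_nhds, hev] with x hx hx'
    rw [conj_delE (hx'.differentiableAt two_ne_zero), dbarE_congr hx]
  have key : ∀ i j, dbarE (connE H i) u (stdVec j) = -dbarE H u (stdVec j) / H u ^ 2 *
      delE H u (stdVec i) + (H u)⁻¹ * dbarE (fun x => delE H x (stdVec i)) u (stdVec j) := by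
    intro i j
    change dbarE (fun x => (H x)⁻¹ * delE H x (stdVec i)) u (stdVec j) = _
    rw [dbarE_mul (F := fun x => (H x)⁻¹) (hd1.inv h0) (hdel _), dbarE_inv hd1 h0]
  have hc1 : ∀ v, conj (dbarE H u v) = delE H u v := fun v => by
    rw [conj_dbarE hd1, delE_congr hreal]
  have hc2 : ∀ v, conj (delE H u v) = dbarE H u v := fun v => by
    rw [conj_delE hd1, dbarE_congr hreal]
  have hc3 : ∀ v w, conj (dbarE (fun x => delE H x v) u w) = dbarE (fun x => delE H x w) u v := by
    intro v w
    rw [conj_dbarE (hdel v), delE_congr (hconj v), dbarE_delE_comm hH]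
  rw [key, key]
  simp only [map_add, map_mul, map_div₀, map_neg, map_pow, map_inv₀, hu, hc1, hc2, hc3]
  ring

/-- The change of `-∂_{j̄} θ_i` under a change `f` of the holomorphic frame of the line bundle and
under a holomorphic change of the direction `∂_i` to `t`: the new term `f⁻¹ ∂f` is holomorphic. -/
theorem dbarE_conn_transform {H f : Cn d → ℂ} {t : Cn d → Cn d} (hH : ContDiffAt ℝ 2 H u)
    (h0 : H u ≠ 0) (hf : ContDiffAt ℂ 2 f u) (hf0 : f u ≠ 0) (ht : DifferentiableAt ℂ t u) :
    DifferentiableAt ℝ (fun x => (f x * conj (f x) * H x)⁻¹ *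
        delE (fun x => f x * conj (f x) * H x) x (t x)) u ∧
      ∀ w, dbarE (fun x => (f x * conj (f x) * H x)⁻¹ *
        delE (fun x => f x * conj (f x) * H x) x (t x)) u w =
        ∑ k, ∑ l, t u k * conj (w l) * dbarE (connE H k) u (stdVec l) := by
  have hev : ∀ᶠ x in 𝓝 u, ContDiffAt ℝ 2 H x := hH.eventually (by simp)
  have hev' : ∀ᶠ x in 𝓝 u, ContDiffAt ℂ 2 f x := hf.eventually (by simp)
  have heq : (fun x => (f x * conj (f x) * H x)⁻¹ *
        delE (fun x => f x * conj (f x) * H x) x (t x)) =ᶠ[𝓝 u]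
      fun x => (f x)⁻¹ * fderiv ℂ f x (t x) + ∑ k, t x k * connE H k x := by
    filter_upwards [hev, hev', hH.continuousAt.eventually_ne h0,
      hf.continuousAt.eventually_ne hf0] with x hHx hfx hH0 hf0
    have hd1 : DifferentiableAt ℝ H x := hHx.differentiableAt two_ne_zero
    have hd2 : DifferentiableAt ℂ f x := hfx.differentiableAt two_ne_zero
    have hd3 : DifferentiableAt ℝ f x := hd2.restrictScalars ℝ
    have hd4 : delE (fun x => conj (f x)) x (t x) = 0 := by
      rw [← conj_dbarE hd3, dbarE_of_holomorphic hd2, map_zero]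
    have hcf : conj (f x) ≠ 0 := (map_ne_zero _).mpr hf0
    rw [delE_mul (F := fun x => f x * conj (f x)) (hd3.mul hd3.conj') hd1, delE_mul hd3 hd3.conj',
      hd4, delE_of_holomorphic hd2]
    have hs : ∑ k, t x k * connE H k x = (H x)⁻¹ * delE H x (t x) := by
      rw [delE_vec_sum (w := t x), Finset.mul_sum]
      exact Finset.sum_congr rfl fun k _ => by rw [connE]; ring
    rw [hs]
    field_simp
    ring
  have hfd : DifferentiableAt ℂ (fun x => (f x)⁻¹ * fderiv ℂ f x (t x)) u := by
    have h1 : DifferentiableAt ℂ (fderiv ℂ f) u :=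
      (hf.fderiv_right (m := 1) (by norm_num)).differentiableAt one_ne_zero
    exact ((hf.differentiableAt two_ne_zero).inv hf0).mul (h1.clm_apply ht)
  have htk : ∀ k, DifferentiableAt ℂ (fun x => t x k) u := fun k =>
    (EuclideanSpace.proj k : Cn d →L[ℂ] ℂ).differentiableAt.comp u ht
  have hck : ∀ k, DifferentiableAt ℝ (connE H k) u := fun k =>
    (contDiffAt_connE (n := 1) (by simpa [one_add_one_eq_two] using hH) h0 k).differentiableAt
      (by simp)
  have hk : ∀ k, DifferentiableAt ℝ (fun x => t x k * connE H k x) u := fun k =>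
    ((htk k).restrictScalars ℝ).mul (hck k)
  refine ⟨((hfd.restrictScalars ℝ).add
    (DifferentiableAt.fun_sum fun k _ => hk k)).congr_of_eventuallyEq heq, fun w => ?_⟩
  rw [dbarE_congr heq, dbarE_add (hfd.restrictScalars ℝ) (DifferentiableAt.fun_sum fun k _ => hk k),
    dbarE_of_holomorphic hfd, zero_add, dbarE_sum _ fun k _ => hk k]
  refine Finset.sum_congr rfl fun k _ => ?_
  rw [dbarE_mul ((htk k).restrictScalars ℝ) (hck k), dbarE_of_holomorphic (htk k), zero_mul,
    zero_add, dbarE_eq_sum, Finset.mul_sum]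
  exact Finset.sum_congr rfl fun l _ => by ring

end ModelCalculus

/-! ### Holomorphic charts -/

section Charts

open Filter Topology

variable {d : ℕ} {M : Type*} [TopologicalSpace M] [ChartedSpace (Cn d) M]

/-- The isomorphism `ℂ^d → T^{1,0}_y M` given by the chart `c`, in the identification of `T_y M`
with the model space. -/
def chartVec (c : OpenPartialHomeomorph M (Cn d)) (y : M) : Cn d →L[ℂ] Cn d :=
  mfderiv 𝓘(ℂ, Cn d) 𝓘(ℂ, Cn d) c.symm (c y)

/-- The components of a tangent vector at `y` in the chart `c`. -/
def chartComp (c : OpenPartialHomeomorph M (Cn d)) (y : M) : Cn d →L[ℂ] Cn d :=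
  mfderiv 𝓘(ℂ, Cn d) 𝓘(ℂ, Cn d) c y

theorem mdifferentiable_of_mem_maximalAtlas {c : OpenPartialHomeomorph M (Cn d)}
    (hc : c ∈ IsManifold.maximalAtlas 𝓘(ℂ, Cn d) ω M) :
    c.MDifferentiable 𝓘(ℂ, Cn d) 𝓘(ℂ, Cn d) :=
  ⟨(contMDiffOn_of_mem_maximalAtlas hc).mdifferentiableOn (by simp),
    (contMDiffOn_symm_of_mem_maximalAtlas hc).mdifferentiableOn (by simp)⟩

variable {c c' : OpenPartialHomeomorph M (Cn d)} {y : M}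

theorem contDiffAt_transition (hc : c ∈ IsManifold.maximalAtlas 𝓘(ℂ, Cn d) ω M)
    (hc' : c' ∈ IsManifold.maximalAtlas 𝓘(ℂ, Cn d) ω M) (hy : y ∈ c.source) (hy' : y ∈ c'.source) :
    ContDiffAt ℂ ω (c' ∘ c.symm) (c y) := by
  rw [← contMDiffAt_iff_contDiffAt]
  refine ContMDiffAt.comp (I' := 𝓘(ℂ, Cn d)) (c y) ?_
    (contMDiffAt_symm_of_mem_maximalAtlas hc (c.map_source hy))
  rw [c.left_inv hy]
  exact contMDiffAt_of_mem_maximalAtlas hc' hy'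

theorem chartComp_chartVec (hc : c ∈ IsManifold.maximalAtlas 𝓘(ℂ, Cn d) ω M) (hy : y ∈ c.source)
    (v : Cn d) : chartComp c y (chartVec c y v) = v := by
  have h := (mdifferentiable_of_mem_maximalAtlas hc).comp_symm_deriv (c.map_source hy)
  rw [c.left_inv hy] at h
  exact DFunLike.congr_fun h v

theorem chartVec_chartComp (hc : c ∈ IsManifold.maximalAtlas 𝓘(ℂ, Cn d) ω M) (hy : y ∈ c.source)
    (v : Cn d) : chartVec c y (chartComp c y v) = v :=
  DFunLike.congr_fun ((mdifferentiable_of_mem_maximalAtlas hc).symm_comp_deriv hy) v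

theorem chartComp_chartVec_eq_fderiv (hc : c ∈ IsManifold.maximalAtlas 𝓘(ℂ, Cn d) ω M)
    (hc' : c' ∈ IsManifold.maximalAtlas 𝓘(ℂ, Cn d) ω M) (hy : y ∈ c.source) (hy' : y ∈ c'.source)
    (v : Cn d) : chartComp c' y (chartVec c y v) = fderiv ℂ (c' ∘ c.symm) (c y) v := by
  have h1 := (mdifferentiable_of_mem_maximalAtlas hc).mdifferentiableAt_symm (c.map_source hy)
  have h2 := (mdifferentiable_of_mem_maximalAtlas hc').mdifferentiableAt hy'
  have h3 : MDifferentiableAt 𝓘(ℂ, Cn d) 𝓘(ℂ, Cn d) c' (c.symm (c y)) := by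
    rw [c.left_inv hy]; exact h2
  have h4 := mfderiv_comp (c y) h3 h1
  rw [mfderiv_eq_fderiv, c.left_inv hy] at h4
  exact (DFunLike.congr_fun h4 v).symm

theorem hasMFDerivAt_real_symm (hc : c ∈ IsManifold.maximalAtlas 𝓘(ℂ, Cn d) ω M)
    (hy : y ∈ c.source) :
    HasMFDerivAt 𝓘(ℝ, Cn d) 𝓘(ℝ, Cn d) c.symm (c y) ((chartVec c y).restrictScalars ℝ) := by
  have h := ((mdifferentiable_of_mem_maximalAtlas hc).mdifferentiableAt_symm
    (c.map_source hy)).hasMFDerivAt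
  exact ⟨h.1, h.2.restrictScalars ℝ⟩

theorem hasMFDerivAt_real (hc : c ∈ IsManifold.maximalAtlas 𝓘(ℂ, Cn d) ω M)
    (hy : y ∈ c.source) :
    HasMFDerivAt 𝓘(ℝ, Cn d) 𝓘(ℝ, Cn d) c y ((chartComp c y).restrictScalars ℝ) := by
  have h := ((mdifferentiable_of_mem_maximalAtlas hc).mdifferentiableAt hy).hasMFDerivAt
  exact ⟨h.1, h.2.restrictScalars ℝ⟩

theorem mdifferentiableAt_iff_chart (hc : c ∈ IsManifold.maximalAtlas 𝓘(ℂ, Cn d) ω M)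
    (hy : y ∈ c.source) (f : M → ℂ) :
    MDifferentiableAt 𝓘(ℝ, Cn d) 𝓘(ℝ, ℂ) f y ↔ DifferentiableAt ℝ (f ∘ c.symm) (c y) := by
  rw [← mdifferentiableAt_iff_differentiableAt]
  constructor
  · intro h
    refine MDifferentiableAt.comp (I' := 𝓘(ℝ, Cn d)) (c y) ?_
      (hasMFDerivAt_real_symm hc hy).mdifferentiableAt
    rwa [c.left_inv hy]
  · intro h
    have h1 := MDifferentiableAt.comp (I' := 𝓘(ℝ, Cn d)) y h
      (hasMFDerivAt_real hc hy).mdifferentiableAt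
    refine h1.congr_of_eventuallyEq ?_
    filter_upwards [c.open_source.mem_nhds hy] with x hx
    simp [c.left_inv hx]

theorem mfderiv_chartVec (hc : c ∈ IsManifold.maximalAtlas 𝓘(ℂ, Cn d) ω M)
    (hy : y ∈ c.source) (f : M → ℂ) (v : Cn d) :
    (mfderiv 𝓘(ℝ, Cn d) 𝓘(ℝ, ℂ) f y : Cn d → ℂ) (chartVec c y v) =
      fderiv ℝ (f ∘ c.symm) (c y) v := by
  by_cases hf : MDifferentiableAt 𝓘(ℝ, Cn d) 𝓘(ℝ, ℂ) f y
  · have h1 : HasMFDerivAt 𝓘(ℝ, Cn d) 𝓘(ℝ, ℂ) f (c.symm (c y))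
        (mfderiv 𝓘(ℝ, Cn d) 𝓘(ℝ, ℂ) f y) := by
      rw [c.left_inv hy]; exact hf.hasMFDerivAt
    let D : Cn d →L[ℝ] ℂ := mfderiv 𝓘(ℝ, Cn d) 𝓘(ℝ, ℂ) f y
    have h2 : HasFDerivAt (f ∘ c.symm) (D.comp ((chartVec c y).restrictScalars ℝ)) (c y) :=
      (h1.comp (c y) (hasMFDerivAt_real_symm hc hy)).hasFDerivAt
    rw [h2.fderiv]
    rfl
  · have hf' := hf
    rw [mdifferentiableAt_iff_chart hc hy] at hf'
    rw [fderiv_zero_of_not_differentiableAt hf', mfderiv_zero_of_not_mdifferentiableAt hf]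
    rfl

theorem dbar_chartVec (hc : c ∈ IsManifold.maximalAtlas 𝓘(ℂ, Cn d) ω M)
    (hy : y ∈ c.source) (f : M → ℂ) (v : Cn d) :
    dbar f y (chartVec c y v) = dbarE (f ∘ c.symm) (c y) v := by
  rw [dbarE, ← mfderiv_chartVec hc hy, ← mfderiv_chartVec hc hy, map_smul]
  rfl

theorem del_chartVec (hc : c ∈ IsManifold.maximalAtlas 𝓘(ℂ, Cn d) ω M)
    (hy : y ∈ c.source) (f : M → ℂ) (v : Cn d) :
    del f y (chartVec c y v) = delE (f ∘ c.symm) (c y) v := by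
  rw [delE, ← mfderiv_chartVec hc hy, ← mfderiv_chartVec hc hy, map_smul]
  rfl

end Charts

/-! ### The curvature in a fixed chart and a fixed holomorphic frame -/

section LocalCurvature

open Filter Topology

variable {d : ℕ} {M : Type*} [TopologicalSpace M] [ChartedSpace (Cn d) M]
  {L : M → Type*} [∀ x, AddCommGroup (L x)] [∀ x, Module ℂ (L x)]
  [TopologicalSpace (Bundle.TotalSpace ℂ L)] [∀ x, TopologicalSpace (L x)] [FiberBundle ℂ L]

/-- A function that is smooth on a neighbourhood of `z` is smooth in the preferred chart at `z`. -/
theorem contDiffAt_of_contMDiffOn {f : M → ℂ} {s : Set M} (hs : IsOpen s) {z : M} (hz : z ∈ s)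
    (hf : ContMDiffOn 𝓘(ℝ, Cn d) 𝓘(ℝ, ℂ) ∞ f s) :
    ContDiffAt ℝ ∞ (f ∘ (chartAt (Cn d) z).symm) (chartAt (Cn d) z z) := by
  have h := contMDiffAt_iff.mp (hf.contMDiffAt (hs.mem_nhds hz))
  have h2 := h.2
  simp only [mfld_simps] at h2
  exact contDiffWithinAt_univ.mp h2

theorem frameNormSq_ne_zero [VectorBundle ℂ ℂ L] (h : HermitianMetric d ℂ L)
    (e : Bundle.Trivialization ℂ (Bundle.TotalSpace.proj : Bundle.TotalSpace ℂ L → M))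
    [MemTrivializationAtlas e] {y : M} (hy : y ∈ e.baseSet) : frameNormSq h e y ≠ 0 := by
  have hne : e.symm y (1 : ℂ) ≠ 0 := by
    intro h0
    have h1 := e.apply_mk_symm hy (1 : ℂ)
    have h2 := e.apply_mk_symm hy (0 : ℂ)
    have h3 : e.symm y (0 : ℂ) = 0 := by
      rw [← e.symmₗ_apply (R := ℂ) hy, map_zero]
    rw [h0] at h1
    rw [h3, h1] at h2
    simp at h2
  intro h0
  have := h.pos y _ hne
  rw [frameNormSq] at h0
  rw [h0] at this
  simp at this

theorem conj_frameNormSq (h : HermitianMetric d ℂ L)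
    (e : Bundle.Trivialization ℂ (Bundle.TotalSpace.proj : Bundle.TotalSpace ℂ L → M)) (y : M) :
    conj (frameNormSq h e y) = frameNormSq h e y := h.conj_symm _ _ _

/-- A change of the holomorphic frame of `L` by the factor `f` changes `|s|²` by `f f̄`. -/
theorem frameNormSq_change [VectorBundle ℂ ℂ L] (h : HermitianMetric d ℂ L)
    (e e' : Bundle.Trivialization ℂ (Bundle.TotalSpace.proj : Bundle.TotalSpace ℂ L → M))
    [MemTrivializationAtlas e] [MemTrivializationAtlas e'] {y : M} (hy : y ∈ e.baseSet)
    (hy' : y ∈ e'.baseSet) :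
    frameNormSq h e' y = e'.coordChangeL ℂ e y 1 * conj (e'.coordChangeL ℂ e y 1) *
      frameNormSq h e y := by
  have h1 : e'.symm y (1 : ℂ) = e'.coordChangeL ℂ e y 1 • e.symm y (1 : ℂ) := by
    rw [e'.coordChangeL_apply e ⟨hy', hy⟩]
    have h2 := (e.symmₗ ℂ y).map_smul ((e ⟨y, e'.symm y (1 : ℂ)⟩).2) (1 : ℂ)
    simp only [smul_eq_mul, mul_one, e.symmₗ_apply hy] at h2
    refine Eq.trans ?_ h2
    exact (e.symm_apply_apply_mk hy _).symm
  rw [frameNormSq, h1]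
  simp only [map_smul, map_smulₛₗ, LinearMap.smul_apply, smul_eq_mul, frameNormSq]
  ring

variable (h : HermitianMetric d ℂ L)

/-- `|s|²` in the preferred chart and the preferred holomorphic frame at `z`. -/
def localNormSq (z : M) : Cn d → ℂ :=
  frameNormSq h (trivializationAt ℂ L z) ∘ (chartAt (Cn d) z).symm

theorem contDiffAt_localNormSq (z : M) :
    ContDiffAt ℝ ∞ (localNormSq h z) (chartAt (Cn d) z z) :=
  contDiffAt_of_contMDiffOn (trivializationAt ℂ L z).open_baseSet
    (mem_baseSet_trivializationAt ℂ L z) (h.smooth (trivializationAt ℂ L z) 1 1)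

theorem localNormSq_ne_zero [VectorBundle ℂ ℂ L] {z y : M} (hy : y ∈ (chartAt (Cn d) z).source)
    (hy' : y ∈ (trivializationAt ℂ L z).baseSet) : localNormSq h z (chartAt (Cn d) z y) ≠ 0 := by
  rw [localNormSq, Function.comp_apply, (chartAt (Cn d) z).left_inv hy]
  exact frameNormSq_ne_zero h _ hy'

variable [IsManifold 𝓘(ℂ, Cn d) ω M] [VectorBundle ℂ ℂ L]
  [ContMDiffVectorBundle ω ℂ L 𝓘(ℂ, Cn d)]

/-- The curvature does not depend on the chart and the holomorphic frame in which it is computed. -/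
theorem chernCurvature_chartVec {z y : M} (hy : y ∈ (chartAt (Cn d) z).source)
    (hy' : y ∈ (trivializationAt ℂ L z).baseSet)
    (hsmooth : ContDiffAt ℝ 2 (localNormSq h z) (chartAt (Cn d) z y)) (v w : Cn d) :
    chernCurvature h y (chartVec (chartAt (Cn d) z) y v) (chartVec (chartAt (Cn d) z) y w) =
      ∑ k, ∑ l, v k * conj (w l) *
        -dbarE (connE (localNormSq h z) k) (chartAt (Cn d) z y) (stdVec l) := by
  set c₀ := chartAt (Cn d) z with hc₀
  set c := chartAt (Cn d) y with hc
  set e₀ := trivializationAt ℂ L z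
  set e := trivializationAt ℂ L y
  have hmax₀ : c₀ ∈ IsManifold.maximalAtlas 𝓘(ℂ, Cn d) ω M :=
    IsManifold.chart_mem_maximalAtlas z
  have hmax : c ∈ IsManifold.maximalAtlas 𝓘(ℂ, Cn d) ω M :=
    IsManifold.chart_mem_maximalAtlas y
  have hyc : y ∈ c.source := mem_chart_source _ y
  have hye : y ∈ e.baseSet := mem_baseSet_trivializationAt ℂ L y
  set f : Cn d → ℂ := (fun x => (e.coordChangeL ℂ e₀ x : ℂ →L[ℂ] ℂ) 1) ∘ c₀.symm with hf
  set t : Fin d → Cn d → Cn d := fun i u => fderiv ℂ (c₀ ∘ c.symm) (c (c₀.symm u)) (stdVec i)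
    with ht
  have hfsm : ContDiffAt ℂ 2 f (c₀ y) := by
    rw [← contMDiffAt_iff_contDiffAt]
    refine ContMDiffAt.comp (I' := 𝓘(ℂ, Cn d)) (c₀ y) ?_
      ((contMDiffAt_symm_of_mem_maximalAtlas hmax₀ (c₀.map_source hy)).of_le (by simp))
    rw [c₀.left_inv hy]
    have h1 := (contMDiffAt_coordChangeL (n := ω) (IB := 𝓘(ℂ, Cn d)) (F := ℂ) (E := L) hye hy')
    exact (h1.of_le (by simp)).clm_apply contMDiffAt_const
  have htsm : ∀ i, DifferentiableAt ℂ (t i) (c₀ y) := by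
    intro i
    have h1 := contDiffAt_transition hmax hmax₀ hyc hy
    have h2 := contDiffAt_transition hmax₀ hmax hy hyc
    have h3 : DifferentiableAt ℂ (fderiv ℂ (c₀ ∘ c.symm)) ((c ∘ c₀.symm) (c₀ y)) := by
      have : (c ∘ c₀.symm) (c₀ y) = c y := by simp [c₀.left_inv hy]
      rw [this]
      exact (h1.fderiv_right (m := 1) (by simp)).differentiableAt one_ne_zero
    exact (h3.comp (c₀ y) (h2.differentiableAt (by simp))).clm_apply (differentiableAt_const _)
  have hnear : ∀ᶠ u in 𝓝 (c₀ y), u ∈ c₀.target ∧ c₀.symm u ∈ c.source ∧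
      c₀.symm u ∈ e.baseSet ∧ c₀.symm u ∈ e₀.baseSet := by
    have hcont : ContinuousAt c₀.symm (c₀ y) := c₀.continuousAt_symm (c₀.map_source hy)
    have hto : ∀ s : Set M, IsOpen s → y ∈ s → ∀ᶠ u in 𝓝 (c₀ y), c₀.symm u ∈ s := fun s hs hys =>
      hcont.eventually_mem (by rw [c₀.left_inv hy]; exact hs.mem_nhds hys)
    have htgt : ∀ᶠ u in 𝓝 (c₀ y), u ∈ c₀.target := c₀.open_target.mem_nhds (c₀.map_source hy)
    exact htgt.and ((hto _ c.open_source hyc).and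
      ((hto _ e.open_baseSet hye).and (hto _ e₀.open_baseSet hy')))
  have hH0 : localNormSq h z (c₀ y) ≠ 0 := by
    change frameNormSq h e₀ (c₀.symm (c₀ y)) ≠ 0
    rw [c₀.left_inv hy]
    exact frameNormSq_ne_zero h e₀ hy'
  have hf0 : f (c₀ y) ≠ 0 := by
    intro h0
    have h1 := frameNormSq_change h e₀ e hy' hye
    have h2 : e.coordChangeL ℂ e₀ y 1 = 0 := by
      have : f (c₀ y) = e.coordChangeL ℂ e₀ y 1 := by
        simp only [hf, Function.comp_apply, c₀.left_inv hy]
        rfl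
      rw [← this, h0]
    rw [h2] at h1
    exact frameNormSq_ne_zero h e hye (by rw [h1]; simp)
  have hnorm : ∀ᶠ u in 𝓝 (c₀ y), (frameNormSq h e ∘ c₀.symm) u =
      f u * conj (f u) * localNormSq h z u := by
    filter_upwards [hnear] with u hu
    exact frameNormSq_change h e₀ e hu.2.2.2 hu.2.2.1
  have hconn : ∀ i, chernConnectionCoeff h c e i ∘ c₀.symm =ᶠ[𝓝 (c₀ y)]
      fun u => (f u * conj (f u) * localNormSq h z u)⁻¹ *
        delE (fun u => f u * conj (f u) * localNormSq h z u) u (t i u) := by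
    intro i
    filter_upwards [hnear, hnorm.eventually_nhds] with u hu hu'
    have hsrc : c₀.symm u ∈ c₀.source := c₀.map_target hu.1
    have hvec : coordVec c (c₀.symm u) i = chartVec c₀ (c₀.symm u) (t i u) := by
      rw [ht]
      simp only
      rw [← chartComp_chartVec_eq_fderiv hmax hmax₀ hu.2.1 hsrc, chartVec_chartComp hmax₀ hsrc]
      rfl
    have hdel : del (frameNormSq h e) (c₀.symm u) (coordVec c (c₀.symm u) i) =
        delE (frameNormSq h e ∘ c₀.symm) u (t i u) := by
      rw [hvec, del_chartVec hmax₀ hsrc, c₀.right_inv hu.1]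
    change (frameNormSq h e (c₀.symm u))⁻¹ * del (frameNormSq h e) (c₀.symm u) _ = _
    rw [hdel, delE_congr hu', ← hu'.self_of_nhds]
    rfl
  have hdbar : ∀ i j, dbar (chernConnectionCoeff h c e i) y (coordVec c y j) =
      ∑ k, ∑ l, t i (c₀ y) k * conj (t j (c₀ y) l : ℂ) *
        dbarE (connE (localNormSq h z) k) (c₀ y) (stdVec l) := by
    intro i j
    have hvec : coordVec c y j = chartVec c₀ y (t j (c₀ y)) := by
      rw [ht]
      simp only [c₀.left_inv hy]
      rw [← chartComp_chartVec_eq_fderiv hmax hmax₀ hyc hy, chartVec_chartComp hmax₀ hy]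
      rfl
    rw [hvec, dbar_chartVec hmax₀ hy, dbarE_congr (hconn i)]
    exact (dbarE_conn_transform hsmooth hH0 hfsm hf0 (htsm i)).2 _
  -- the components of `v` in the chart `c` recombine to `v`
  have hcomp : ∀ (v : Cn d) k, ∑ i, (chartComp c y (chartVec c₀ y v)) i * t i (c₀ y) k = v k := by
    intro v k
    have h1 : ∑ i, (chartComp c y (chartVec c₀ y v)) i • t i (c₀ y) = v := by
      have h2 : ∀ i, t i (c₀ y) = chartComp c₀ y (chartVec c y (stdVec i)) := fun i => by
        rw [ht]
        simp only [c₀.left_inv hy]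
        rw [← chartComp_chartVec_eq_fderiv hmax hmax₀ hyc hy]
      simp only [h2, ← map_smul, ← map_sum]
      rw [sum_smul_stdVec, chartVec_chartComp hmax hyc, chartComp_chartVec hmax₀ hy]
    conv_rhs => rw [← h1]
    simp
  have hform : ∀ (v : Cn d) i, coordForm c y i v = (chartComp c y v) i := fun _ _ => rfl
  have hsesq : ∀ v w, chernCurvature h y v w = ∑ i, ∑ j,
      -dbar (chernConnectionCoeff h c e i) y (coordVec c y j) *
        (coordForm c y i v * conj (coordForm c y j w)) := fun v w => by
    simp only [chernCurvature, LinearMap.sum_apply, LinearMap.smul_apply, smul_eq_mul]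
    rfl
  refine (hsesq _ _).trans ?_
  set a : Fin d → ℂ := fun i => (chartComp c y (chartVec c₀ y v)) i with ha
  set b : Fin d → ℂ := fun i => (chartComp c y (chartVec c₀ y w)) i with hb
  calc _ = ∑ i, ∑ j, -(∑ k, ∑ l, t i (c₀ y) k * conj (t j (c₀ y) l : ℂ) *
        dbarE (connE (localNormSq h z) k) (c₀ y) (stdVec l)) * (a i * conj (b j)) := by
        refine Finset.sum_congr rfl fun i _ => Finset.sum_congr rfl fun j _ => ?_
        rw [← hdbar]
        rfl
    _ = ∑ k, ∑ l, ∑ i, ∑ j, -(t i (c₀ y) k * conj (t j (c₀ y) l : ℂ) *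
        dbarE (connE (localNormSq h z) k) (c₀ y) (stdVec l)) * (a i * conj (b j)) := by
        simp only [← Finset.sum_neg_distrib, Finset.sum_mul]
        calc _ = ∑ i, ∑ k, ∑ j, ∑ l, -(t i (c₀ y) k * conj (t j (c₀ y) l : ℂ) *
              dbarE (connE (localNormSq h z) k) (c₀ y) (stdVec l)) * (a i * conj (b j)) :=
              Finset.sum_congr rfl fun i _ => Finset.sum_comm
          _ = ∑ k, ∑ i, ∑ l, ∑ j, -(t i (c₀ y) k * conj (t j (c₀ y) l : ℂ) *
              dbarE (connE (localNormSq h z) k) (c₀ y) (stdVec l)) * (a i * conj (b j)) := by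
              rw [Finset.sum_comm]
              exact Finset.sum_congr rfl fun k _ => Finset.sum_congr rfl fun i _ =>
                Finset.sum_comm
          _ = _ := Finset.sum_congr rfl fun k _ => Finset.sum_comm
    _ = _ := by
        refine Finset.sum_congr rfl fun k _ => Finset.sum_congr rfl fun l _ => ?_
        rw [← hcomp v k, ← hcomp w l, map_sum, Finset.sum_mul_sum, Finset.sum_mul]
        refine Finset.sum_congr rfl fun i _ => ?_
        rw [Finset.sum_mul]
        refine Finset.sum_congr rfl fun j _ => ?_
        rw [map_mul]
        ring

end LocalCurvature

/-! ### Regularity of the curvature and of the metric in a holomorphic frame -/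

section Transport

open Filter Topology

variable {d : ℕ} {M : Type*} [TopologicalSpace M]

theorem eventually_symm_mem {X : Type*} [TopologicalSpace X] {c : OpenPartialHomeomorph M X} {z : M} (hz : z ∈ c.source)
    {s : Set M} (hs : IsOpen s) (hzs : z ∈ s) :
    ∀ᶠ u in 𝓝 (c z), u ∈ c.target ∧ c.symm u ∈ s := by
  have htgt : ∀ᶠ u in 𝓝 (c z), u ∈ c.target := c.open_target.mem_nhds (c.map_source hz)
  refine htgt.and ((c.continuousAt_symm (c.map_source hz)).eventually_mem ?_)
  rw [c.left_inv hz]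
  exact hs.mem_nhds hzs

variable [ChartedSpace (Cn d) M]

theorem chartTransport_comp {c : OpenPartialHomeomorph M (Cn d)}
    (hc : c ∈ IsManifold.maximalAtlas 𝓘(ℂ, Cn d) ω M) {x y : M} (hx : x ∈ c.source)
    (hy : y ∈ c.source) : chartTransport c y x ∘ₗ chartTransport c x y = LinearMap.id := by
  ext v
  change chartVec c x (chartComp c y (chartVec c y (chartComp c x v))) = v
  rw [chartComp_chartVec hc hy]
  exact chartVec_chartComp hc hx v

theorem dbar_eq_dbarE {c : OpenPartialHomeomorph M (Cn d)}
    (hc : c ∈ IsManifold.maximalAtlas 𝓘(ℂ, Cn d) ω M) {z : M} (hz : z ∈ c.source) (f : M → ℂ)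
    (v : HolTangent d z) : dbar f z v = dbarE (f ∘ c.symm) (c z) (chartComp c z v) := by
  rw [← dbar_chartVec hc hz]
  exact congrArg (dbar f z) (chartVec_chartComp hc hz v).symm

variable [IsManifold 𝓘(ℂ, Cn d) ω M]

theorem differentiableAt_metric_transport
    (g : HermitianMetric d (Cn d) (HolTangent d : M → Type)) (z : M) (v w : HolTangent d z) :
    DifferentiableAt ℝ (fun u => g.form ((chartAt (Cn d) z).symm u)
      (chartTransport (chartAt (Cn d) z) z ((chartAt (Cn d) z).symm u) v)
      (chartTransport (chartAt (Cn d) z) z ((chartAt (Cn d) z).symm u) w))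
      (chartAt (Cn d) z z) := by
  set c := chartAt (Cn d) z
  have hz : z ∈ c.source := mem_chart_source _ z
  let e := trivializationAt (Cn d) (HolTangent d : M → Type) z
  have hbase : e.baseSet = c.source := TangentBundle.trivializationAt_baseSet z
  have h1 := contDiffAt_of_contMDiffOn e.open_baseSet (hbase ▸ hz)
    (g.smooth e (chartComp c z v) (chartComp c z w))
  refine (h1.differentiableAt (by simp)).congr_of_eventuallyEq ?_
  filter_upwards [eventually_symm_mem hz c.open_source hz] with u hu
  have h2 : ∀ v : Cn d, e.symm (c.symm u) v = chartVec c (c.symm u) v := by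
    intro v
    have h3 := TangentBundle.symmL_trivializationAt (𝕜 := ℂ) (I := 𝓘(ℂ, Cn d)) (x₀ := z) hu.2
    have h4 : (e.symmL ℂ (c.symm u) : Cn d →L[ℂ] Cn d) =
        mfderivWithin 𝓘(ℂ, Cn d) 𝓘(ℂ, Cn d) c.symm (Set.range 𝓘(ℂ, Cn d)) (c (c.symm u)) := h3
    rw [ModelWithCorners.range_eq_univ, mfderivWithin_univ] at h4
    have h5 : e.symmL ℂ (c.symm u) v = e.symm (c.symm u) v :=
      e.symmₗ_apply (R := ℂ) (hbase ▸ hu.2) v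
    rw [← h5]
    exact DFunLike.congr_fun h4 v
  change _ = g.form (c.symm u) (e.symm (c.symm u) (chartComp c z v))
    (e.symm (c.symm u) (chartComp c z w))
  rw [h2, h2]
  rfl

variable {L : M → Type*} [∀ x, AddCommGroup (L x)] [∀ x, Module ℂ (L x)]
  [TopologicalSpace (Bundle.TotalSpace ℂ L)] [∀ x, TopologicalSpace (L x)] [FiberBundle ℂ L]
  [VectorBundle ℂ ℂ L] [ContMDiffVectorBundle ω ℂ L 𝓘(ℂ, Cn d)] (h : HermitianMetric d ℂ L)

/-- The Chern curvature `R_{i j̄}` is Hermitian. -/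
theorem conj_chernCurvature (x : M) (v w : HolTangent d x) :
    conj (chernCurvature h x v w) = chernCurvature h x w v := by
  set c := chartAt (Cn d) x
  have hx : x ∈ c.source := mem_chart_source _ x
  have hx' := mem_baseSet_trivializationAt ℂ L x
  have hc : c ∈ IsManifold.maximalAtlas 𝓘(ℂ, Cn d) ω M := IsManifold.chart_mem_maximalAtlas x
  have hH : ContDiffAt ℝ 2 (localNormSq h x) (c x) :=
    mod_cast contDiffAt_infty.mp (contDiffAt_localNormSq h x) 2
  have hform := chernCurvature_chartVec h hx hx' hH
  have hv : chartVec c x (chartComp c x v) = v := chartVec_chartComp hc hx v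
  have hw : chartVec c x (chartComp c x w) = w := chartVec_chartComp hc hx w
  have h1 := hform (chartComp c x v) (chartComp c x w)
  have h2 := hform (chartComp c x w) (chartComp c x v)
  rw [hv, hw] at h1 h2
  rw [h1, h2, Finset.sum_comm, map_sum]
  refine Finset.sum_congr rfl fun l _ => ?_
  rw [map_sum]
  refine Finset.sum_congr rfl fun k _ => ?_
  rw [map_mul, map_mul, map_neg, Complex.conj_conj, conj_dbarE_connE hH
    (localNormSq_ne_zero h hx hx') (Eventually.of_forall fun u => conj_frameNormSq h _ _)]
  ring

theorem differentiableAt_chernCurvature_transport (z : M) (v w : HolTangent d z) :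
    DifferentiableAt ℝ (fun u => chernCurvature h ((chartAt (Cn d) z).symm u)
      (chartTransport (chartAt (Cn d) z) z ((chartAt (Cn d) z).symm u) v)
      (chartTransport (chartAt (Cn d) z) z ((chartAt (Cn d) z).symm u) w))
      (chartAt (Cn d) z z) := by
  set c := chartAt (Cn d) z
  have hz : z ∈ c.source := mem_chart_source _ z
  have hz' := mem_baseSet_trivializationAt ℂ L z
  have hH := contDiffAt_localNormSq h z
  have h0 := localNormSq_ne_zero h hz hz'
  have hform : (fun u => chernCurvature h (c.symm u) (chartTransport c z (c.symm u) v)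
      (chartTransport c z (c.symm u) w)) =ᶠ[𝓝 (c z)] fun u => ∑ k, ∑ l,
        (chartComp c z v) k * conj ((chartComp c z w) l : ℂ) *
          -dbarE (connE (localNormSq h z) k) u (stdVec l) := by
    have hH2 : ∀ᶠ u in 𝓝 (c z), ContDiffAt ℝ 2 (localNormSq h z) u :=
      ContDiffAt.eventually (mod_cast contDiffAt_infty.mp hH 2) (by simp)
    filter_upwards [eventually_symm_mem hz c.open_source hz,
      eventually_symm_mem hz (trivializationAt ℂ L z).open_baseSet hz', hH2] with u hu hu' hu2
    have h1 := chernCurvature_chartVec h (z := z) hu.2 hu'.2 (by rw [c.right_inv hu.1]; exact hu2)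
      (chartComp c z v) (chartComp c z w)
    rw [c.right_inv hu.1] at h1
    exact h1
  refine DifferentiableAt.congr_of_eventuallyEq ?_ hform
  refine DifferentiableAt.fun_sum fun k _ => DifferentiableAt.fun_sum fun l _ => ?_
  have h3 : ContDiffAt ℝ ((2 : ℕ) + 1) (localNormSq h z) (c z) :=
    mod_cast contDiffAt_infty.mp hH 3
  have h4 : ContDiffAt ℝ ((1 : ℕ) + 1) (connE (localNormSq h z) k) (c z) := by
    have := contDiffAt_connE h3 h0 k
    norm_num at this ⊢
    exact this
  have h5 := (contDiffAt_dbarE h4 (stdVec l)).differentiableAt (by simp)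
  exact (h5.fun_neg.const_mul _)

end Transport

/-! ### The curvature endomorphism and its spectral projection in a holomorphic frame -/

section Fields

open Filter Topology
open scoped Matrix

theorem differentiableAt_matrix_inv {d n : ℕ} {N : Cn d → Matrix (Fin n) (Fin n) ℂ} {u : Cn d}
    (hN : ∀ i j, DifferentiableAt ℝ (fun x => N x i j) u) (h0 : (N u).det ≠ 0) (i j : Fin n) :
    DifferentiableAt ℝ (fun x => (N x)⁻¹ i j) u := by
  have h1 : ∀ x, (N x)⁻¹ i j = (N x).det⁻¹ * ((N x).updateRow j (Pi.single i 1)).det := fun x => by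
    rw [Matrix.inv_def, Matrix.smul_apply, Matrix.adjugate_apply, Ring.inverse_eq_inv', smul_eq_mul]
  simp only [h1]
  refine ((differentiableAt_det hN).inv h0).mul (differentiableAt_det fun a c => ?_)
  by_cases ha : a = j
  · simp [ha]
  · simpa [Matrix.updateRow_ne ha] using hN a c

variable {d : ℕ} {M : Type*} [TopologicalSpace M] [ChartedSpace (Cn d) M]

/-- The matrix of an endomorphism field of `T^{1,0} M`, as a function of the coordinates of the chart
`c`, in the holomorphic frame that extends the basis `b` of `T^{1,0}_z M` constantly in the chart. -/
def frameMatrix (c : OpenPartialHomeomorph M (Cn d)) (z : M)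
    (b : Module.Basis (Fin d) ℂ (HolTangent d z)) (A : ∀ y : M, Module.End ℂ (HolTangent d y))
    (u : Cn d) : Matrix (Fin d) (Fin d) ℂ :=
  LinearMap.toMatrix b b
    (chartTransport c (c.symm u) z ∘ₗ A (c.symm u) ∘ₗ chartTransport c z (c.symm u))

theorem chartTransport_comp' {c : OpenPartialHomeomorph M (Cn d)}
    (hc : c ∈ IsManifold.maximalAtlas 𝓘(ℂ, Cn d) ω M) {x y : M} (hx : x ∈ c.source)
    (hy : y ∈ c.source) (v : HolTangent d x) :
    chartTransport c y x (chartTransport c x y v) = v :=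
  DFunLike.congr_fun (chartTransport_comp hc hx hy) v

variable {c : OpenPartialHomeomorph M (Cn d)} {z : M}
  {b : Module.Basis (Fin d) ℂ (HolTangent d z)} {A B : ∀ y : M, Module.End ℂ (HolTangent d y)}

theorem frameMatrix_mul (hc : c ∈ IsManifold.maximalAtlas 𝓘(ℂ, Cn d) ω M) (hz : z ∈ c.source) :
    (fun u => frameMatrix c z b A u * frameMatrix c z b B u) =ᶠ[𝓝 (c z)]
      frameMatrix c z b (fun y => A y * B y) := by
  filter_upwards [eventually_symm_mem hz c.open_source hz] with u hu
  rw [frameMatrix, frameMatrix, frameMatrix, ← LinearMap.toMatrix_mul]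
  congr 1
  ext v
  simp only [Module.End.mul_apply, LinearMap.comp_apply]
  rw [chartTransport_comp' hc hu.2 hz]

theorem frameMatrix_self (hc : c ∈ IsManifold.maximalAtlas 𝓘(ℂ, Cn d) ω M) (hz : z ∈ c.source) :
    frameMatrix c z b A (c z) = LinearMap.toMatrix b b (A z) := by
  have h1 : chartTransport c z z = LinearMap.id := by
    ext v
    exact chartVec_chartComp hc hz v
  rw [frameMatrix, c.left_inv hz, h1]
  rfl

/-- Change of the basis at `z`. -/
theorem frameMatrix_basis_change (b e : Module.Basis (Fin d) ℂ (HolTangent d z)) (u : Cn d) :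
    frameMatrix c z b A u = b.toMatrix e * frameMatrix c z e A u * e.toMatrix b := by
  rw [frameMatrix, frameMatrix, basis_toMatrix_mul_linearMap_toMatrix_mul_basis_toMatrix]

theorem trace_frameMatrix (hc : c ∈ IsManifold.maximalAtlas 𝓘(ℂ, Cn d) ω M) (hz : z ∈ c.source)
    {u : Cn d} (hu : c.symm u ∈ c.source) :
    (frameMatrix c z b A u).trace = LinearMap.trace ℂ (HolTangent d (c.symm u)) (A (c.symm u)) := by
  rw [frameMatrix, ← LinearMap.trace_eq_matrix_trace, LinearMap.trace_comp_comm', LinearMap.comp_assoc,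
    chartTransport_comp hc hu hz]
  rfl

variable [IsManifold 𝓘(ℂ, Cn d) ω M] (g : HermitianMetric d (Cn d) (HolTangent d : M → Type))
  {L : M → Type*} [∀ x, AddCommGroup (L x)] [∀ x, Module ℂ (L x)]
  [TopologicalSpace (Bundle.TotalSpace ℂ L)] [∀ x, TopologicalSpace (L x)] [FiberBundle ℂ L]

/-- The matrix `g_{i j̄}` of the metric in the holomorphic frame that extends `b`. -/
def metricMatrix (z : M) (b : Module.Basis (Fin d) ℂ (HolTangent d z)) (u : Cn d) :
    Matrix (Fin d) (Fin d) ℂ :=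
  Matrix.of fun i j => g.form ((chartAt (Cn d) z).symm u)
    (chartTransport (chartAt (Cn d) z) z ((chartAt (Cn d) z).symm u) (b i))
    (chartTransport (chartAt (Cn d) z) z ((chartAt (Cn d) z).symm u) (b j))

/-- `g_{i j̄} = ∑_k B_{ki} conj(B_{kj})`, where `B` is the matrix of the components of the holomorphic
frame in a unitary frame `e`. In particular `B` is bounded where the metric is, for any choice of
`e` at each point. -/
theorem metricMatrix_eq {z : M} {b : Module.Basis (Fin d) ℂ (HolTangent d z)} {u : Cn d}
    {e : Module.Basis (Fin d) ℂ (HolTangent d ((chartAt (Cn d) z).symm u))}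
    (he : IsUnitaryFrame (g.form ((chartAt (Cn d) z).symm u)) e) :
    metricMatrix g z b u = (LinearMap.toMatrix b e
        (chartTransport (chartAt (Cn d) z) z ((chartAt (Cn d) z).symm u)))ᵀ *
      (LinearMap.toMatrix b e
        (chartTransport (chartAt (Cn d) z) z ((chartAt (Cn d) z).symm u))).map conj := by
  ext i j
  set τ := chartTransport (chartAt (Cn d) z) z ((chartAt (Cn d) z).symm u)
  simp only [metricMatrix, Matrix.of_apply, Matrix.mul_apply, Matrix.transpose_apply,
    Matrix.map_apply, LinearMap.toMatrix_apply]
  have h1 : ∀ v, v = ∑ k, e.repr v k • e k := fun v => (e.sum_repr v).symm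
  conv_lhs => rw [h1 (τ (b i))]
  simp only [map_sum, map_smul, LinearMap.sum_apply, LinearMap.smul_apply, smul_eq_mul]
  refine Finset.sum_congr rfl fun k _ => ?_
  congr 1
  rw [← g.conj_symm, ← he.coord_eq]
  rfl

theorem det_metricMatrix_ne_zero {z : M} (b : Module.Basis (Fin d) ℂ (HolTangent d z)) :
    (metricMatrix g z b (chartAt (Cn d) z z)).det ≠ 0 := by
  set c := chartAt (Cn d) z
  have hz : z ∈ c.source := mem_chart_source _ z
  have hc : c ∈ IsManifold.maximalAtlas 𝓘(ℂ, Cn d) ω M := IsManifold.chart_mem_maximalAtlas z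
  have hs : c.symm (c z) ∈ c.source := by rwa [c.left_inv hz]
  set e := unitaryFrame g (c.symm (c z))
  rw [metricMatrix_eq g (unitaryFrame_isUnitary g _), Matrix.det_mul, Matrix.det_transpose]
  have h1 : LinearMap.toMatrix e b (chartTransport c (c.symm (c z)) z) *
      LinearMap.toMatrix b e (chartTransport c z (c.symm (c z))) = 1 := by
    rw [← LinearMap.toMatrix_comp, chartTransport_comp hc hz hs, LinearMap.toMatrix_id]
  have h2 : (LinearMap.toMatrix b e (chartTransport c z (c.symm (c z)))).det ≠ 0 := by
    intro h0
    have := congrArg Matrix.det h1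
    rw [Matrix.det_mul, h0] at this
    simp at this
  refine mul_ne_zero h2 ?_
  have h3 := RingHom.map_det (starRingEnd ℂ)
    (LinearMap.toMatrix b e (chartTransport c z (c.symm (c z))))
  rw [RingHom.mapMatrix_apply] at h3
  rw [← h3]
  simpa using h2

theorem differentiableAt_metricMatrix (z : M) (b : Module.Basis (Fin d) ℂ (HolTangent d z))
    (i j : Fin d) :
    DifferentiableAt ℝ (fun u => metricMatrix g z b u i j) (chartAt (Cn d) z z) :=
  differentiableAt_metric_transport g z (b i) (b j)

theorem eventually_det_metricMatrix_ne_zero (z : M) (b : Module.Basis (Fin d) ℂ (HolTangent d z)) :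
    ∀ᶠ u in 𝓝 (chartAt (Cn d) z z), (metricMatrix g z b u).det ≠ 0 :=
  (differentiableAt_det (differentiableAt_metricMatrix g z b)).continuousAt.eventually_ne
    (det_metricMatrix_ne_zero g b)

variable [VectorBundle ℂ ℂ L] [ContMDiffVectorBundle ω ℂ L 𝓘(ℂ, Cn d)] (h : HermitianMetric d ℂ L)

/-- `R` has differentiable coefficients: they are `R_{i k̄} g^{k̄ j}`. -/
theorem differentiableAt_frameMatrix_curvEnd (z : M)
    (b : Module.Basis (Fin d) ℂ (HolTangent d z)) (i j : Fin d) :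
    DifferentiableAt ℝ (fun u => frameMatrix (chartAt (Cn d) z) z b (curvEnd g h) u i j)
      (chartAt (Cn d) z z) := by
  set c := chartAt (Cn d) z
  have hz : z ∈ c.source := mem_chart_source _ z
  have hc : c ∈ IsManifold.maximalAtlas 𝓘(ℂ, Cn d) ω M := IsManifold.chart_mem_maximalAtlas z
  let Q : Cn d → Matrix (Fin d) (Fin d) ℂ := fun u => Matrix.of fun i j =>
    chernCurvature h (c.symm u) (chartTransport c z (c.symm u) (b i))
      (chartTransport c z (c.symm u) (b j))
  have hQ : ∀ i j, DifferentiableAt ℝ (fun u => Q u i j) (c z) := fun i j =>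
    differentiableAt_chernCurvature_transport h z (b i) (b j)
  have hinv := differentiableAt_matrix_inv (differentiableAt_metricMatrix g z b)
    (det_metricMatrix_ne_zero g b)
  refine (differentiableAt_matrix_mul hQ hinv j i).congr_of_eventuallyEq ?_
  filter_upwards [eventually_symm_mem hz c.open_source hz,
    eventually_det_metricMatrix_ne_zero g z b] with u hu hdet
  have h1 : (frameMatrix c z b (curvEnd g h) u)ᵀ * metricMatrix g z b u = Q u := by
    ext i j
    set τ := chartTransport c z (c.symm u) with hτ
    have h2 : curvEnd g h (c.symm u) (τ (b i)) =
        ∑ k, frameMatrix c z b (curvEnd g h) u k i • τ (b k) := by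
      have h3 := b.sum_repr (chartTransport c (c.symm u) z (curvEnd g h (c.symm u) (τ (b i))))
      have h4 := congrArg τ h3
      rw [hτ, chartTransport_comp' hc hu.2 hz, map_sum] at h4
      rw [← hτ] at h4
      rw [← h4]
      refine Finset.sum_congr rfl fun k _ => ?_
      rw [map_smul, frameMatrix, LinearMap.toMatrix_apply]
      rfl
    have h5 := typeChange_spec (g.form (c.symm u)) (unitaryFrame g (c.symm u))
      (unitaryFrame_isUnitary g _) (chernCurvature h (c.symm u)) (τ (b i)) (τ (b j))
    change g.form (c.symm u) (curvEnd g h (c.symm u) (τ (b i))) (τ (b j)) = _ at h5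
    rw [h2] at h5
    simp only [map_sum, map_smul, LinearMap.sum_apply, LinearMap.smul_apply, smul_eq_mul] at h5
    simp only [Matrix.mul_apply, Matrix.transpose_apply]
    exact h5
  have h6 : (frameMatrix c z b (curvEnd g h) u)ᵀ = Q u * (metricMatrix g z b u)⁻¹ := by
    rw [← h1, Matrix.mul_assoc, Matrix.mul_nonsing_inv _ (isUnit_iff_ne_zero.mpr hdet),
      Matrix.mul_one]
  exact congrFun (congrFun h6 j) i

/-- A unitary frame of eigenvectors of `R` at `x`, in the order of decreasing eigenvalues. -/
def curvEigenframe (x : M) : Module.Basis (Fin d) ℂ (HolTangent d x) :=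
  (exists_curvEnd_eigenframe (g := g) (conj_chernCurvature h x)).choose

theorem curvEigenframe_isUnitary (x : M) : IsUnitaryFrame (g.form x) (curvEigenframe g h x) :=
  (exists_curvEnd_eigenframe (g := g) (conj_chernCurvature h x)).choose_spec.1

theorem curvEnd_curvEigenframe (x : M) (i : Fin d) : curvEnd g h x (curvEigenframe g h x i) =
    (eigval g h (i + 1) x : ℂ) • curvEigenframe g h x i :=
  (exists_curvEnd_eigenframe (g := g) (conj_chernCurvature h x)).choose_spec.2.1 i

theorem antitone_eigval (x : M) : Antitone fun i : Fin d => eigval g h (i + 1) x :=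
  (exists_curvEnd_eigenframe (g := g) (conj_chernCurvature h x)).choose_spec.2.2

theorem eigval_gap {p : ℕ} (hp : 1 ≤ p) (hpd : p < d) (x : M) {i j : Fin d} (hi : (i : ℕ) < p)
    (hj : p ≤ (j : ℕ)) : eigval g h p x - eigval g h (p + 1) x ≤
      eigval g h (i + 1) x - eigval g h (j + 1) x := by
  have h1 := antitone_eigval g h x (show i ≤ ⟨p - 1, by omega⟩ from Fin.le_def.mpr (by simp; omega))
  have h2 := antitone_eigval g h x (show (⟨p, hpd⟩ : Fin d) ≤ j from Fin.le_def.mpr hj)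
  simp only [Nat.sub_add_cancel hp] at h1 h2
  linarith

/-- The orthogonal projection onto the sum of the eigenspaces of `R` for `λ_1, …, λ_p`. -/
def spectralProj (p : ℕ) (x : M) : Module.End ℂ (HolTangent d x) :=
  frameProj (curvEigenframe g h x) p

theorem spectralProj_mul_self (p : ℕ) (x : M) :
    spectralProj g h p x * spectralProj g h p x = spectralProj g h p x := by
  refine (curvEigenframe g h x).ext fun i => ?_
  simp only [spectralProj, Module.End.mul_apply, frameProj_apply]
  split_ifs with hi
  · rw [frameProj_apply, if_pos hi]
  · simp

theorem spectralProj_comm (p : ℕ) (x : M) :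
    spectralProj g h p x * curvEnd g h x = curvEnd g h x * spectralProj g h p x := by
  refine (curvEigenframe g h x).ext fun i => ?_
  simp only [spectralProj, Module.End.mul_apply, frameProj_apply, curvEnd_curvEigenframe, map_smul]
  split_ifs with hi
  · rw [curvEnd_curvEigenframe]
  · simp

/-- The spectral projection can be computed in any frame of eigenvectors. -/
theorem spectralProj_eq_frameProj {p : ℕ} {x : M} {e : Module.Basis (Fin d) ℂ (HolTangent d x)}
    (hlam : ∀ i : Fin d, curvEnd g h x (e i) = (eigval g h (i + 1) x : ℂ) • e i)
    (hgap : ∀ i j : Fin d, (i : ℕ) < p → p ≤ (j : ℕ) →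
      eigval g h (j + 1) x < eigval g h (i + 1) x) :
    spectralProj g h p x = frameProj e p := by
  refine (curvEigenframe g h x).ext fun j => ?_
  set f := curvEigenframe g h x
  -- the eigenvectors of the two frames for different eigenvalues are independent
  have hU : ∀ i, e.repr (f j) i * (eigval g h (i + 1) x - eigval g h (j + 1) x : ℂ) = 0 := by
    intro i
    have h1 := curvEnd_curvEigenframe g h x j
    change curvEnd g h x (f j) = _ • f j at h1
    have h2 : e.repr (curvEnd g h x (f j)) i = e.repr (f j) i * eigval g h (i + 1) x := by
      conv_lhs => rw [← e.sum_repr (f j)]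
      simp only [map_sum, map_smul, hlam, Finsupp.coe_finsetSum, Finset.sum_apply,
        Finsupp.smul_apply, Module.Basis.repr_self, smul_eq_mul]
      rw [Finset.sum_eq_single i]
      · simp
      · intro k _ hk
        simp [Finsupp.single_eq_of_ne hk.symm]
      · simp
    rw [h1, map_smul, Finsupp.smul_apply, smul_eq_mul] at h2
    linear_combination -h2
  have hne : ∀ i : Fin d, ((i : ℕ) < p ↔ ¬ (j : ℕ) < p) → e.repr (f j) i = 0 := by
    intro i hij
    refine (mul_eq_zero.mp (hU i)).resolve_right ?_
    rw [← Complex.ofReal_sub, Complex.ofReal_eq_zero, sub_eq_zero]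
    by_cases hi : (i : ℕ) < p
    · exact (hgap i j hi (not_lt.mp (hij.mp hi))).ne'
    · exact (hgap j i (by omega) (by omega)).ne
  rw [spectralProj, frameProj_apply]
  conv_rhs => rw [← e.sum_repr (f j)]
  simp only [map_sum, map_smul, frameProj_apply]
  split_ifs with hj
  · conv_lhs => rw [← e.sum_repr (f j)]
    refine Finset.sum_congr rfl fun i _ => ?_
    by_cases hi : (i : ℕ) < p
    · rw [if_pos hi]
    · rw [hne i (by omega), zero_smul, zero_smul]
  · symm
    refine Finset.sum_eq_zero fun i _ => ?_
    by_cases hi : (i : ℕ) < p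
    · rw [hne i (by omega), zero_smul]
    · rw [if_neg hi, smul_zero]

theorem differentiableAt_frameMatrix_spectralProj {p : ℕ} (hp : 1 ≤ p) (hpd : p < d) {z : M}
    (hgap : eigval g h (p + 1) z < eigval g h p z)
    (b : Module.Basis (Fin d) ℂ (HolTangent d z)) (i j : Fin d) :
    DifferentiableAt ℝ (fun u => frameMatrix (chartAt (Cn d) z) z b (spectralProj g h p) u i j)
      (chartAt (Cn d) z z) := by
  set c := chartAt (Cn d) z
  have hz : z ∈ c.source := mem_chart_source _ z
  have hc : c ∈ IsManifold.maximalAtlas 𝓘(ℂ, Cn d) ω M := IsManifold.chart_mem_maximalAtlas z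
  let e := fun u => curvEigenframe g h (c.symm u)
  let B : Cn d → Matrix (Fin d) (Fin d) ℂ := fun u =>
    LinearMap.toMatrix (e u) b (chartTransport c (c.symm u) z)
  let B' : Cn d → Matrix (Fin d) (Fin d) ℂ := fun u =>
    LinearMap.toMatrix b (e u) (chartTransport c z (c.symm u))
  have hev := eventually_symm_mem hz c.open_source hz
  have hBB : ∀ᶠ u in 𝓝 (c z), B u * B' u = 1 := by
    filter_upwards [hev] with u hu
    rw [← LinearMap.toMatrix_comp, chartTransport_comp hc hz hu.2, LinearMap.toMatrix_id]
  have hG : ∀ u, metricMatrix g z b u = (B' u)ᵀ * (B' u).map conj := fun u =>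
    metricMatrix_eq g (curvEigenframe_isUnitary g h _)
  have hSB : ∀ᶠ u in 𝓝 (c z), frameMatrix c z b (curvEnd g h) u * B u =
      B u * Matrix.diagonal fun i : Fin d => (eigval g h (i + 1) (c.symm u) : ℂ) := by
    filter_upwards [hev] with u hu
    have h1 : LinearMap.toMatrix (e u) (e u) (curvEnd g h (c.symm u)) =
        Matrix.diagonal fun i : Fin d => (eigval g h (i + 1) (c.symm u) : ℂ) := by
      ext i j
      rw [LinearMap.toMatrix_apply, curvEnd_curvEigenframe, map_smul, Finsupp.smul_apply,
        Module.Basis.repr_self, Matrix.diagonal_apply, Finsupp.single_apply]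
      by_cases hij : i = j
      · simp [hij]
      · simp [hij, Ne.symm hij]
    rw [← h1, frameMatrix, ← LinearMap.toMatrix_comp, ← LinearMap.toMatrix_comp,
      LinearMap.comp_assoc, LinearMap.comp_assoc, chartTransport_comp hc hu.2 hz]
    rfl
  have hB' : ∀ i j, (fun u => B' u i j) =O[𝓝 (c z)] fun _ => (1 : ℝ) := by
    intro k i
    have hcont : (fun u => metricMatrix g z b u i i) =O[𝓝 (c z)] fun _ => (1 : ℝ) :=
      (differentiableAt_metricMatrix g z b i i).continuousAt.norm.isBoundedUnder_le.isBigO_one ℝ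
    obtain ⟨C, hC⟩ := hcont.bound
    refine Asymptotics.IsBigO.of_bound (max C 0 + 1) ?_
    filter_upwards [hC] with u hu
    have h1 : metricMatrix g z b u i i = ((∑ l, ‖B' u l i‖ ^ 2 : ℝ) : ℂ) := by
      rw [hG, Matrix.mul_apply]
      push_cast
      refine Finset.sum_congr rfl fun l _ => ?_
      rw [Matrix.transpose_apply, Matrix.map_apply, Complex.mul_conj, Complex.normSq_eq_norm_sq]
      push_cast
      rfl
    have h2 : ‖B' u k i‖ ^ 2 ≤ ∑ l, ‖B' u l i‖ ^ 2 :=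
      Finset.single_le_sum (f := fun l => ‖B' u l i‖ ^ 2) (fun l _ => sq_nonneg _)
        (Finset.mem_univ k)
    rw [h1, Complex.norm_real, Real.norm_of_nonneg (Finset.sum_nonneg fun l _ => sq_nonneg _)] at hu
    simp only [norm_one, mul_one] at hu ⊢
    have h3 : C ≤ max C 0 := le_max_left _ _
    have h4 : 0 ≤ max C 0 := le_max_right _ _
    nlinarith [norm_nonneg (B' u k i)]
  have hB : ∀ i j, (fun u => B u i j) =O[𝓝 (c z)] fun _ => (1 : ℝ) := by
    intro i j
    have hinv : ∀ i j, (fun u => ((metricMatrix g z b u)⁻¹)ᵀ i j) =O[𝓝 (c z)]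
        fun _ => (1 : ℝ) := fun i j =>
      (differentiableAt_matrix_inv (differentiableAt_metricMatrix g z b)
        (det_metricMatrix_ne_zero g b) j i).continuousAt.norm.isBoundedUnder_le.isBigO_one ℝ
    have hconj : ∀ i j, (fun u => (B' u).conjTranspose i j) =O[𝓝 (c z)] fun _ => (1 : ℝ) :=
      fun i j => by
        refine Asymptotics.IsBigO.of_norm_left ((hB' j i).norm_left.congr_left fun u => ?_)
        rw [Matrix.conjTranspose_apply, norm_star]
    have h1 := isBigO_matrix_mul hinv hconj i j
    refine h1.congr' ?_ (Eventually.of_forall fun _ => mul_one _)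
    filter_upwards [hBB, eventually_det_metricMatrix_ne_zero g z b] with u hu hdet
    have h2 : (metricMatrix g z b u)ᵀ = (B' u).conjTranspose * B' u := by
      rw [hG, Matrix.transpose_mul, Matrix.transpose_transpose]
      rfl
    have h3 : ((metricMatrix g z b u)⁻¹)ᵀ * (B' u).conjTranspose = B u := by
      have h4 : ((metricMatrix g z b u)⁻¹)ᵀ * ((B' u).conjTranspose * B' u) = 1 := by
        rw [← h2, ← Matrix.transpose_mul, Matrix.mul_nonsing_inv _ (isUnit_iff_ne_zero.mpr hdet),
          Matrix.transpose_one]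
      calc _ = ((metricMatrix g z b u)⁻¹)ᵀ * (B' u).conjTranspose * (B' u * B u) := by
            rw [mul_eq_one_comm.mp hu, Matrix.mul_one]
        _ = (((metricMatrix g z b u)⁻¹)ᵀ * ((B' u).conjTranspose * B' u)) * B u := by
            simp only [Matrix.mul_assoc]
        _ = _ := by rw [h4, Matrix.one_mul]
    rw [h3]
  have hmain := differentiableAt_spectralProj hp hpd
    (lam := fun u i => eigval g h (i + 1) (c.symm u)) hBB hSB
    (Eventually.of_forall fun u => antitone_eigval g h _)
    (by simpa [c.left_inv hz, Nat.sub_add_cancel hp] using hgap)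
    (differentiableAt_frameMatrix_curvEnd g h z b) hB hB' i j
  refine hmain.congr_of_eventuallyEq (Eventually.of_forall fun u => ?_)
  have h5 : frameMatrix c z b (spectralProj g h p) u = B u * stdProj d p * B' u := by
    rw [← toMatrix_frameProj (e u) p, ← LinearMap.toMatrix_comp, ← LinearMap.toMatrix_comp]
    rfl
  exact congrFun (congrFun h5 i) j

end Fields

/-! ### First-order perturbation of a spectral projection -/

section Perturbation

open Filter Topology

variable {d p : ℕ} {u v : Cn d} {A S : Cn d → Matrix (Fin d) (Fin d) ℂ} {lam : Fin d → ℝ}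

theorem stdProj_mul_apply (X : Matrix (Fin d) (Fin d) ℂ) (i j : Fin d) :
    (stdProj d p * X) i j = if (i : ℕ) < p then X i j else 0 := by
  rw [stdProj, Matrix.diagonal_mul]
  split_ifs <;> simp

theorem mul_stdProj_apply (X : Matrix (Fin d) (Fin d) ℂ) (i j : Fin d) :
    (X * stdProj d p) i j = if (j : ℕ) < p then X i j else 0 := by
  rw [stdProj, Matrix.mul_diagonal]
  split_ifs <;> simp

/-- The derivative of a projection exchanges its image and its kernel. -/
theorem dbarMat_idempotent_apply (hA : ∀ i j, DifferentiableAt ℝ (fun x => A x i j) u)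
    (hAA : (fun x => A x * A x) =ᶠ[𝓝 u] A) (hA0 : A u = stdProj d p) {i j : Fin d}
    (hij : (i : ℕ) < p ↔ (j : ℕ) < p) : dbarMat A u v i j = 0 := by
  have h1 := dbarMat_mul (v := v) hA hA
  rw [dbarMat_congr hAA, hA0] at h1
  have h2 := congrFun (congrFun h1 i) j
  rw [Matrix.add_apply, stdProj_mul_apply, mul_stdProj_apply] at h2
  by_cases hi : (i : ℕ) < p
  · rw [if_pos hi, if_pos (hij.mp hi)] at h2
    linear_combination -h2
  · rw [if_neg hi, if_neg (by rwa [← hij])] at h2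
    simpa using h2

/-- Differentiating `[A, S] = 0` at a point where `S` is diagonal. -/
theorem dbarMat_spectralProj_apply (hA : ∀ i j, DifferentiableAt ℝ (fun x => A x i j) u)
    (hS : ∀ i j, DifferentiableAt ℝ (fun x => S x i j) u)
    (hAS : (fun x => A x * S x) =ᶠ[𝓝 u] fun x => S x * A x) (hA0 : A u = stdProj d p)
    (hS0 : S u = Matrix.diagonal fun i => (lam i : ℂ)) {i j : Fin d} (hi : (i : ℕ) < p)
    (hj : p ≤ (j : ℕ)) :
    dbarMat A u v i j * (lam i - lam j) = dbarMat S u v i j ∧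
      dbarMat A u v j i * (lam i - lam j) = dbarMat S u v j i := by
  have h1 := dbarMat_mul (v := v) hA hS
  rw [dbarMat_congr hAS, dbarMat_mul hS hA, hA0, hS0] at h1
  have h2 := congrFun (congrFun h1 i) j
  have h3 := congrFun (congrFun h1 j) i
  simp only [Matrix.add_apply, stdProj_mul_apply, mul_stdProj_apply, Matrix.mul_diagonal,
    Matrix.diagonal_mul, if_pos hi, if_neg (not_lt.mpr hj)] at h2 h3
  constructor
  · linear_combination h2
  · linear_combination -h3

theorem differentiableAt_compound (hA : ∀ i j, DifferentiableAt ℝ (fun x => A x i j) u)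
    (I J : Set.powersetCard (Fin d) p) : DifferentiableAt ℝ (fun x => compound p (A x) I J) u :=
  differentiableAt_det fun _ _ => hA _ _

/-- At a matrix unit, the derivative of an idempotent is supported on one row and one column, and
vanishes at their intersection. -/
theorem hsNormSq_dbarMat_rankOne {n : Type*} [Fintype n] [DecidableEq n] {C : Cn d → Matrix n n ℂ}
    (hC : ∀ i j, DifferentiableAt ℝ (fun x => C x i j) u) (hCC : (fun x => C x * C x) =ᶠ[𝓝 u] C)
    {k : n} (hC0 : C u = Matrix.single k k 1) :
    hsNormSq (dbarMat C u v) = ∑ j, ‖dbarMat C u v k j‖ ^ 2 + ∑ i, ‖dbarMat C u v i k‖ ^ 2 := by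
  set X := dbarMat C u v with hX
  have h1 := dbarMat_mul (v := v) hC hC
  rw [dbarMat_congr hCC, hC0, ← hX] at h1
  have h2 : ∀ i j, X i j = (if j = k then X i k else 0) + if i = k then X k j else 0 := by
    intro i j
    have h3 := congrFun (congrFun h1 i) j
    rw [Matrix.add_apply] at h3
    rw [h3]
    congr 1
    · split_ifs with hj
      · rw [hj]; simp
      · simp [hj]
    · split_ifs with hi
      · rw [hi]; simp
      · simp [hi]
  have hkk : X k k = 0 := by
    have := h2 k k
    simp only [if_true] at this
    linear_combination -this
  have h3 : ∀ i j, ‖X i j‖ ^ 2 = (if i = k then ‖X k j‖ ^ 2 else 0) +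
      if j = k then ‖X i k‖ ^ 2 else 0 := by
    intro i j
    by_cases hi : i = k
    · by_cases hj : j = k
      · simp [hi, hj, hkk]
      · simp [hi, hj]
    · by_cases hj : j = k
      · simp [hi, hj]
      · rw [h2 i j]; simp [hi, hj]
  rw [hsNormSq, Finset.sum_congr rfl fun i _ => Finset.sum_congr rfl fun j _ => h3 i j]
  simp only [Finset.sum_add_distrib]
  congr 1
  · rw [Finset.sum_comm]
    simp
  · simp

/-- The row of the derivative of a compound projection that belongs to the multi-index
`{1, …, p}`. -/
theorem sum_sq_row_dbarMat_compound (hpd : p ≤ d)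
    (hA : ∀ i j, DifferentiableAt ℝ (fun x => A x i j) u)
    (hAA : (fun x => A x * A x) =ᶠ[𝓝 u] A) (hA0 : A u = stdProj d p) :
    ∑ J, ‖dbarMat (fun x => compound p (A x)) u v (firstIndices hpd) J‖ ^ 2 =
      ∑ i : Fin d, ∑ j : Fin d,
        if (i : ℕ) < p ∧ p ≤ (j : ℕ) then ‖dbarMat A u v i j‖ ^ 2 else 0 := by
  rw [← sum_sq_rowDeriv_compound hpd (dbarMat A u v) fun i j hi hj =>
    dbarMat_idempotent_apply hA hAA hA0 (iff_of_true hi hj)]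
  refine Finset.sum_congr rfl fun J _ => ?_
  congr 2
  refine (dbarE_det fun a c => hA _ _).trans (Finset.sum_congr rfl fun r _ => ?_)
  rw [hA0]
  rfl

theorem hsNormSq_dbarMat_compound (hpd : p ≤ d)
    (hA : ∀ i j, DifferentiableAt ℝ (fun x => A x i j) u)
    (hAA : (fun x => A x * A x) =ᶠ[𝓝 u] A) (hA0 : A u = stdProj d p) :
    hsNormSq (dbarMat (fun x => compound p (A x)) u v) =
      ∑ i : Fin d, ∑ j : Fin d, if (i : ℕ) < p ∧ p ≤ (j : ℕ) then
        ‖dbarMat A u v i j‖ ^ 2 + ‖dbarMat A u v j i‖ ^ 2 else 0 := by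
  rw [hsNormSq_dbarMat_rankOne (differentiableAt_compound hA)
    (k := firstIndices hpd) ?_ (by rw [hA0, compound_stdProj])]
  · rw [sum_sq_row_dbarMat_compound hpd hA hAA hA0]
    have h1 := sum_sq_row_dbarMat_compound (v := v) (A := fun x => (A x).transpose) hpd
      (fun i j => hA j i) (by
        filter_upwards [hAA] with x hx
        rw [← Matrix.transpose_mul, hx]) (by rw [hA0, stdProj, Matrix.diagonal_transpose])
    simp only [compound_transpose] at h1
    refine (congrArg _ h1).trans ?_
    rw [← Finset.sum_add_distrib]
    refine Finset.sum_congr rfl fun i _ => ?_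
    rw [← Finset.sum_add_distrib]
    refine Finset.sum_congr rfl fun j _ => ?_
    split_ifs
    · rfl
    · simp
  · filter_upwards [hAA] with x hx
    rw [← compound_mul, hx]

/-- The derivative of the `p`-th compound of the spectral projection `A` of `S` for the first `p`
eigenvalues, at a point where `S` is diagonal. -/
theorem hsNormSq_dbarMat_compound_spectralProj (hpd : p ≤ d)
    (hA : ∀ i j, DifferentiableAt ℝ (fun x => A x i j) u)
    (hS : ∀ i j, DifferentiableAt ℝ (fun x => S x i j) u)
    (hAA : (fun x => A x * A x) =ᶠ[𝓝 u] A)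
    (hAS : (fun x => A x * S x) =ᶠ[𝓝 u] fun x => S x * A x) (hA0 : A u = stdProj d p)
    (hS0 : S u = Matrix.diagonal fun i => (lam i : ℂ))
    (hgap : ∀ i j : Fin d, (i : ℕ) < p → p ≤ (j : ℕ) → lam j < lam i) :
    hsNormSq (dbarMat (fun x => compound p (A x)) u v) =
      ∑ i : Fin d, ∑ j : Fin d, if (i : ℕ) < p ∧ p ≤ (j : ℕ) then
        (lam i - lam j) ^ (-2 : ℤ) * (‖dbarMat S u v i j‖ ^ 2 + ‖dbarMat S u v j i‖ ^ 2) else 0 := by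
  rw [hsNormSq_dbarMat_compound hpd hA hAA hA0]
  refine Finset.sum_congr rfl fun i _ => Finset.sum_congr rfl fun j _ => ?_
  split_ifs with hij
  · obtain ⟨h1, h2⟩ := dbarMat_spectralProj_apply (v := v) hA hS hAS hA0 hS0 hij.1 hij.2
    have h3 : lam i - lam j ≠ 0 := (sub_pos.mpr (hgap i j hij.1 hij.2)).ne'
    rw [← h1, ← h2, ← Complex.ofReal_sub, norm_mul, norm_mul, Complex.norm_real, mul_pow, mul_pow,
      Real.norm_eq_abs, sq_abs, zpow_neg]
    norm_cast
    field_simp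
  · rfl

/-- The off-diagonal blocks of a matrix contribute at most its squared norm minus that of the
diagonal. -/
theorem sum_offDiagonal_le (X : Matrix (Fin d) (Fin d) ℂ) :
    (∑ i : Fin d, ∑ j : Fin d, if (i : ℕ) < p ∧ p ≤ (j : ℕ) then ‖X i j‖ ^ 2 + ‖X j i‖ ^ 2 else 0) ≤
      hsNormSq X - ∑ i, ‖X i i‖ ^ 2 := by
  have h1 : (∑ i : Fin d, ∑ j : Fin d,
      if (i : ℕ) < p ∧ p ≤ (j : ℕ) then ‖X i j‖ ^ 2 + ‖X j i‖ ^ 2 else 0) =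
      ∑ i : Fin d, ∑ j : Fin d, ((if (i : ℕ) < p ∧ p ≤ (j : ℕ) then ‖X i j‖ ^ 2 else 0) +
        if (j : ℕ) < p ∧ p ≤ (i : ℕ) then ‖X i j‖ ^ 2 else 0) := by
    simp only [Finset.sum_add_distrib]
    rw [Finset.sum_comm (f := fun i j : Fin d =>
      if (j : ℕ) < p ∧ p ≤ (i : ℕ) then ‖X i j‖ ^ 2 else 0)]
    simp only [← Finset.sum_add_distrib]
    refine Finset.sum_congr rfl fun i _ => Finset.sum_congr rfl fun j _ => ?_
    split_ifs <;> simp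
  have h2 : ∑ i, ‖X i i‖ ^ 2 = ∑ i, ∑ j, if i = j then ‖X i j‖ ^ 2 else 0 := by simp
  rw [h1, h2, hsNormSq, ← Finset.sum_sub_distrib]
  refine Finset.sum_le_sum fun i _ => ?_
  rw [← Finset.sum_sub_distrib]
  refine Finset.sum_le_sum fun j _ => ?_
  by_cases hij : i = j
  · subst hij
    have hne : ¬((i : ℕ) < p ∧ p ≤ (i : ℕ)) := by omega
    simp [hne]
  · rw [if_neg hij, sub_zero]
    split_ifs with h3 h4
    · omega
    · simp
    · simp
    · simp

/-- The pointwise estimate behind all upper bounds. -/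
theorem hsNormSq_dbarMat_compound_le (hpd : p ≤ d)
    (hA : ∀ i j, DifferentiableAt ℝ (fun x => A x i j) u)
    (hS : ∀ i j, DifferentiableAt ℝ (fun x => S x i j) u)
    (hAA : (fun x => A x * A x) =ᶠ[𝓝 u] A)
    (hAS : (fun x => A x * S x) =ᶠ[𝓝 u] fun x => S x * A x) (hA0 : A u = stdProj d p)
    (hS0 : S u = Matrix.diagonal fun i => (lam i : ℂ)) {δ : ℝ} (hδ : 0 < δ)
    (hgap : ∀ i j : Fin d, (i : ℕ) < p → p ≤ (j : ℕ) → δ ≤ lam i - lam j) :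
    hsNormSq (dbarMat (fun x => compound p (A x)) u v) ≤
      δ ^ (-2 : ℤ) * (hsNormSq (dbarMat S u v) - ∑ i, ‖dbarMat S u v i i‖ ^ 2) := by
  rw [hsNormSq_dbarMat_compound_spectralProj hpd hA hS hAA hAS hA0 hS0 fun i j hi hj => by
    linarith [hgap i j hi hj]]
  refine le_trans ?_ (mul_le_mul_of_nonneg_left (sum_offDiagonal_le (p := p) (dbarMat S u v))
    (by positivity))
  rw [Finset.mul_sum]
  refine Finset.sum_le_sum fun i _ => ?_
  rw [Finset.mul_sum]
  refine Finset.sum_le_sum fun j _ => ?_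
  split_ifs with hij
  · refine mul_le_mul_of_nonneg_right ?_ (by positivity)
    have h1 := hgap i j hij.1 hij.2
    rw [zpow_neg, zpow_neg]
    norm_cast
    gcongr
  · simp

/-- Cauchy–Schwarz for the trace. -/
theorem norm_trace_sq_le (X : Matrix (Fin d) (Fin d) ℂ) :
    1 / (d : ℝ) * ‖X.trace‖ ^ 2 ≤ ∑ i, ‖X i i‖ ^ 2 := by
  rcases Nat.eq_zero_or_pos d with hd | hd
  · subst hd
    simp
  have h1 : ‖X.trace‖ ^ 2 ≤ d * ∑ i, ‖X i i‖ ^ 2 := by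
    calc ‖X.trace‖ ^ 2 ≤ (∑ i, ‖X i i‖) ^ 2 := by
          gcongr
          exact norm_sum_le _ _
      _ ≤ _ := by
          have := sq_sum_le_card_mul_sum_sq (s := Finset.univ) (f := fun i : Fin d => ‖X i i‖)
          simpa using this
  have hd' : (0 : ℝ) < d := by exact_mod_cast hd
  rw [one_div, inv_mul_le_iff₀ hd']
  exact h1

theorem dbarE_trace (hS : ∀ i j, DifferentiableAt ℝ (fun x => S x i j) u) :
    dbarE (fun x => (S x).trace) u v = (dbarMat S u v).trace := by
  simp only [Matrix.trace, Matrix.diag]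
  exact dbarE_sum _ fun i _ => hS i i

/-- If `f² = Tr S²` and `S` is diagonal at `u`, then `∂̄f` is the component of `∂̄S` in the direction of
`S`. -/
theorem norm_dbarE_sq_le {f : Cn d → ℂ} (hf : DifferentiableAt ℝ f u) (hf0 : f u ≠ 0)
    (hS : ∀ i j, DifferentiableAt ℝ (fun x => S x i j) u)
    (hfS : (fun x => f x * f x) =ᶠ[𝓝 u] fun x => (S x * S x).trace)
    (hS0 : S u = Matrix.diagonal fun i => (lam i : ℂ)) :
    ‖dbarE f u v‖ ^ 2 ≤ ∑ i, ‖dbarMat S u v i i‖ ^ 2 := by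
  have h1 := dbarE_mul (v := v) hf hf
  rw [dbarE_congr hfS, dbarE_trace (differentiableAt_matrix_mul hS hS), dbarMat_mul hS hS, hS0] at h1
  have h2 : f u * dbarE f u v = ∑ i, lam i * dbarMat S u v i i := by
    simp only [Matrix.trace, Matrix.diag, Matrix.add_apply, Matrix.mul_diagonal,
      Matrix.diagonal_mul] at h1
    have h3 : ∑ i, (dbarMat S u v i i * lam i + lam i * dbarMat S u v i i) =
        2 * ∑ i, lam i * dbarMat S u v i i := by
      rw [Finset.mul_sum]
      exact Finset.sum_congr rfl fun i _ => by ring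
    rw [h3] at h1
    linear_combination -(1 / 2 : ℂ) * h1
  have h4 : f u * f u = ((∑ i, lam i ^ 2 : ℝ) : ℂ) := by
    rw [show f u * f u = (S u * S u).trace from hfS.self_of_nhds, hS0, Matrix.diagonal_mul_diagonal, Matrix.trace_diagonal]
    push_cast
    exact Finset.sum_congr rfl fun i _ => by ring
  have h5 : ‖f u‖ ^ 2 = ∑ i, lam i ^ 2 := by
    rw [sq, ← norm_mul, h4, Complex.norm_real,
      Real.norm_of_nonneg (Finset.sum_nonneg fun i _ => sq_nonneg _)]
  have h6 : ‖f u‖ ^ 2 * ‖dbarE f u v‖ ^ 2 ≤ (∑ i, lam i ^ 2) * ∑ i, ‖dbarMat S u v i i‖ ^ 2 := by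
    rw [← mul_pow, ← norm_mul, h2]
    calc ‖∑ i, lam i * dbarMat S u v i i‖ ^ 2 ≤ (∑ i, |lam i| * ‖dbarMat S u v i i‖) ^ 2 := by
          gcongr
          refine (norm_sum_le _ _).trans (Finset.sum_le_sum fun i _ => ?_)
          rw [norm_mul, Complex.norm_real, Real.norm_eq_abs]
      _ ≤ (∑ i, |lam i| ^ 2) * ∑ i, ‖dbarMat S u v i i‖ ^ 2 :=
          Finset.sum_mul_sq_le_sq_mul_sq _ _ _
      _ = _ := by simp only [sq_abs]
  rw [← h5] at h6
  exact le_of_mul_le_mul_left h6 (by positivity)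

end Perturbation

/-! ### Norms of derivatives in unitary frames -/

section Norms

open Filter Topology

theorem dbarMat_const_mul_const {d : ℕ} {n : Type*} [Fintype n] {N : Cn d → Matrix n n ℂ}
    {u v : Cn d} (hN : ∀ i j, DifferentiableAt ℝ (fun x => N x i j) u) (W W' : Matrix n n ℂ) :
    dbarMat (fun x => W * N x * W') u v = W * dbarMat N u v * W' := by
  have h1 : ∀ i j, DifferentiableAt ℝ (fun x => (W * N x) i j) u :=
    differentiableAt_matrix_mul (N := fun _ => W) (fun _ _ => differentiableAt_const _) hN
  rw [dbarMat_mul (N := fun x => W * N x) (N' := fun _ => W') h1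
    (fun _ _ => differentiableAt_const _), dbarMat_mul (N := fun _ => W)
    (fun _ _ => differentiableAt_const _) hN, dbarMat_const, dbarMat_const]
  simp

variable {d : ℕ} {M : Type*} [TopologicalSpace M] [ChartedSpace (Cn d) M]
  [IsManifold 𝓘(ℂ, Cn d) ω M] (g : HermitianMetric d (Cn d) (HolTangent d : M → Type))

/-- The components in the chart at `z` of the vectors of the unitary frame at `z`. -/
def frameDirection (z : M) (k : Fin d) : Cn d :=
  chartComp (chartAt (Cn d) z) z (unitaryFrame g z k)

theorem normSqDbar_eq (f : M → ℂ) (z : M) : normSqDbar g f z =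
    ∑ k, ‖dbarE (f ∘ (chartAt (Cn d) z).symm) (chartAt (Cn d) z z) (frameDirection g z k)‖ ^ 2 :=
  Finset.sum_congr rfl fun k _ => by
    rw [dbar_eq_dbarE (IsManifold.chart_mem_maximalAtlas z) (mem_chart_source _ z)]
    rfl

/-- The squared norm of `∂̄N` for a matrix of functions of the coordinates near `z`. -/
def normSqDbarMat {n : Type*} [Fintype n] (z : M) (N : Cn d → Matrix n n ℂ) : ℝ :=
  ∑ k, hsNormSq (dbarMat N (chartAt (Cn d) z z) (frameDirection g z k))

theorem sum_normSqDbar_eq {n : Type*} [Fintype n] (z : M) (f : n → n → M → ℂ)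
    (N : Cn d → Matrix n n ℂ) (hfN : ∀ i j u, f i j ((chartAt (Cn d) z).symm u) = N u i j) :
    ∑ i, ∑ j, normSqDbar g (f i j) z = normSqDbarMat g z N := by
  simp only [normSqDbar_eq, normSqDbarMat, hsNormSq]
  rw [Finset.sum_congr rfl fun i _ => Finset.sum_comm, Finset.sum_comm]
  refine Finset.sum_congr rfl fun k _ => Finset.sum_congr rfl fun i _ =>
    Finset.sum_congr rfl fun j _ => ?_
  rw [dbarMat, Matrix.of_apply, ← funext (hfN i j)]
  rfl

theorem IsUnitaryFrame.toMatrix_eq_conjTranspose {z : M}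
    {b e : Module.Basis (Fin d) ℂ (HolTangent d z)} (hb : IsUnitaryFrame (g.form z) b)
    (he : IsUnitaryFrame (g.form z) e) : e.toMatrix b = (b.toMatrix e).conjTranspose := by
  have h1 := hb.conjTranspose_toMatrix_mul he
  have h2 := b.toMatrix_mul_toMatrix_flip e
  calc e.toMatrix b = (b.toMatrix e).conjTranspose * b.toMatrix e * e.toMatrix b := by
        rw [h1, Matrix.one_mul]
    _ = _ := by rw [Matrix.mul_assoc, h2, Matrix.mul_one]

/-- `|∂̄A|²` does not depend on the unitary basis at `z`, which changes the matrix of `A` by a constant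
unitary matrix. -/
theorem normSqDbarMat_frameMatrix {z : M} {b e : Module.Basis (Fin d) ℂ (HolTangent d z)}
    (hb : IsUnitaryFrame (g.form z) b) (he : IsUnitaryFrame (g.form z) e)
    {A : ∀ y : M, Module.End ℂ (HolTangent d y)}
    (hA : ∀ i j, DifferentiableAt ℝ (fun u => frameMatrix (chartAt (Cn d) z) z e A u i j)
      (chartAt (Cn d) z z)) :
    normSqDbarMat g z (frameMatrix (chartAt (Cn d) z) z b A) =
      normSqDbarMat g z (frameMatrix (chartAt (Cn d) z) z e A) := by
  refine Finset.sum_congr rfl fun k _ => ?_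
  have h1 : frameMatrix (chartAt (Cn d) z) z b A = fun u =>
      b.toMatrix e * frameMatrix (chartAt (Cn d) z) z e A u * e.toMatrix b :=
    funext (frameMatrix_basis_change b e)
  rw [h1, dbarMat_const_mul_const hA,
    hb.toMatrix_eq_conjTranspose g he, hsNormSq_unitary_conj (hb.conjTranspose_toMatrix_mul he)]

theorem normSqDbarMat_compound_frameMatrix {p : ℕ} {z : M}
    {b e : Module.Basis (Fin d) ℂ (HolTangent d z)}
    (hb : IsUnitaryFrame (g.form z) b) (he : IsUnitaryFrame (g.form z) e)
    {A : ∀ y : M, Module.End ℂ (HolTangent d y)}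
    (hA : ∀ i j, DifferentiableAt ℝ (fun u => frameMatrix (chartAt (Cn d) z) z e A u i j)
      (chartAt (Cn d) z z)) :
    normSqDbarMat g z (fun u => compound p (frameMatrix (chartAt (Cn d) z) z b A u)) =
      normSqDbarMat g z (fun u => compound p (frameMatrix (chartAt (Cn d) z) z e A u)) := by
  refine Finset.sum_congr rfl fun k _ => ?_
  have h1 : (compound p (b.toMatrix e)).conjTranspose * compound p (b.toMatrix e) = 1 := by
    rw [← compound_conjTranspose, ← compound_mul, hb.conjTranspose_toMatrix_mul he, compound_one]
  simp only [frameMatrix_basis_change (A := A) b e, compound_mul]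
  rw [dbarMat_const_mul_const (differentiableAt_compound hA),
    hb.toMatrix_eq_conjTranspose g he, compound_conjTranspose, hsNormSq_unitary_conj h1]

theorem normSqDbarEnd_eq (A : ∀ y : M, Module.End ℂ (HolTangent d y)) (z : M) :
    normSqDbarEnd g A z =
      normSqDbarMat g z (frameMatrix (chartAt (Cn d) z) z (unitaryFrame g z) A) := by
  rw [← sum_normSqDbar_eq g z (fun j i y => (unitaryFrame g z).coord j
    (chartTransport (chartAt (Cn d) z) y z (A y (chartTransport (chartAt (Cn d) z) z y
      (unitaryFrame g z i))))) _ fun j i u => ?_, Finset.sum_comm]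
  · rfl
  · rw [frameMatrix, LinearMap.toMatrix_apply]
    rfl

variable {L : M → Type*} [∀ x, AddCommGroup (L x)] [∀ x, Module ℂ (L x)]
  [TopologicalSpace (Bundle.TotalSpace ℂ L)] [∀ x, TopologicalSpace (L x)] [FiberBundle ℂ L]
  (h : HermitianMetric d ℂ L) {z : M} {e : Module.Basis (Fin d) ℂ (HolTangent d z)}

theorem frameMatrix_curvEnd_self
    (hlam : ∀ i : Fin d, curvEnd g h z (e i) = (eigval g h (i + 1) z : ℂ) • e i) :
    frameMatrix (chartAt (Cn d) z) z e (curvEnd g h) (chartAt (Cn d) z z) =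
      Matrix.diagonal fun i : Fin d => (eigval g h (i + 1) z : ℂ) := by
  rw [frameMatrix_self (IsManifold.chart_mem_maximalAtlas z) (mem_chart_source _ z)]
  ext i j
  rw [LinearMap.toMatrix_apply, hlam, map_smul, Finsupp.smul_apply,
    Module.Basis.repr_self, Matrix.diagonal_apply, Finsupp.single_apply]
  by_cases hij : i = j
  · simp [hij]
  · simp [hij, Ne.symm hij]

theorem curvTrace_eventuallyEq :
    curvTrace g h ∘ (chartAt (Cn d) z).symm =ᶠ[𝓝 (chartAt (Cn d) z z)]
      fun u => (frameMatrix (chartAt (Cn d) z) z e (curvEnd g h) u).trace := by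
  filter_upwards [eventually_symm_mem (mem_chart_source _ z) (chartAt (Cn d) z).open_source
    (mem_chart_source _ z)] with u hu
  rw [trace_frameMatrix (IsManifold.chart_mem_maximalAtlas z) (mem_chart_source _ z) hu.2]
  rfl

theorem curvNorm_nonneg (x : M) : 0 ≤ curvNorm g h x := Real.sqrt_nonneg _

variable [VectorBundle ℂ ℂ L] [ContMDiffVectorBundle ω ℂ L 𝓘(ℂ, Cn d)]

/-- The coefficients of `Ψ` are the `p × p` minors of the matrix of the spectral projection. -/
theorem endFormsCoeff_twistingSection {p : ℕ} (hp : 1 ≤ p) (hpd : p < d)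
    (hgap : ∀ x : M, eigval g h (p + 1) x < eigval g h p x) (c : OpenPartialHomeomorph M (Cn d))
    (z : M) (b : Module.Basis (Fin d) ℂ (HolTangent d z)) (I J : Set.powersetCard (Fin d) p)
    (u : Cn d) : endFormsCoeff (twistingSection g h p) c z b I J (c.symm u) =
      compound p (frameMatrix c z b (spectralProj g h p) u) I J := by
  have h1 := twistingSection_eq (p := p) hpd.le (conj_chernCurvature h (c.symm u))
    (curvEigenframe_isUnitary g h (c.symm u))
    (lam := fun i : Fin d => eigval g h (i + 1) (c.symm u)) (curvEnd_curvEigenframe g h _)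
    fun i j hi hj => by linarith [eigval_gap g h hp hpd (c.symm u) hi hj, hgap (c.symm u)]
  rw [endFormsCoeff, h1, frameMatrix, ← coord_exteriorPower_map]
  congr 1
  rw [← LinearMap.comp_apply, ← LinearMap.comp_apply, ← exteriorPower.map_comp,
    ← exteriorPower.map_comp]
  rfl

theorem normSqDbarEndForms_twistingSection {p : ℕ} (hp : 1 ≤ p) (hpd : p < d)
    (hgap : ∀ x : M, eigval g h (p + 1) x < eigval g h p x) (z : M)
    {e : Module.Basis (Fin d) ℂ (HolTangent d z)} (he : IsUnitaryFrame (g.form z) e) :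
    normSqDbarEndForms g (twistingSection g h p) z = normSqDbarMat g z fun u =>
      compound p (frameMatrix (chartAt (Cn d) z) z e (spectralProj g h p) u) := by
  rw [← normSqDbarMat_compound_frameMatrix g (unitaryFrame_isUnitary g z) he
    (differentiableAt_frameMatrix_spectralProj g h hp hpd (hgap z) e)]
  exact sum_normSqDbar_eq g z _ _ fun I J u =>
    endFormsCoeff_twistingSection g h hp hpd hgap _ z _ I J u

theorem frameMatrix_spectralProj_self {p : ℕ} (hp : 1 ≤ p) (hpd : p < d)
    (hgap : eigval g h (p + 1) z < eigval g h p z)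
    (hlam : ∀ i : Fin d, curvEnd g h z (e i) = (eigval g h (i + 1) z : ℂ) • e i) :
    frameMatrix (chartAt (Cn d) z) z e (spectralProj g h p) (chartAt (Cn d) z z) =
      stdProj d p := by
  rw [frameMatrix_self (IsManifold.chart_mem_maximalAtlas z) (mem_chart_source _ z),
    spectralProj_eq_frameProj g h hlam fun i j hi hj => by
      linarith [eigval_gap g h hp hpd z hi hj], toMatrix_frameProj]

theorem frameMatrix_spectralProj_idem (p : ℕ) :
    (fun u => frameMatrix (chartAt (Cn d) z) z e (spectralProj g h p) u *
      frameMatrix (chartAt (Cn d) z) z e (spectralProj g h p) u) =ᶠ[𝓝 (chartAt (Cn d) z z)]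
      frameMatrix (chartAt (Cn d) z) z e (spectralProj g h p) := by
  refine (frameMatrix_mul (IsManifold.chart_mem_maximalAtlas z) (mem_chart_source _ z)).trans ?_
  rw [funext fun y => spectralProj_mul_self g h p y]

theorem frameMatrix_spectralProj_comm (p : ℕ) :
    (fun u => frameMatrix (chartAt (Cn d) z) z e (spectralProj g h p) u *
      frameMatrix (chartAt (Cn d) z) z e (curvEnd g h) u) =ᶠ[𝓝 (chartAt (Cn d) z z)]
      fun u => frameMatrix (chartAt (Cn d) z) z e (curvEnd g h) u *
        frameMatrix (chartAt (Cn d) z) z e (spectralProj g h p) u := by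
  have hc := IsManifold.chart_mem_maximalAtlas (I := 𝓘(ℂ, Cn d)) (n := ω) z
  refine (frameMatrix_mul hc (mem_chart_source _ z)).trans
    (EventuallyEq.trans ?_ (frameMatrix_mul hc (mem_chart_source _ z)).symm)
  rw [funext fun y => spectralProj_comm g h p y]

/-! ### The trace and the norm of the curvature endomorphism -/

/-- `|R|² = Tr R²`, as `R` is self-adjoint. -/
theorem curvNorm_mul_self (x : M) : ((curvNorm g h x : ℂ)) * curvNorm g h x =
    LinearMap.trace ℂ (HolTangent d x) (curvEnd g h x * curvEnd g h x) := by
  set b := unitaryFrame g x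
  have hb : IsUnitaryFrame (g.form x) b := unitaryFrame_isUnitary g x
  have hself := typeChange_isSelfAdjoint (g.conj_symm x) hb (conj_chernCurvature h x)
  change ∀ v w, g.form x (curvEnd g h x v) w = g.form x v (curvEnd g h x w) at hself
  have hconj : ∀ i j, conj (b.coord j (curvEnd g h x (b i))) = b.coord i (curvEnd g h x (b j)) :=
    fun i j => by rw [hb.coord_eq, hb.coord_eq, g.conj_symm, hself]
  rw [← Complex.ofReal_mul, curvNorm, Real.mul_self_sqrt
    (Finset.sum_nonneg fun i _ => Finset.sum_nonneg fun j _ => sq_nonneg _),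
    LinearMap.trace_eq_matrix_trace ℂ b, LinearMap.toMatrix_mul, Matrix.trace]
  push_cast
  refine Finset.sum_congr rfl fun i _ => ?_
  rw [Matrix.diag_apply, Matrix.mul_apply]
  refine Finset.sum_congr rfl fun j _ => ?_
  rw [← Complex.mul_conj', hconj, LinearMap.toMatrix_apply, LinearMap.toMatrix_apply]
  exact mul_comm _ _

theorem curvNorm_mul_self_eventuallyEq :
    (fun u => (curvNorm g h ((chartAt (Cn d) z).symm u) : ℂ) *
      curvNorm g h ((chartAt (Cn d) z).symm u)) =ᶠ[𝓝 (chartAt (Cn d) z z)]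
      fun u => (frameMatrix (chartAt (Cn d) z) z e (curvEnd g h) u *
        frameMatrix (chartAt (Cn d) z) z e (curvEnd g h) u).trace := by
  have hc := IsManifold.chart_mem_maximalAtlas (I := 𝓘(ℂ, Cn d)) (n := ω) z
  filter_upwards [frameMatrix_mul (b := e) (A := curvEnd g h) (B := curvEnd g h) hc
    (mem_chart_source _ z), eventually_symm_mem (mem_chart_source _ z)
    (chartAt (Cn d) z).open_source (mem_chart_source _ z)] with u hu hu'
  rw [hu, trace_frameMatrix hc (mem_chart_source _ z) hu'.2, curvNorm_mul_self]

theorem differentiableAt_curvNorm (h0 : curvNorm g h z ≠ 0) :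
    DifferentiableAt ℝ (fun u => (curvNorm g h ((chartAt (Cn d) z).symm u) : ℂ))
      (chartAt (Cn d) z z) := by
  set c := chartAt (Cn d) z
  have hz : z ∈ c.source := mem_chart_source _ z
  set S := frameMatrix c z (unitaryFrame g z) (curvEnd g h)
  have hS := differentiableAt_frameMatrix_curvEnd g h z (unitaryFrame g z)
  have hsq : ∀ᶠ u in 𝓝 (c z), curvNorm g h (c.symm u) = √((S u * S u).trace.re) := by
    filter_upwards [curvNorm_mul_self_eventuallyEq g h (e := unitaryFrame g z)] with u hu
    rw [← hu, ← Complex.ofReal_mul, Complex.ofReal_re, Real.sqrt_mul_self (curvNorm_nonneg g h _)]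
  have htr : DifferentiableAt ℝ (fun u => (S u * S u).trace) (c z) := by
    simp only [Matrix.trace, Matrix.diag]
    exact DifferentiableAt.fun_sum fun i _ => differentiableAt_matrix_mul hS hS i i
  have hre : DifferentiableAt ℝ (fun u => (S u * S u).trace.re) (c z) :=
    Complex.reCLM.differentiableAt.comp _ htr
  have hne : (S (c z) * S (c z)).trace.re ≠ 0 := by
    intro h1
    have h2 := hsq.self_of_nhds
    rw [h1, Real.sqrt_zero, c.left_inv hz] at h2
    exact h0 h2
  refine (Complex.ofRealCLM.differentiableAt.comp _ (hre.sqrt hne)).congr_of_eventuallyEq ?_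
  filter_upwards [hsq] with u hu
  rw [hu]
  rfl

/-! ### The coefficients of the curvature in arbitrary holomorphic coordinates -/

/-- In coordinates whose coordinate vectors form the basis `e` at `z`, the matrix of `R` and the
matrix of `R` in the frame that extends `e` constantly in the preferred chart are conjugate by a
holomorphic matrix that is the identity at `z`, so they have the same `∂̄` at `z`. -/
theorem dbarE_curvCoeff {c : OpenPartialHomeomorph M (Cn d)}
    (hc : c ∈ IsManifold.maximalAtlas 𝓘(ℂ, Cn d) ω M) (hz : z ∈ c.source)
    (he : ∀ i, e i = coordVec c z i) (i j : Fin d) (v : Cn d) :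
    dbarE (curvCoeff g h c j i ∘ (chartAt (Cn d) z).symm) (chartAt (Cn d) z z) v =
      dbarMat (frameMatrix (chartAt (Cn d) z) z e (curvEnd g h)) (chartAt (Cn d) z z) v i j := by
  set c₀ := chartAt (Cn d) z
  have hz₀ : z ∈ c₀.source := mem_chart_source _ z
  have hc₀ : c₀ ∈ IsManifold.maximalAtlas 𝓘(ℂ, Cn d) ω M := IsManifold.chart_mem_maximalAtlas z
  set S := frameMatrix c₀ z e (curvEnd g h) with hSdef
  have hS := differentiableAt_frameMatrix_curvEnd g h z e
  let S' : Cn d → Matrix (Fin d) (Fin d) ℂ := fun u =>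
    Matrix.of fun i j => curvCoeff g h c j i (c₀.symm u)
  let t : Fin d → Cn d → Cn d := fun i u => fderiv ℂ (c₀ ∘ c.symm) (c (c₀.symm u)) (stdVec i)
  let coord : Fin d → Cn d →ₗ[ℂ] ℂ := fun k => e.coord k
  let ℓ : Fin d → Cn d →L[ℂ] ℂ := fun k => (coord k).toContinuousLinearMap.comp (chartVec c₀ z)
  let T : Cn d → Matrix (Fin d) (Fin d) ℂ := fun u => Matrix.of fun k i => ℓ k (t i u)
  have htsm : ∀ i, DifferentiableAt ℂ (t i) (c₀ z) := by
    intro i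
    have h1 := contDiffAt_transition hc hc₀ hz hz₀
    have h2 := contDiffAt_transition hc₀ hc hz₀ hz
    have h3 : DifferentiableAt ℂ (fderiv ℂ (c₀ ∘ c.symm)) ((c ∘ c₀.symm) (c₀ z)) := by
      have : (c ∘ c₀.symm) (c₀ z) = c z := by simp [c₀.left_inv hz₀]
      rw [this]
      exact (h1.fderiv_right (m := 1) (by simp)).differentiableAt one_ne_zero
    exact (h3.comp (c₀ z) (h2.differentiableAt (by simp))).clm_apply (differentiableAt_const _)
  have hThol : ∀ k i, DifferentiableAt ℂ (fun u => T u k i) (c₀ z) := fun k i =>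
    (ℓ k).differentiableAt.comp _ (htsm i)
  have hT : ∀ k i, DifferentiableAt ℝ (fun u => T u k i) (c₀ z) := fun k i =>
    (hThol k i).restrictScalars ℝ
  have hdT : dbarMat T (c₀ z) v = 0 := by
    ext k i
    exact dbarE_of_holomorphic (hThol k i)
  have hTcoord : ∀ u, u ∈ c₀.target ∧ c₀.symm u ∈ c₀.source → c₀.symm u ∈ c.source → ∀ k i,
      T u k i = e.coord k (chartTransport c₀ (c₀.symm u) z (coordVec c (c₀.symm u) i)) := by
    intro u hu hu' k i
    change e.coord k (chartVec c₀ z (t i u)) =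
      e.coord k (chartVec c₀ z (chartComp c₀ (c₀.symm u) (chartVec c (c₀.symm u) (stdVec i))))
    rw [chartComp_chartVec_eq_fderiv hc hc₀ hu' hu.2]
  have hT1 : T (c₀ z) = 1 := by
    ext k i
    have h1 : c₀ z ∈ c₀.target ∧ c₀.symm (c₀ z) ∈ c₀.source :=
      ⟨c₀.map_source hz₀, by rwa [c₀.left_inv hz₀]⟩
    rw [hTcoord _ h1 (by rwa [c₀.left_inv hz₀]), c₀.left_inv hz₀, ← he]
    have h2 : chartTransport c₀ z z (e i) = e i := chartVec_chartComp hc₀ hz₀ (e i)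
    rw [h2, Module.Basis.coord_apply, Module.Basis.repr_self, Matrix.one_apply,
      Finsupp.single_apply]
    simp only [eq_comm]
  -- the change of frame intertwines the two matrices of `R`
  have hST : (fun u => S u * T u) =ᶠ[𝓝 (c₀ z)] fun u => T u * S' u := by
    filter_upwards [eventually_symm_mem hz₀ c₀.open_source hz₀,
      eventually_symm_mem hz₀ c.open_source hz] with u hu hu'
    ext m i
    set y := c₀.symm u
    simp only [Matrix.mul_apply]
    have h1 : curvEnd g h y (coordVec c y i) = ∑ k, S' u k i • coordVec c y k := by
      obtain ⟨w, hw⟩ : ∃ w : Cn d, w = chartComp c y (curvEnd g h y (coordVec c y i)) := ⟨_, rfl⟩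
      have h2 : chartVec c y w = curvEnd g h y (coordVec c y i) := by
        rw [hw]
        exact chartVec_chartComp hc hu'.2 (curvEnd g h y (coordVec c y i))
      rw [← sum_smul_stdVec w, map_sum] at h2
      refine h2.symm.trans (Finset.sum_congr rfl fun k _ => ?_)
      rw [map_smul, hw]
      rfl
    have h3 : ∑ k, S u m k * T u k i =
        e.coord m (chartTransport c₀ y z (curvEnd g h y (coordVec c y i))) := by
      have h4 : coordVec c y i = ∑ k, T u k i • chartTransport c₀ z y (e k) := by
        have h5 := congrArg (chartTransport c₀ z y)
          (e.sum_repr (chartTransport c₀ y z (coordVec c y i)))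
        rw [chartTransport_comp' hc₀ hu.2 hz₀, map_sum] at h5
        refine h5.symm.trans (Finset.sum_congr rfl fun k _ => ?_)
        rw [map_smul, hTcoord u hu hu'.2]
        rfl
      rw [h4]
      simp only [map_sum, map_smul, smul_eq_mul]
      refine Finset.sum_congr rfl fun k _ => ?_
      rw [mul_comm]
      congr 1
      rw [hSdef, frameMatrix, LinearMap.toMatrix_apply]
      rfl
    rw [h3, h1]
    simp only [map_sum, map_smul, smul_eq_mul]
    refine Finset.sum_congr rfl fun k _ => ?_
    rw [hTcoord u hu hu'.2, mul_comm]
  have hdet : (T (c₀ z)).det ≠ 0 := by rw [hT1]; simp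
  have hS'eq : S' =ᶠ[𝓝 (c₀ z)] fun u => (T u)⁻¹ * (S u * T u) := by
    filter_upwards [hST, (differentiableAt_det hT).continuousAt.eventually_ne hdet] with u hu hu'
    rw [hu, Matrix.nonsing_inv_mul_cancel_left _ _ (isUnit_iff_ne_zero.mpr hu')]
  have hS' : ∀ i j, DifferentiableAt ℝ (fun u => S' u i j) (c₀ z) := fun i j =>
    (differentiableAt_matrix_mul (differentiableAt_matrix_inv hT hdet)
      (differentiableAt_matrix_mul hS hT) i j).congr_of_eventuallyEq
      (hS'eq.mono fun u hu => congrFun (congrFun hu i) j)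
  have hfin := dbarMat_mul (v := v) hS hT
  rw [dbarMat_congr hST, dbarMat_mul hT hS', hdT, hT1] at hfin
  simp only [Matrix.zero_mul, Matrix.one_mul, Matrix.mul_zero, Matrix.mul_one, zero_add,
    add_zero] at hfin
  exact congrFun (congrFun hfin i) j

end Norms

theorem mainTheorem3 {d : ℕ} {M : Type*} [TopologicalSpace M] [ChartedSpace (Cn d) M]
    [IsManifold 𝓘(ℂ, Cn d) ω M]
    (g : HermitianMetric d (Cn d) (HolTangent d : M → Type))
    {L : M → Type*} [∀ x, AddCommGroup (L x)] [∀ x, Module ℂ (L x)]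
    [TopologicalSpace (Bundle.TotalSpace ℂ L)] [∀ x, TopologicalSpace (L x)] [FiberBundle ℂ L]
    [VectorBundle ℂ ℂ L] [ContMDiffVectorBundle ω ℂ L 𝓘(ℂ, Cn d)]
    (h : HermitianMetric d ℂ L)
    (p : ℕ) (hp : 1 ≤ p) (hpd : p < d)
    (hgap : ∀ x : M, eigval g h (p + 1) x < eigval g h p x) :
    -- the coefficients of `Ψ` in a holomorphic frame are differentiable
    (∀ (z₀ : M) (I J : Set.powersetCard (Fin d) p),
      MDifferentiableAt 𝓘(ℝ, Cn d) 𝓘(ℝ, ℂ)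
        (endFormsCoeff (twistingSection g h p) (chartAt (Cn d) z₀) z₀ (unitaryFrame g z₀) I J) z₀) ∧
    -- the formula in coordinates that diagonalize `R` unitarily at `z₀`
    (∀ (z₀ : M), ∀ c ∈ IsManifold.maximalAtlas 𝓘(ℂ, Cn d) ω M, z₀ ∈ c.source →
      IsUnitaryFrame (g.form z₀) (coordVec c z₀) →
      (∀ i : Fin d, curvEnd g h z₀ (coordVec c z₀ i) =
        (eigval g h (i + 1) z₀ : ℂ) • coordVec c z₀ i) →
      normSqDbarEndForms g (twistingSection g h p) z₀ =
        ∑ i : Fin d, ∑ j : Fin d, if (i : ℕ) + 1 ≤ p ∧ p + 1 ≤ (j : ℕ) + 1 then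
          (eigval g h (i + 1) z₀ - eigval g h (j + 1) z₀) ^ (-2 : ℤ) *
            (normSqDbar g (curvCoeff g h c j i) z₀ + normSqDbar g (curvCoeff g h c i j) z₀)
        else 0) ∧
    -- the estimate
    (∀ z : M, normSqDbarEndForms g (twistingSection g h p) z ≤
      (eigval g h p z - eigval g h (p + 1) z) ^ (-2 : ℤ) * normSqDbarEnd g (curvEnd g h) z) ∧
    -- refinement (a)
    (∀ z : M, normSqDbarEndForms g (twistingSection g h p) z ≤
      (eigval g h p z - eigval g h (p + 1) z) ^ (-2 : ℤ) *
        (normSqDbarEnd g (curvEnd g h) z - 1 / (d : ℝ) * normSqDbar g (curvTrace g h) z)) ∧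
    -- refinement (b)
    (∀ z : M, curvNorm g h z ≠ 0 → normSqDbarEndForms g (twistingSection g h p) z ≤
      (eigval g h p z - eigval g h (p + 1) z) ^ (-2 : ℤ) *
        (normSqDbarEnd g (curvEnd g h) z -
          normSqDbar g (fun y => (curvNorm g h y : ℂ)) z)) := by
  have hc₀ := fun z : M => IsManifold.chart_mem_maximalAtlas (I := 𝓘(ℂ, Cn d)) (n := ω) z
  have hA := fun (z : M) e => differentiableAt_frameMatrix_spectralProj g h hp hpd (hgap z) e
  have hS := fun (z : M) e => differentiableAt_frameMatrix_curvEnd g h z e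
  have hlt : ∀ (z : M) (i j : Fin d), (i : ℕ) < p → p ≤ (j : ℕ) →
      eigval g h (j + 1) z < eigval g h (i + 1) z := fun z i j hi hj => by
    linarith [eigval_gap g h hp hpd z hi hj, hgap z]
  -- the common estimate, in a frame of eigenvectors at `z`
  have hle : ∀ z : M, ∀ k,
      hsNormSq (dbarMat (fun u => compound p (frameMatrix (chartAt (Cn d) z) z
        (curvEigenframe g h z) (spectralProj g h p) u)) (chartAt (Cn d) z z)
        (frameDirection g z k)) ≤ (eigval g h p z - eigval g h (p + 1) z) ^ (-2 : ℤ) *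
      (hsNormSq (dbarMat (frameMatrix (chartAt (Cn d) z) z (curvEigenframe g h z) (curvEnd g h))
        (chartAt (Cn d) z z) (frameDirection g z k)) -
        ∑ i, ‖dbarMat (frameMatrix (chartAt (Cn d) z) z (curvEigenframe g h z) (curvEnd g h))
          (chartAt (Cn d) z z) (frameDirection g z k) i i‖ ^ 2) := fun z k =>
    hsNormSq_dbarMat_compound_le hpd.le (hA z _) (hS z _) (frameMatrix_spectralProj_idem g h p)
      (frameMatrix_spectralProj_comm g h p)
      (frameMatrix_spectralProj_self g h hp hpd (hgap z) (curvEnd_curvEigenframe g h z))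
      (frameMatrix_curvEnd_self g h (curvEnd_curvEigenframe g h z)) (sub_pos.mpr (hgap z))
      fun i j hi hj => eigval_gap g h hp hpd z hi hj
  have hbound : ∀ (z : M) (r : Fin d → ℝ),
      (∀ k, r k ≤ ∑ i, ‖dbarMat (frameMatrix (chartAt (Cn d) z) z (curvEigenframe g h z)
        (curvEnd g h)) (chartAt (Cn d) z z) (frameDirection g z k) i i‖ ^ 2) →
      normSqDbarEndForms g (twistingSection g h p) z ≤
        (eigval g h p z - eigval g h (p + 1) z) ^ (-2 : ℤ) *
          (normSqDbarEnd g (curvEnd g h) z - ∑ k, r k) := by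
    intro z r hr
    have he := curvEigenframe_isUnitary g h z
    rw [normSqDbarEndForms_twistingSection g h hp hpd hgap z he, normSqDbarEnd_eq,
      normSqDbarMat_frameMatrix g (unitaryFrame_isUnitary g z) he (hS z _), normSqDbarMat,
      normSqDbarMat, ← Finset.sum_sub_distrib, Finset.mul_sum]
    refine Finset.sum_le_sum fun k _ => (hle z k).trans ?_
    gcongr
    exact hr k
  refine ⟨fun z I J => ?_, fun z c hc hz hu hlam => ?_, fun z => ?_, fun z => ?_, fun z h0 => ?_⟩
  · rw [mdifferentiableAt_iff_chart (hc₀ z) (mem_chart_source _ z)]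
    have h1 : endFormsCoeff (twistingSection g h p) (chartAt (Cn d) z) z (unitaryFrame g z) I J ∘
        (chartAt (Cn d) z).symm = fun u => compound p (frameMatrix (chartAt (Cn d) z) z
          (unitaryFrame g z) (spectralProj g h p) u) I J :=
      funext (endFormsCoeff_twistingSection g h hp hpd hgap _ z _ I J)
    rw [h1]
    exact differentiableAt_compound (hA z _) I J
  · obtain ⟨e, he⟩ := hu.exists_basis (finrank_holTangent z)
    rw [← he] at hu
    have hlam' : ∀ i : Fin d, curvEnd g h z (e i) = (eigval g h (i + 1) z : ℂ) • e i := fun i => by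
      rw [he]
      exact hlam i
    have hcoeff : ∀ i j, normSqDbar g (curvCoeff g h c j i) z =
        ∑ k, ‖dbarMat (frameMatrix (chartAt (Cn d) z) z e (curvEnd g h)) (chartAt (Cn d) z z)
          (frameDirection g z k) i j‖ ^ 2 := fun i j => by
      rw [normSqDbar_eq]
      exact Finset.sum_congr rfl fun k _ => by
        rw [dbarE_curvCoeff g h hc hz (fun i => congrFun he i)]
    rw [normSqDbarEndForms_twistingSection g h hp hpd hgap z hu, normSqDbarMat,
      Finset.sum_congr rfl fun k _ => hsNormSq_dbarMat_compound_spectralProj hpd.le (hA z e)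
        (hS z e) (frameMatrix_spectralProj_idem g h p) (frameMatrix_spectralProj_comm g h p)
        (frameMatrix_spectralProj_self g h hp hpd (hgap z) hlam')
        (frameMatrix_curvEnd_self g h hlam') (hlt z), Finset.sum_comm]
    refine Finset.sum_congr rfl fun i _ => ?_
    rw [Finset.sum_comm]
    refine Finset.sum_congr rfl fun j _ => ?_
    rw [hcoeff, hcoeff, ← Finset.sum_add_distrib, Finset.mul_sum]
    by_cases hij : (i : ℕ) < p ∧ p ≤ (j : ℕ)
    · simp only [if_pos hij]
      rw [if_pos (by omega)]
    · simp only [if_neg hij]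
      rw [if_neg (by omega), Finset.sum_const_zero]
  · simpa using hbound z (fun _ => 0) fun k => Finset.sum_nonneg fun i _ => sq_nonneg _
  · rw [normSqDbar_eq, Finset.mul_sum]
    refine hbound z _ fun k => ?_
    rw [dbarE_congr (curvTrace_eventuallyEq g h (e := curvEigenframe g h z)),
      dbarE_trace (hS z _)]
    exact norm_trace_sq_le _
  · rw [normSqDbar_eq]
    refine hbound z _ fun k => ?_
    refine norm_dbarE_sq_le (differentiableAt_curvNorm g h h0) ?_ (hS z _)
      (curvNorm_mul_self_eventuallyEq g h)
      (frameMatrix_curvEnd_self g h (curvEnd_curvEigenframe g h z))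
    rw [Function.comp_apply, (chartAt (Cn d) z).left_inv (mem_chart_source _ z)]
    exact_mod_cast h0
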